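/- **Setting.** For a parameter $\epsilon>0$ and a constant input $U\in\mathbb{R}^2$, consider on $\mathcal{X}=\mathbb{R}^2\times L^2((0,1);\mathbb{R}^2)$, with norm $\|(Z,\zeta)\|_{\mathcal X}^2=\|Z\|_2^2+\|\zeta\|_{L^2}^2$, the semilinear single-track model $$\dot X(t)=A_1X(t)+G_1\bigl[\mathscr K_1z(t)+\Sigma(\alpha)\mathscr K_2z(t)\bigr]+G_1h_1(\alpha)+b,$$ $$\epsilon\,\partial_tz(\xi,t)+\Lambda\,\partial_\xi z(\xi,t)=\Sigma(\alpha)\bigl[z(\xi,t)+\mathscr K_3z(t)\bigr]+\mathscr K_4z(t)+h_2(\alpha),\qquad z(0,t)=0,$$ for $\xi\in(0,1)$, $t>0$, where $\alpha=\alpha(X(t),U)=A_2X(t)+G_2U$. Here $A_1,A_2,G_1,G_2,K_5$ are real $2\times2$ matrices, $b\in\mathbb{R}^2$, $\Lambda$ is a symmetric positive definite $2\times 2$ matrix, $\Sigma:\mathbb{R}^2\to\mathbb{R}^{2\times2}$ and $h_1,h_2:\mathbb{R}^2\to\mathbb{R}^2$ are continuous, $K_1,\dots,K_4\in C^0([0,1];\mathbb{R}^{2\times2})$,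 $\mathscr K_i\zeta=\int_0^1K_i(\xi)\zeta(\xi)\,d\xi$ for $i=1,2,3$, and $\mathscr K_4\zeta=\int_0^1K_4(\xi)\zeta(\xi)\,d\xi+K_5\zeta(1)$. All these data do not depend on $\epsilon$. Let $\mathscr A\zeta=-\Lambda\,\partial_\xi\zeta+\mathscr K_4\zeta$ with domain $\{\zeta\in H^1((0,1);\mathbb{R}^2):\zeta(0)=0\}$. A (global) mild solution with initial condition $(X_0,z_0)\in\mathcal X$ is a function $(X,z)\in C^0(\mathbb{R}_{\ge0};\mathcal X)$ that satisfies the time-integrated first equation and, with $(T(t))_{t\ge0}$ the $C_0$-semigroup generated by $\mathscr A$, $$z(t)=T(t/\epsilon)z_0+\frac1\epsilon\int_0^tT\bigl((t-s)/\epsilon\bigr)\Bigl(\Sigma(\alpha)\bigl[z(s)+\mathscr K_3z(s)\bigr]+h_2(\alpha)\Bigr)ds,\qquad \alpha=\alpha(X(s),U),\ t\ge0.$$ **Assumptions.** 1. (Strict dissipativity) There are a continuous function $\mathscr Q$ on $[0,1]$ with values in the diagonal positive definite $2\times2$ matrices and $\omega>0$ such that $\langle\mathscr A\zeta,\mathscr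 Q\zeta\rangle_{L^2}\le-\omega\|\zeta\|_{L^2}^2$ for all $\zeta$ in the domain of $\mathscr A$. 2. (Dissipativity and Lipschitz continuity) For all $y\in\mathbb{R}^2$ and $\zeta\in L^2((0,1);\mathbb{R}^2)$, $\int_0^1\zeta(\xi)^{\mathrm T}\mathscr Q(\xi)\Sigma(y)[\zeta(\xi)+\mathscr K_3\zeta]\,d\xi\le0$; moreover $\Sigma$ is globally Lipschitz continuous. 3. (Regularity) For $y\in\mathbb{R}^2$ let $\varphi(\cdot,y)\in C^1([0,1];\mathbb{R}^2)$ be the solution (it exists and is unique under 1 and 2) of $$\Lambda\,\partial_\xi\varphi=\Sigma(y)[\varphi+\mathscr K_3\varphi]+\mathscr K_4\varphi+h_2(y)\ \text{ on }(0,1),\qquad\varphi(0,y)=0,$$ and let $\Phi(y)=\mathscr K_1\varphi(\cdot,y)+\Sigma(y)\mathscr K_2\varphi(\cdot,y)+h_1(y)$. Then $\varphi\in C^1([0,1]\times\mathbb{R}^2;\mathbb{R}^2)$, $\Phi\in C^1(\mathbb{R}^2;\mathbb{R}^2)$, and $\partial\varphi/\partial y$ is bounded on $[0,1]\times\mathbb{R}^2$.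 **Theorem.** Suppose 1, 2 and 3 hold. Let $(X^\star,U^\star)$ be an equilibrium, i.e. $A_1X^\star+G_1\Phi(\alpha^\star)+b=0$ with $\alpha^\star=A_2X^\star+G_2U^\star$, let $\tilde C(\alpha^\star)$ be the Jacobian matrix of $\Phi$ at $\alpha^\star$, and suppose that $\tilde A_1(\alpha^\star)=A_1+G_1\tilde C(\alpha^\star)A_2$ is Hurwitz (all its eigenvalues have negative real part). Then there are symmetric positive definite matrices $P$ with $\tilde A_1(\alpha^\star)^{\mathrm T}P+P\tilde A_1(\alpha^\star)=-2qI_2$ for some $q>0$, and for each such $P$ the following holds. Put $$V(Z,\zeta)=\tfrac12Z^{\mathrm T}PZ+\int_0^1\zeta(\xi)^{\mathrm T}\mathscr Q(\xi)\zeta(\xi)\,d\xi .$$ There are constants $\epsilon^*,r_\epsilon,\beta,\sigma>0$ such that for every $\epsilon\in(0,\epsilon^*)$ and every $(X_0,z_0)\in\mathcal X$ with $V(X_0-X^\star,\zeta_0)<r_\epsilon$, where $\zeta_0=z_0-\varphi(\cdot,\alpha(X_0,U^\star))$, the model with constant input $U=U^\star$ has a unique mild solution $(X,z)\in C^0(\mathbb{R}_{\ge0};\mathcal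 X)$ with initial condition $(X_0,z_0)$, and, with $\zeta(\cdot,t)=z(\cdot,t)-\varphi(\cdot,\alpha(X(t),U^\star))$, $$\|(X(t)-X^\star,\zeta(\cdot,t))\|_{\mathcal X}\le\beta e^{-\sigma t}\|(X_0-X^\star,\zeta_0)\|_{\mathcal X},\qquad t\ge0 .$$ -/

import Mathlib

open MeasureTheory Set Filter Topology
open scoped ContDiff

namespace SingleTrack

/-- Lebesgue measure on the open unit interval. -/
noncomputable abbrev unitMeasure : Measure ℝ := volume.restrict (Ioo (0 : ℝ) 1)

/-- The Euclidean plane `ℝ²`. -/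
abbrev Plane : Type := EuclideanSpace ℝ (Fin 2)

/-- Real `2 × 2` matrices. -/
abbrev Mat : Type := Matrix (Fin 2) (Fin 2) ℝ

/-- The Hilbert space `L²((0,1); ℝ²)`. -/
abbrev L2 : Type := Lp Plane 2 unitMeasure

/-- The state space `ℝ² × L²((0,1); ℝ²)`, with the norm `‖(Z, ζ)‖² = ‖Z‖² + ‖ζ‖²`. -/
abbrev StateSpace : Type := WithLp 2 (Plane × L2)

/-- The action of a matrix on the Euclidean plane; its norm is the induced operator norm. -/
noncomputable abbrev op (M : Mat) : Plane →L[ℝ] Plane :=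
  Matrix.toEuclideanCLM (n := Fin 2) (𝕜 := ℝ) M

/-- The data (coefficients) of the semilinear single-track model
`X' = A₁ X + G₁ [𝒦₁ z + Σ(α) 𝒦₂ z] + G₁ h₁(α) + b`,
`ε ∂ₜ z + Λ ∂_ξ z = Σ(α) [z + 𝒦₃ z] + 𝒦₄ z + h₂(α)`, `z(0,t) = 0`, with `α = A₂ X + G₂ U`,
`𝒦ᵢ z = ∫₀¹ Kᵢ(ξ) z(ξ) dξ` for `i = 1, 2, 3`, and `𝒦₄ z = ∫₀¹ K₄(ξ) z(ξ) dξ + K₅ z(1)`. -/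
structure Model where
  A₁ : Mat
  A₂ : Mat
  G₁ : Mat
  G₂ : Mat
  b : Plane
  /-- the transport velocities `Λ` -/
  Lam : Mat
  Lam_posDef : Lam.PosDef
  /-- the nonlinear source matrix `Σ` -/
  Sig : Plane → Mat
  Sig_continuous : Continuous Sig
  h₁ : Plane → Plane
  h₁_continuous : Continuous h₁
  h₂ : Plane → Plane
  h₂_continuous : Continuous h₂
  K₁ : ℝ → Mat
  K₁_continuousOn : ContinuousOn K₁ (Icc 0 1)
  K₂ : ℝ → Mat
  K₂_continuousOn : ContinuousOn K₂ (Icc 0 1)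
  K₃ : ℝ → Mat
  K₃_continuousOn : ContinuousOn K₃ (Icc 0 1)
  K₄ : ℝ → Mat
  K₄_continuousOn : ContinuousOn K₄ (Icc 0 1)
  K₅ : Mat

/-- The integral operator `f ↦ ∫₀¹ K(ξ) f(ξ) dξ`. -/
noncomputable def kernelInt (K : ℝ → Mat) (f : ℝ → Plane) : Plane :=
  ∫ ξ, op (K ξ) (f ξ) ∂unitMeasure

/-- `g` is the weak derivative of `ζ` on `(0,1)`. -/
def HasWeakDeriv (ζ g : L2) : Prop :=
  ∀ θ : ℝ → ℝ, ContDiff ℝ ∞ θ → HasCompactSupport θ → tsupport θ ⊆ Ioo 0 1 →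
    ∫ ξ, deriv θ ξ • ζ ξ ∂unitMeasure = -∫ ξ, θ ξ • g ξ ∂unitMeasure

/-- A one-parameter family `T t`, `t ≥ 0`, of bounded operators is a `C₀`-semigroup.
(The values at negative times are irrelevant.) -/
structure IsC0Semigroup (T : ℝ → L2 →L[ℝ] L2) : Prop where
  zero : T 0 = ContinuousLinearMap.id ℝ L2
  add : ∀ s t : ℝ, 0 ≤ s → 0 ≤ t → T (s + t) = (T s).comp (T t)
  tendsto_zero : ∀ ζ : L2, Tendsto (fun t => T t ζ) (𝓝[>] 0) (𝓝 ζ)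

namespace Model

variable (D : Model)

/-- The apparent slip angles `α(X,U) = A₂ X + G₂ U`. -/
noncomputable def slip (X U : Plane) : Plane := op D.A₂ X + op D.G₂ U

/-- The graph of the unbounded transport operator `𝒜 ζ = -Λ ∂_ξ ζ + 𝒦₄ ζ` with domain
`{ζ ∈ H¹((0,1);ℝ²) | ζ(0) = 0}`: `D.TransportGraph ζ w` says that `ζ` lies in the domain and
`𝒜 ζ = w`. Here `g` is the weak derivative of `ζ`, and `f` is its continuous representative,
which gives the boundary values `ζ(0)` and `ζ(1)`. -/
def TransportGraph (ζ w : L2) : Prop :=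
  ∃ (g : L2) (f : ℝ → Plane), HasWeakDeriv ζ g ∧ ContinuousOn f (Icc 0 1) ∧
    ζ =ᵐ[unitMeasure] f ∧ f 0 = 0 ∧
    w = -(op D.Lam).compLp g + Lp.const 2 unitMeasure (kernelInt D.K₄ ζ + op D.K₅ (f 1))

/-- `T` is the `C₀`-semigroup generated by `𝒜`: the infinitesimal generator of `T`, with its
domain, is exactly `𝒜`. -/
def Generates (T : ℝ → L2 →L[ℝ] L2) : Prop :=
  IsC0Semigroup T ∧ ∀ ζ w : L2, D.TransportGraph ζ w ↔
    Tendsto (fun t : ℝ => t⁻¹ • (T t ζ - ζ)) (𝓝[>] 0) (𝓝 w)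

/-- Right-hand side of the vehicle dynamics. -/
noncomputable def odeField (U : Plane) (w : StateSpace) : Plane :=
  op D.A₁ w.fst
    + op D.G₁ (kernelInt D.K₁ w.snd + op (D.Sig (D.slip w.fst U)) (kernelInt D.K₂ w.snd))
    + op D.G₁ (D.h₁ (D.slip w.fst U)) + D.b

/-- The source term `Σ(α) [z + 𝒦₃ z] + h₂(α)` of the bristle dynamics. -/
noncomputable def source (U : Plane) (w : StateSpace) : L2 :=
  (op (D.Sig (D.slip w.fst U))).compLp (w.snd + Lp.const 2 unitMeasure (kernelInt D.K₃ w.snd))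
    + Lp.const 2 unitMeasure (D.h₂ (D.slip w.fst U))

/-- `w = (X, z) ∈ C⁰([0,∞); ℝ² × L²)` is a global mild solution with perturbation parameter `ε`,
constant input `U` and initial state `w₀`: the variation of constants formula holds, where
`t ↦ T (t / ε)` is the `C₀`-semigroup generated by `ε⁻¹ 𝒜`. -/
def IsMildSolution (ε : ℝ) (U : Plane) (w₀ : StateSpace) (w : ℝ → StateSpace) : Prop :=
  ContinuousOn w (Ici 0) ∧ ∃ T : ℝ → L2 →L[ℝ] L2, D.Generates T ∧ ∀ t : ℝ, 0 ≤ t →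
    (w t).fst = w₀.fst + ∫ s in (0 : ℝ)..t, D.odeField U (w s) ∧
    (w t).snd = T (t / ε) w₀.snd
      + ε⁻¹ • ∫ s in (0 : ℝ)..t, T ((t - s) / ε) (D.source U (w s))

/-- `f ∈ C¹([0,1];ℝ²)` solves the stationary nonlocal equation
`Λ f' = Σ(y) [f + 𝒦₃ f] + 𝒦₄ f + h₂(y)` on `(0,1)` with `f(0) = 0`. -/
def IsSteadyProfile (y : Plane) (f : ℝ → Plane) : Prop :=
  ContDiffOn ℝ 1 f (Icc 0 1) ∧ f 0 = 0 ∧ ∀ ξ ∈ Ioo (0 : ℝ) 1,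
    op D.Lam (deriv f ξ) = op (D.Sig y) (f ξ + kernelInt D.K₃ f)
      + (kernelInt D.K₄ f + op D.K₅ (f 1)) + D.h₂ y

open Classical in
/-- The steady bristle profile `φ(·, y)` on `[0,1]`: the solution of the stationary nonlocal
equation (and `0` if there is none; the values outside `[0,1]` are irrelevant). -/
noncomputable def profile (y : Plane) : ℝ → Plane :=
  if h : ∃ f, D.IsSteadyProfile y f then h.choose else 0

theorem profile_contDiffOn (y : Plane) : ContDiffOn ℝ 1 (D.profile y) (Icc 0 1) := by
  unfold profile
  split_ifs with h
  · exact h.choose_spec.1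
  · exact contDiffOn_const

theorem profile_memLp (y : Plane) : MemLp (D.profile y) 2 unitMeasure := by
  have hc := (D.profile_contDiffOn y).continuousOn
  obtain ⟨C, hC⟩ := isCompact_Icc.exists_bound_of_continuousOn hc
  refine MemLp.of_bound
    ((hc.mono Ioo_subset_Icc_self).aestronglyMeasurable measurableSet_Ioo) C ?_
  filter_upwards [ae_restrict_mem measurableSet_Ioo] with ξ hξ
  exact hC ξ (Ioo_subset_Icc_self hξ)

/-- The steady profile as an element of `L²((0,1);ℝ²)`. -/
noncomputable def profileL2 (y : Plane) : L2 := (D.profile_memLp y).toLp (D.profile y)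

/-- The steady tire forces `Φ(y) = 𝒦₁ φ(·,y) + Σ(y) 𝒦₂ φ(·,y) + h₁(y)`. -/
noncomputable def steadyForce (y : Plane) : Plane :=
  kernelInt D.K₁ (D.profile y) + op (D.Sig y) (kernelInt D.K₂ (D.profile y)) + D.h₁ y

/-- The matrix of generalized cornering stiffnesses, i.e. the Jacobian of `Φ` at `y`. -/
noncomputable def cornering (y : Plane) : Mat :=
  Matrix.of fun i j => (fderiv ℝ D.steadyForce y (EuclideanSpace.single j 1)) i

/-- The matrix `A₁ + G₁ C̃(y) A₂` of the linearized reduced dynamics. -/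
noncomputable def reducedMatrix (y : Plane) : Mat := D.A₁ + D.G₁ * D.cornering y * D.A₂

/-- Strict dissipativity of the transport operator, with the diagonal weight `Q`. -/
def StrictlyDissipative (Q : ℝ → Mat) : Prop :=
  ContinuousOn Q (Icc 0 1) ∧ (∀ ξ ∈ Icc (0 : ℝ) 1, (Q ξ).IsDiag ∧ (Q ξ).PosDef) ∧
    ∃ κ : ℝ, 0 < κ ∧ ∀ ζ w : L2, D.TransportGraph ζ w →
      ∫ ξ, inner ℝ (w ξ) (op (Q ξ) (ζ ξ)) ∂unitMeasure ≤ -κ * ‖ζ‖ ^ 2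

/-- Dissipativity (with the weight `Q`) and global Lipschitz continuity of `Σ`. -/
def SourceDissipativeLipschitz (Q : ℝ → Mat) : Prop :=
  (∀ (y : Plane) (ζ : L2),
    ∫ ξ, inner ℝ (ζ ξ) (op (Q ξ) (op (D.Sig y) (ζ ξ + kernelInt D.K₃ ζ))) ∂unitMeasure ≤ 0) ∧
  ∃ L : ℝ, 0 ≤ L ∧ ∀ y₁ y₂ : Plane, ‖op (D.Sig y₁ - D.Sig y₂)‖ ≤ L * ‖y₁ - y₂‖

/-- `φ` and `Φ` are of class `C¹`, and `∂φ/∂y` is uniformly bounded. -/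
def SteadyRegular : Prop :=
  ContDiffOn ℝ 1 (fun p : ℝ × Plane => D.profile p.2 p.1) (Icc (0 : ℝ) 1 ×ˢ univ) ∧
  ContDiff ℝ 1 D.steadyForce ∧
  ∃ M : ℝ, 0 ≤ M ∧ ∀ ξ ∈ Icc (0 : ℝ) 1, ∀ y : Plane, ‖fderiv ℝ (fun v => D.profile v ξ) y‖ ≤ M

/-- `(X, U)` is an equilibrium: `A₁ X + G₁ Φ(α(X,U)) + b = 0` (the tire state at the
equilibrium is `φ(·, α(X,U))`). -/
def IsEquilibrium (X U : Plane) : Prop :=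
  op D.A₁ X + op D.G₁ (D.steadyForce (D.slip X U)) + D.b = 0

/-- The deviation `(X - X⋆, ζ)` with `ζ = z - φ(·, α(X, U))`. -/
noncomputable def deviation (Xs U : Plane) (w : StateSpace) : StateSpace :=
  WithLp.toLp 2 (w.fst - Xs, w.snd - D.profileL2 (D.slip w.fst U))

end Model

/-- A real matrix is Hurwitz if all its complex eigenvalues have negative real part. -/
def IsHurwitz (A : Mat) : Prop :=
  ∀ μ ∈ spectrum ℂ (A.map (algebraMap ℝ ℂ)), μ.re < 0

/-- `P` is symmetric positive definite and `Aᵀ P + P A = -2 q I` for some `q > 0`. -/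
def IsLyapunovMatrix (A P : Mat) : Prop :=
  P.PosDef ∧ ∃ q : ℝ, 0 < q ∧ A.transpose * P + P * A = -(2 * q) • (1 : Mat)

/-- The Lyapunov function `V(Z, ζ) = ½ Zᵀ P Z + ∫₀¹ ζ(ξ)ᵀ Q(ξ) ζ(ξ) dξ`. -/
noncomputable def lyapunov (P : Mat) (Q : ℝ → Mat) (δ : StateSpace) : ℝ :=
  (1 / 2) * inner ℝ δ.fst (op P δ.fst)
    + ∫ ξ, inner ℝ (δ.snd ξ) (op (Q ξ) (δ.snd ξ)) ∂unitMeasure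

end SingleTrack

open SingleTrack

/-!
The steady profiles `φ(·, α(X))` form a slow manifold of the model. The proof measures the distance
of the bristle state to this manifold and treats the vehicle dynamics as a small perturbation of the
reduced equation `X' = A₁ X + G₁ Φ(α) + b`, whose linearization at the equilibrium is Hurwitz.

*Semigroup.* The form `⟨ζ, 𝒬 ζ⟩` is an inner product equivalent to that of `L²`, and `𝒜` is strictly
dissipative for it. The equation `𝒜 ζ = -f` is solved by a primitive, the nonlocal term `𝒦₄ ζ`
being an unknown vector of `ℝ²`: this leaves a linear system of two equations, which is injective by
dissipativity (`exists_primitive_solution`). From this single resolvent the Lax–Milgram theorem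
gives all the others (`IsMaxDissipative.exists_resolvent`), and the Yosida approximations give the
semigroup (`IsMaxDissipative.exists_semigroup`), which decays exponentially in the weighted norm and
is determined by `𝒜`. A bounded dissipative perturbation of `𝒜` remains onto
(`IsMaxDissipative.surj_add`); hence the steady profile exists for every `y`.

*Well-posedness.* The coefficients `h₁` and `h₂` are only assumed continuous, but the steady
equation and the steady force express them by the profile, which is `C¹` in `y`; so the
nonlinearity is Lipschitz on bounded sets (`lipOnBounded_field`). Mild solutions are therefore
unique, and they exist globally once the nonlinearity is cut off outside of a large ball.

*Stability.* The profile `p(t) = φ(·, α(X(t)))` stays in the domain of `𝒜`. A mild solution is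
not differentiable, but comparing `z(t + h)` with `p(t)` by the variation of constants formula
bounds the right Dini derivative of `⟨ζ, 𝒬 ζ⟩`, with `ζ = z - p`
(`IsMild.exists_dini_bound`). Here the terms `𝒜 p` and `h₂` combine with the source to
`ε⁻¹ Σ(α) [ζ + 𝒦₃ ζ]`, which is dissipative, and the motion of `p` costs at most a multiple of
`‖ζ‖ ‖X'‖`. For small `ε` the damping `-(k / ε) ‖ζ‖²` dominates all the coupling terms, so that
the derivative of `V` is at most `-s V` on a small sublevel set (`exists_lyapunovRate_le`). A
barrier argument then shows that `V` decays exponentially and that the solution never reaches the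
region where the cutoff acts (`lyapunov_decay`, `exists_isMildSolution`).
-/

namespace SingleTrack

/-! ### Dissipative operators in a weighted inner product -/

variable {E : Type*} [NormedAddCommGroup E] [InnerProductSpace ℝ E]

/-- The square `⟨x, Q x⟩` of the norm weighted by `Q`. -/
noncomputable def wsq (Q : E →L[ℝ] E) (x : E) : ℝ := inner ℝ x (Q x)

/-- `Q` is symmetric and coercive with constant `c > 0`, so that `⟨x, Q y⟩` is an inner product
equivalent to the given one. -/
structure IsWeight (Q : E →L[ℝ] E) (c : ℝ) : Prop where
  pos : 0 < c
  symm : ∀ x y, inner ℝ x (Q y) = inner ℝ y (Q x)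
  coercive : ∀ x, c * ‖x‖ ^ 2 ≤ wsq Q x

/-- The linear relation `G` is the graph of an operator `A` that is strictly dissipative for the
inner product weighted by `Q`, with constant `κ`, and that maps its domain onto `E`. -/
structure IsMaxDissipative (Q : E →L[ℝ] E) (κ : ℝ) (G : Submodule ℝ (E × E)) : Prop where
  pos : 0 < κ
  diss : ∀ x y, (x, y) ∈ G → inner ℝ y (Q x) ≤ -κ * ‖x‖ ^ 2
  surj : ∀ f, ∃ x, (x, -f) ∈ G
  single : ∀ y, ((0 : E), y) ∈ G → y = 0

section Weight

variable {Q : E →L[ℝ] E} {c : ℝ}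

theorem wsq_le (Q : E →L[ℝ] E) (x : E) : wsq Q x ≤ ‖Q‖ * ‖x‖ ^ 2 := by
  have h1 := real_inner_le_norm x (Q x)
  have h2 := Q.le_opNorm x
  have h3 := mul_le_mul_of_nonneg_left h2 (norm_nonneg x)
  unfold wsq
  nlinarith

theorem inner_weight_le (Q : E →L[ℝ] E) (x y : E) : inner ℝ x (Q y) ≤ ‖Q‖ * (‖x‖ * ‖y‖) := by
  have h1 := real_inner_le_norm x (Q y)
  have h2 := Q.le_opNorm y
  have h3 := mul_le_mul_of_nonneg_left h2 (norm_nonneg x)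
  nlinarith

theorem IsWeight.wsq_add (hQ : IsWeight Q c) (x y : E) :
    wsq Q (x + y) = wsq Q x + 2 * inner ℝ x (Q y) + wsq Q y := by
  unfold wsq
  rw [map_add, inner_add_left, inner_add_right, inner_add_right, hQ.symm y x]
  ring

theorem IsWeight.wsq_sub (hQ : IsWeight Q c) (x y : E) :
    wsq Q (x - y) = wsq Q x - 2 * inner ℝ x (Q y) + wsq Q y := by
  unfold wsq
  rw [map_sub, inner_sub_left, inner_sub_right, inner_sub_right, hQ.symm y x]
  ring

theorem wsq_smul (Q : E →L[ℝ] E) (a : ℝ) (x : E) : wsq Q (a • x) = a ^ 2 * wsq Q x := by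
  unfold wsq
  rw [map_smul, inner_smul_left, inner_smul_right]
  simp
  ring

theorem IsWeight.wsq_nonneg (hQ : IsWeight Q c) (x : E) : 0 ≤ wsq Q x :=
  le_trans (by have := hQ.pos; positivity) (hQ.coercive x)

theorem IsWeight.eq_zero (hQ : IsWeight Q c) {x : E} (hx : wsq Q x ≤ 0) : x = 0 := by
  have h1 := hQ.coercive x
  have h2 : ‖x‖ ^ 2 ≤ 0 := by
    by_contra! h
    have := mul_pos hQ.pos h
    linarith
  have h3 : ‖x‖ = 0 := by nlinarith [norm_nonneg x]
  simpa using h3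

/-- A bound, at least `1`, for the comparison of the weighted norm with the given one. -/
noncomputable def weightBound (Q : E →L[ℝ] E) (c : ℝ) : ℝ := Real.sqrt (‖Q‖ / c) + 1

theorem weightBound_ge_one (Q : E →L[ℝ] E) (c : ℝ) : 1 ≤ weightBound Q c := by
  unfold weightBound
  linarith [Real.sqrt_nonneg (‖Q‖ / c)]

theorem weightBound_pos (Q : E →L[ℝ] E) (c : ℝ) : 0 < weightBound Q c :=
  lt_of_lt_of_le one_pos (weightBound_ge_one Q c)

theorem IsWeight.norm_le (hQ : IsWeight Q c) {x y : E} (h : wsq Q x ≤ wsq Q y) :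
    ‖x‖ ≤ weightBound Q c * ‖y‖ := by
  have h1 := hQ.coercive x
  have h2 := wsq_le Q y
  have hc := hQ.pos
  have h3 : ‖x‖ ^ 2 ≤ (Real.sqrt (‖Q‖ / c) * ‖y‖) ^ 2 := by
    rw [mul_pow, Real.sq_sqrt (by positivity), div_mul_eq_mul_div, le_div_iff₀ hc]
    linarith
  have h4 := abs_le_of_sq_le_sq h3 (by positivity)
  rw [abs_of_nonneg (norm_nonneg x)] at h4
  unfold weightBound
  nlinarith [norm_nonneg y]

theorem IsWeight.opNorm_le (hQ : IsWeight Q c) {T : E →L[ℝ] E} (h : ∀ x, wsq Q (T x) ≤ wsq Q x) :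
    ‖T‖ ≤ weightBound Q c :=
  T.opNorm_le_bound (weightBound_pos Q c).le fun x => hQ.norm_le (h x)

theorem continuous_wsq (Q : E →L[ℝ] E) : Continuous (wsq Q) := by
  unfold wsq
  fun_prop

/-- The bound `κ ‖x‖²` on the dissipation, in terms of the weighted norm. -/
theorem weight_diss_le {κ : ℝ} (hκ : 0 < κ) (Q : E →L[ℝ] E) (x : E) :
    κ / (‖Q‖ + 1) * wsq Q x ≤ κ * ‖x‖ ^ 2 := by
  have h1 := wsq_le Q x
  have h0 := norm_nonneg Q
  have h2 : wsq Q x ≤ (‖Q‖ + 1) * ‖x‖ ^ 2 := by nlinarith [sq_nonneg ‖x‖]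
  calc κ / (‖Q‖ + 1) * wsq Q x ≤ κ / (‖Q‖ + 1) * ((‖Q‖ + 1) * ‖x‖ ^ 2) := by gcongr
    _ = κ * ‖x‖ ^ 2 := by field_simp

variable [CompleteSpace E]

/-- The Lax–Milgram theorem. -/
theorem surjective_of_coercive_form (S : E →L[ℝ] E) {a : ℝ} (ha : 0 < a)
    (h : ∀ x, a * ‖x‖ ^ 2 ≤ inner ℝ x (S x)) : Function.Surjective S := by
  let B : E →L[ℝ] E →L[ℝ] ℝ := (innerSL ℝ).comp S
  have hB : IsCoercive B := by
    refine ⟨a, ha, fun u => ?_⟩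
    have := h u
    rw [real_inner_comm] at this
    simpa [B, pow_two, mul_assoc] using this
  intro f
  refine ⟨(hB.continuousLinearEquivOfBilin).symm f, ?_⟩
  refine ext_inner_right ℝ fun v => ?_
  have := hB.continuousLinearEquivOfBilin_apply ((hB.continuousLinearEquivOfBilin).symm f) v
  rw [ContinuousLinearEquiv.apply_symm_apply] at this
  rw [this]
  simp [B]

theorem IsWeight.surjective (hQ : IsWeight Q c) : Function.Surjective Q :=
  surjective_of_coercive_form Q hQ.pos hQ.coercive

/-- The Lax–Milgram theorem for the weighted inner product. -/
theorem IsWeight.surjective_of_coercive (hQ : IsWeight Q c) (S : E →L[ℝ] E) {a : ℝ} (ha : 0 < a)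
    (h : ∀ x, a * wsq Q x ≤ inner ℝ (S x) (Q x)) : Function.Surjective S := by
  have hs : Function.Surjective (Q.comp S) := by
    refine surjective_of_coercive_form _ (mul_pos ha hQ.pos) fun x => ?_
    rw [ContinuousLinearMap.comp_apply, hQ.symm]
    have := mul_le_mul_of_nonneg_left (hQ.coercive x) ha.le
    linarith [h x]
  intro f
  obtain ⟨x, hx⟩ := hs (Q f)
  refine ⟨x, ?_⟩
  rw [← sub_eq_zero]
  apply hQ.eq_zero
  have : Q (S x - f) = 0 := by rw [map_sub]; simpa [sub_eq_zero] using hx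
  simp [wsq, this]

end Weight

section Dissipative

variable {Q : E →L[ℝ] E} {c κ : ℝ} {G : Submodule ℝ (E × E)}

theorem IsMaxDissipative.eq_of_resolvent (hG : IsMaxDissipative Q κ G) (hQ : IsWeight Q c)
    {l : ℝ} (hl : 0 ≤ l) {x x' f : E} (hx : (x, l • x - f) ∈ G) (hx' : (x', l • x' - f) ∈ G) :
    x = x' := by
  have h := G.sub_mem hx hx'
  have h' : (x - x', l • (x - x')) ∈ G := by
    convert h using 1
    ext <;> simp [smul_sub]
  have h1 := hG.diss _ _ h'
  rw [inner_smul_left] at h1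
  have h2 := mul_nonneg hl (hQ.wsq_nonneg (x - x'))
  simp only [wsq, conj_trivial] at h1 h2
  have h3 : ‖x - x'‖ ^ 2 ≤ 0 := by
    by_contra! h
    have := mul_pos hG.pos h
    linarith
  have h4 : ‖x - x'‖ = 0 := by nlinarith [norm_nonneg (x - x')]
  rw [norm_eq_zero] at h4
  exact sub_eq_zero.1 h4

theorem IsMaxDissipative.norm_resolvent_le (hG : IsMaxDissipative Q κ G) (hQ : IsWeight Q c)
    {l : ℝ} (hl : 0 ≤ l) {x f : E} (hx : (x, l • x - f) ∈ G) : ‖x‖ ≤ ‖Q‖ / κ * ‖f‖ := by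
  have h1 := hG.diss _ _ hx
  rw [inner_sub_left, inner_smul_left] at h1
  have h2 := mul_nonneg hl (hQ.wsq_nonneg x)
  simp only [wsq, conj_trivial] at h1 h2
  have h3 := inner_weight_le Q f x
  have h4 : κ * ‖x‖ ^ 2 ≤ ‖Q‖ * (‖f‖ * ‖x‖) := by linarith
  rw [div_mul_eq_mul_div, le_div_iff₀ hG.pos]
  rcases (norm_nonneg x).eq_or_lt with h | h
  · rw [← h, zero_mul]
    exact mul_nonneg (norm_nonneg _) (norm_nonneg _)
  · nlinarith

/-- The resolvent `(l - A)⁻¹` as a bounded operator, as soon as `l - A` is onto. -/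
theorem IsMaxDissipative.exists_clm (hG : IsMaxDissipative Q κ G) (hQ : IsWeight Q c)
    {l : ℝ} (hl : 0 ≤ l) (h : ∀ f, ∃ x, (x, l • x - f) ∈ G) :
    ∃ R : E →L[ℝ] E, ∀ f, (R f, l • R f - f) ∈ G := by
  choose R hR using h
  let R' : E →ₗ[ℝ] E :=
    { toFun := R
      map_add' := fun f g => by
        refine hG.eq_of_resolvent hQ hl (hR _) ?_
        convert G.add_mem (hR f) (hR g) using 1
        ext <;> simp [smul_add]; abel
      map_smul' := fun a f => by
        refine hG.eq_of_resolvent hQ hl (hR _) ?_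
        convert G.smul_mem a (hR f) using 1
        ext <;> simp [smul_sub, smul_comm a l] }
  exact ⟨R'.mkContinuous (‖Q‖ / κ) fun f => hG.norm_resolvent_le hQ hl (hR f), hR⟩

/-- Expand `|f|² = |l x - A x|²` in the weighted norm and drop `|A x|²`. -/
theorem IsMaxDissipative.wsq_resolvent_le (hG : IsMaxDissipative Q κ G) (hQ : IsWeight Q c)
    {l : ℝ} (hl : 0 ≤ l) {x f : E} (hx : (x, l • x - f) ∈ G) :
    l ^ 2 * wsq Q x + 2 * l * (κ * ‖x‖ ^ 2) ≤ wsq Q f := by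
  have h1 := hG.diss _ _ hx
  have h2 : f = l • x - (l • x - f) := by abel
  have h3 : wsq Q f = l ^ 2 * wsq Q x - 2 * (l * inner ℝ (l • x - f) (Q x))
      + wsq Q (l • x - f) := by
    conv_lhs => rw [h2]
    rw [hQ.wsq_sub, wsq_smul, hQ.symm, map_smul, inner_smul_right]
  have h4 := hQ.wsq_nonneg (l • x - f)
  have h5 := mul_le_mul_of_nonneg_left h1 hl
  rw [h3]
  linarith

variable [CompleteSpace E]

/-- All the resolvents `(l - A)⁻¹`, `l ≥ 0`, exist: with `R₀ = (-A)⁻¹`, the equation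
`l x - A x = f` reads `x + l R₀ x = R₀ f`, and `1 + l R₀` is coercive. -/
theorem IsMaxDissipative.exists_resolvent (hG : IsMaxDissipative Q κ G) (hQ : IsWeight Q c)
    {l : ℝ} (hl : 0 ≤ l) : ∃ R : E →L[ℝ] E, ∀ f, (R f, l • R f - f) ∈ G := by
  obtain ⟨R, hR⟩ := hG.exists_clm hQ le_rfl (fun f => by simpa using hG.surj f)
  simp only [zero_smul, zero_sub] at hR
  refine hG.exists_clm hQ hl fun f => ?_
  have hs : Function.Surjective (ContinuousLinearMap.id ℝ E + l • R) := by
    refine hQ.surjective_of_coercive _ one_pos fun x => ?_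
    have h1 := hG.diss _ _ (hR x)
    rw [inner_neg_left, hQ.symm] at h1
    have h2 : 0 ≤ inner ℝ (R x) (Q x) := by
      have := mul_nonneg hG.pos.le (sq_nonneg ‖R x‖)
      linarith
    simp only [add_apply, ContinuousLinearMap.id_apply,
      smul_apply, inner_add_left, inner_smul_left, conj_trivial, wsq]
    have := mul_nonneg hl h2
    linarith
  obtain ⟨x, hx⟩ := hs (R f)
  refine ⟨x, ?_⟩
  simp only [add_apply, ContinuousLinearMap.id_apply,
      smul_apply] at hx
  have hx' : x = R (f - l • x) := by rw [map_sub, map_smul, ← hx]; abel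
  have := hR (f - l • x)
  rw [← hx'] at this
  simpa using this

/-- The domain of a maximal dissipative operator is dense. -/
theorem IsMaxDissipative.dense_domain (hG : IsMaxDissipative Q κ G) (hQ : IsWeight Q c) (x : E)
    {δ : ℝ} (hδ : 0 < δ) : ∃ y z, (y, z) ∈ G ∧ ‖x - y‖ < δ := by
  let K : Submodule ℝ E := G.map (LinearMap.fst ℝ E E)
  have hK : K.topologicalClosure = ⊤ := by
    rw [Submodule.topologicalClosure_eq_top_iff, Submodule.eq_bot_iff]
    intro u hu
    obtain ⟨v, rfl⟩ := hQ.surjective u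
    obtain ⟨R, hR⟩ := hG.exists_resolvent hQ zero_le_one
    rw [Submodule.mem_orthogonal] at hu
    have h1 : inner ℝ (R v) (Q v) = 0 := hu _ ⟨_, hR v, rfl⟩
    have h2 := hG.diss _ _ (hR v)
    rw [one_smul, inner_sub_left, hQ.symm v, h1] at h2
    have h3 : wsq Q (R v) ≤ 0 := by
      have := mul_nonneg hG.pos.le (sq_nonneg ‖R v‖)
      simp only [wsq]
      linarith
    have h4 := hQ.eq_zero h3
    have h5 := hR v
    rw [h4, smul_zero, zero_sub] at h5
    have h6 := hG.single _ h5
    rw [neg_eq_zero] at h6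
    rw [h6, map_zero]
  have hx : x ∈ K.topologicalClosure := hK ▸ Submodule.mem_top
  obtain ⟨y, hy, hxy⟩ := Metric.mem_closure_iff.1 hx δ hδ
  obtain ⟨⟨y', z⟩, hz, rfl⟩ := hy
  exact ⟨y', z, hz, by simpa [dist_eq_norm] using hxy⟩

/-- If `B` is bounded and dissipative, `A + B` is onto: for large `m` the operator
`(m - A)⁻¹ (m + B)` is a strict contraction of the weighted norm, and `-(A + B) x = h` reads
`x - (m - A)⁻¹ (m + B) x = (m - A)⁻¹ h`. -/
theorem IsMaxDissipative.surj_add (hG : IsMaxDissipative Q κ G) (hQ : IsWeight Q c)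
    (B : E →L[ℝ] E) (hB : ∀ x, inner ℝ (B x) (Q x) ≤ 0) (h : E) :
    ∃ x, (x, -(B x + h)) ∈ G := by
  have hκ := hG.pos
  have hc := hQ.pos
  set k := κ / (‖Q‖ + 1) with hk
  have hk0 : 0 < k := by positivity
  set b := ‖Q‖ * ‖B‖ ^ 2 / c with hb
  have hb0 : 0 ≤ b := by positivity
  have hbx : ∀ x, wsq Q (B x) ≤ b * wsq Q x := by
    intro x
    have h1 := wsq_le Q (B x)
    have h2 := B.le_opNorm x
    calc wsq Q (B x) ≤ ‖Q‖ * ‖B x‖ ^ 2 := h1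
      _ ≤ ‖Q‖ * (‖B‖ * ‖x‖) ^ 2 := by gcongr
      _ = b * (c * ‖x‖ ^ 2) := by rw [hb]; field_simp
      _ ≤ b * wsq Q x := by gcongr; exact hQ.coercive x
  -- with this `m` the gain `2 m k` of the resolvent exceeds the loss `b` caused by `B`
  set m := (b + 1) / (2 * k) with hm
  have hm0 : 0 < m := by positivity
  obtain ⟨R, hR⟩ := hG.exists_resolvent hQ hm0.le
  set d := m ^ 2 + b + 1 with hd
  have hd0 : 0 < d := by positivity
  have hs : Function.Surjective
      (ContinuousLinearMap.id ℝ E - R.comp (m • ContinuousLinearMap.id ℝ E + B)) := by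
    refine hQ.surjective_of_coercive _ (a := 1 / (2 * d)) (by positivity) fun x => ?_
    set f := m • x + B x with hf
    have e : (ContinuousLinearMap.id ℝ E - R.comp (m • ContinuousLinearMap.id ℝ E + B)) x
      = x - R f := by simp [hf]
    rw [e, inner_sub_left]
    have h1 := hG.wsq_resolvent_le hQ hm0.le (hR f)
    have h2 := weight_diss_le hκ Q (R f)
    rw [← hk] at h2
    have h3 : wsq Q f ≤ (m ^ 2 + b) * wsq Q x := by
      rw [hf, hQ.wsq_add, wsq_smul, inner_smul_left, hQ.symm, conj_trivial]
      have := mul_nonneg hm0.le (neg_nonneg.2 (hB x))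
      have := hbx x
      linarith
    have h4 : 2 * m * k = b + 1 := by rw [hm]; field_simp
    have h5 : d * wsq Q (R f) ≤ (m ^ 2 + b) * wsq Q x := by
      have h6 := mul_le_mul_of_nonneg_left h2 (by positivity : 0 ≤ 2 * m)
      have h7 : 2 * m * (k * wsq Q (R f)) = (b + 1) * wsq Q (R f) := by rw [← h4]; ring
      rw [hd]
      linarith
    have h6 := hQ.wsq_nonneg (x - R f)
    rw [hQ.wsq_sub, hQ.symm] at h6
    have h7 : wsq Q (R f) ≤ (m ^ 2 + b) * wsq Q x / d := by
      rw [le_div_iff₀ hd0]; linarith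
    have h8 : (m ^ 2 + b) * wsq Q x / d = wsq Q x - 1 / d * wsq Q x := by
      rw [hd]; field_simp; ring
    have h9 : 1 / (2 * d) * wsq Q x = 1 / d * wsq Q x / 2 := by field_simp
    have h10 : inner ℝ x (Q x) = wsq Q x := rfl
    linarith
  obtain ⟨x, hx⟩ := hs (R h)
  refine ⟨x, ?_⟩
  have hx' : R (m • x + B x + h) = x := by
    have e : x - R (m • x + B x) = R h := by simpa using hx
    rw [map_add, ← e]; abel
  have := hR (m • x + B x + h)
  rw [hx'] at this
  convert this using 2
  abel

end Dissipative

end SingleTrack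

namespace SingleTrack

/-! ### Generation of the semigroup -/

section HilleYosida

variable {E : Type*} [NormedAddCommGroup E] [InnerProductSpace ℝ E]

/-- `T` is a `C₀`-semigroup on `[0,∞)` and `G` is the graph of its generator. -/
structure IsSemigroupOf (T : ℝ → E →L[ℝ] E) (G : Submodule ℝ (E × E)) : Prop where
  zero : T 0 = ContinuousLinearMap.id ℝ E
  add : ∀ s t : ℝ, 0 ≤ s → 0 ≤ t → T (s + t) = (T s).comp (T t)
  tendsto_zero : ∀ x : E, Tendsto (fun t => T t x) (𝓝[>] 0) (𝓝 x)
  generator : ∀ x y : E,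
    (x, y) ∈ G ↔ Tendsto (fun t : ℝ => t⁻¹ • (T t x - x)) (𝓝[>] 0) (𝓝 y)

/-- The Yosida approximation `l (l R - 1)` of `A`, where `R = (l - A)⁻¹`. -/
noncomputable def yosida (l : ℝ) (R : E →L[ℝ] E) : E →L[ℝ] E := l • (l • R - 1)

/-- The group generated by a bounded operator. -/
noncomputable def expFlow (A : E →L[ℝ] E) (t : ℝ) : E →L[ℝ] E := NormedSpace.exp (t • A)

theorem expFlow_zero (A : E →L[ℝ] E) : expFlow A 0 = 1 := by
  simp [expFlow]

theorem commute_expFlow {A B : E →L[ℝ] E} (h : Commute A B) (t : ℝ) :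
    Commute A (expFlow B t) :=
  (h.smul_right t).exp_right

section

variable [CompleteSpace E]

theorem hasDerivAt_expFlow (A : E →L[ℝ] E) (t : ℝ) :
    HasDerivAt (expFlow A) (expFlow A t * A) t :=
  hasDerivAt_exp_smul_const A t

theorem hasDerivAt_expFlow' (A : E →L[ℝ] E) (t : ℝ) :
    HasDerivAt (expFlow A) (A * expFlow A t) t :=
  hasDerivAt_exp_smul_const' A t

theorem expFlow_add (A : E →L[ℝ] E) (s t : ℝ) :
    expFlow A (s + t) = expFlow A s * expFlow A t := by
  let _ : NormedAlgebra ℚ (E →L[ℝ] E) := NormedAlgebra.restrictScalars ℚ ℝ (E →L[ℝ] E)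
  unfold expFlow
  rw [add_smul]
  exact NormedSpace.exp_add_of_commute (((Commute.refl A).smul_left s).smul_right t)

theorem hasDerivAt_expFlow_apply (A : E →L[ℝ] E) (x : E) (t : ℝ) :
    HasDerivAt (fun t => expFlow A t x) (expFlow A t (A x)) t := by
  simpa using (hasDerivAt_expFlow A t).clm_apply (hasDerivAt_const t x)

end

variable {Q : E →L[ℝ] E} {c κ : ℝ} {G : Submodule ℝ (E × E)}

/-- The Yosida approximations are dissipative in the weighted inner product. -/
theorem IsMaxDissipative.inner_yosida_le (hG : IsMaxDissipative Q κ G) (hQ : IsWeight Q c)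
    {l : ℝ} (hl : 0 < l) {R : E →L[ℝ] E} (hR : ∀ f, (R f, l • R f - f) ∈ G) (u : E) :
    inner ℝ (yosida l R u) (Q u) ≤ 0 := by
  have h1 := hG.diss _ _ (hR u)
  set v := R u
  set y := l • v - u with hy
  have e1 : yosida l R u = l • y := by simp [yosida, hy, v]
  have e2 : Q u = l • Q v - Q y := by
    rw [← map_smul, ← map_sub]; congr 1; rw [hy]; abel
  rw [e1, e2, inner_smul_left, inner_sub_right, inner_smul_right, conj_trivial]
  have h2 := hQ.wsq_nonneg y
  unfold wsq at h2
  have h3 : inner ℝ y (Q v) ≤ 0 := h1.trans (by nlinarith [hG.pos, sq_nonneg ‖v‖])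
  have h4 := mul_nonpos_of_nonneg_of_nonpos hl.le h3
  exact mul_nonpos_of_nonneg_of_nonpos hl.le (by linarith)

theorem IsMaxDissipative.wsq_yosida_flow_le [CompleteSpace E] (hG : IsMaxDissipative Q κ G)
    (hQ : IsWeight Q c) {l : ℝ} (hl : 0 < l) {R : E →L[ℝ] E}
    (hR : ∀ f, (R f, l • R f - f) ∈ G) {t : ℝ} (ht : 0 ≤ t) (x : E) :
    wsq Q (expFlow (yosida l R) t x) ≤ wsq Q x := by
  set A := yosida l R
  have hd : ∀ t, HasDerivAt (fun t => wsq Q (expFlow A t x))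
      (2 * inner ℝ (A (expFlow A t x)) (Q (expFlow A t x))) t := by
    intro t
    have h1 : HasDerivAt (fun t => expFlow A t x) (A (expFlow A t x)) t := by
      simpa using (hasDerivAt_expFlow' A t).clm_apply (hasDerivAt_const t x)
    have h2 := h1.inner ℝ (Q.hasFDerivAt.comp_hasDerivAt t h1)
    refine h2.congr_deriv ?_
    rw [hQ.symm (expFlow A t x), Function.comp_apply]
    ring
  have h := antitone_of_hasDerivAt_nonpos hd fun t => by
    have : inner ℝ (A (expFlow A t x)) (Q (expFlow A t x)) ≤ 0 := hG.inner_yosida_le hQ hl hR _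
    rw [Pi.zero_apply]
    linarith
  simpa [expFlow_zero] using h ht

/-- Resolvents commute, by the resolvent identity. -/
theorem IsMaxDissipative.commute_resolvent (hG : IsMaxDissipative Q κ G) (hQ : IsWeight Q c)
    {l m : ℝ} (hl : 0 ≤ l) (hm : 0 ≤ m) {R S : E →L[ℝ] E}
    (hR : ∀ f, (R f, l • R f - f) ∈ G) (hS : ∀ f, (S f, m • S f - f) ∈ G) : Commute R S := by
  have key : ∀ {l m : ℝ} (_ : 0 ≤ l) {R S : E →L[ℝ] E}
      (_ : ∀ f, (R f, l • R f - f) ∈ G) (_ : ∀ f, (S f, m • S f - f) ∈ G) (f : E),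
      S f = R f + (l - m) • R (S f) := by
    intro l m hl R S hR hS f
    rw [← map_smul, ← map_add]
    refine hG.eq_of_resolvent hQ hl (f := f + (l - m) • S f) ?_ (hR _)
    convert hS f using 2
    module
  ext f
  rw [mul_apply_eq_comp, mul_apply_eq_comp]
  rcases eq_or_ne l m with rfl | h
  · have : ∀ f, R f = S f := fun f => hG.eq_of_resolvent hQ hl (hR f) (hS f)
    simp [this]
  · have h1 := key hl hR hS f
    have h2 := key hm hS hR f
    have h3 : (l - m) • (R (S f) - S (R f)) = 0 := by
      have e1 : S f - R f = (l - m) • R (S f) := by rw [sub_eq_iff_eq_add']; exact h1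
      have e2 : R f - S f = (m - l) • S (R f) := by rw [sub_eq_iff_eq_add']; exact h2
      have e3 : (l - m) • (R (S f) - S (R f)) = (l - m) • R (S f) + (m - l) • S (R f) := by
        module
      rw [e3, ← e1, ← e2]
      abel
    rw [smul_eq_zero, sub_eq_zero, sub_eq_zero] at h3
    exact h3.resolve_left h

theorem commute_yosida {l m : ℝ} {R S : E →L[ℝ] E} (h : Commute R S) :
    Commute (yosida l R) (yosida m S) := by
  unfold yosida
  refine ((Commute.sub_left ?_ ?_).smul_left l)
  · refine (Commute.sub_right ?_ ?_).smul_right m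
    · exact (h.smul_left l).smul_right m
    · exact Commute.one_right _
  · exact Commute.one_left _

theorem IsMaxDissipative.yosida_apply (hG : IsMaxDissipative Q κ G) (hQ : IsWeight Q c)
    {l : ℝ} (hl : 0 ≤ l) {R : E →L[ℝ] E} (hR : ∀ f, (R f, l • R f - f) ∈ G) {x y : E}
    (h : (x, y) ∈ G) : yosida l R x = l • R y := by
  have h1 : R (l • x - y) = x :=
    hG.eq_of_resolvent hQ hl (hR _) (by convert h using 2; abel)
  rw [map_sub, map_smul] at h1
  have : yosida l R x = l • (l • R x - x) := by simp [yosida]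
  rw [this]
  congr 1
  rw [sub_eq_iff_eq_add] at h1 ⊢
  rw [h1, add_comm]

theorem IsMaxDissipative.norm_smul_resolvent_le (hG : IsMaxDissipative Q κ G) (hQ : IsWeight Q c)
    {l : ℝ} (hl : 0 ≤ l) {R : E →L[ℝ] E} (hR : ∀ f, (R f, l • R f - f) ∈ G) (x : E) :
    ‖l • R x‖ ≤ weightBound Q c * ‖x‖ := by
  refine hQ.norm_le ?_
  rw [wsq_smul]
  have := hG.wsq_resolvent_le hQ hl (hR x)
  have h2 : 0 ≤ 2 * l * (κ * ‖R x‖ ^ 2) := by have := hG.pos; positivity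
  linarith

variable [CompleteSpace E]

theorem IsMaxDissipative.norm_yosida_flow_le (hG : IsMaxDissipative Q κ G)
    (hQ : IsWeight Q c) {l : ℝ} (hl : 0 < l) {R : E →L[ℝ] E}
    (hR : ∀ f, (R f, l • R f - f) ∈ G) {t : ℝ} (ht : 0 ≤ t) (x : E) :
    ‖expFlow (yosida l R) t x‖ ≤ weightBound Q c * ‖x‖ :=
  hQ.norm_le (hG.wsq_yosida_flow_le hQ hl hR ht x)

/-- Two bounded flows with commuting generators differ by at most `C² t ‖A x - B x‖`. -/
theorem norm_expFlow_sub_le {A B : E →L[ℝ] E} (h : Commute A B) {C t : ℝ} (hC : 0 ≤ C)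
    (ht : 0 ≤ t) (hA : ∀ s, 0 ≤ s → ∀ x, ‖expFlow A s x‖ ≤ C * ‖x‖)
    (hB : ∀ s, 0 ≤ s → ∀ x, ‖expFlow B s x‖ ≤ C * ‖x‖) (x : E) :
    ‖expFlow A t x - expFlow B t x‖ ≤ C * (C * ‖A x - B x‖) * t := by
  have hd : ∀ s, HasDerivAt (fun s => (expFlow B (t - s) * expFlow A s) x)
      ((expFlow B (t - s) * expFlow A s) (A x - B x)) s := by
    intro s
    have h1 : HasDerivAt (fun s : ℝ => t - s) (-1) s := by
      simpa using (hasDerivAt_id s).const_sub t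
    have h2 := (hasDerivAt_expFlow B (t - s)).scomp s h1
    have h3 := h2.mul (hasDerivAt_expFlow A s)
    have h4 := h3.clm_apply (hasDerivAt_const s x)
    refine h4.congr_deriv ?_
    have h5 : ∀ x, B (expFlow A s x) = expFlow A s (B x) := fun x => by
      have := commute_expFlow h.symm s
      exact DFunLike.congr_fun this.eq x
    simp [h5]
    abel
  have := norm_image_sub_le_of_norm_deriv_le_segment' (a := 0) (b := t)
    (C := C * (C * ‖A x - B x‖)) (fun s _ => (hd s).hasDerivWithinAt) (fun s hs => by
      rw [mul_apply_eq_comp]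
      refine (hB _ (by linarith [hs.2]) _).trans ?_
      gcongr
      exact hA _ hs.1 _) t ⟨ht, le_rfl⟩
  simpa [expFlow_zero] using this

/-- The operators `l (l - A)⁻¹` converge strongly to the identity as `l → ∞`. -/
theorem IsMaxDissipative.tendsto_smul_resolvent (hG : IsMaxDissipative Q κ G)
    (hQ : IsWeight Q c) {R : ℕ → E →L[ℝ] E}
    (hR : ∀ n f, (R n f, ((n : ℝ) + 1) • R n f - f) ∈ G) (y : E) :
    Tendsto (fun n : ℕ => ((n : ℝ) + 1) • R n y) atTop (𝓝 y) := by
  set M := weightBound Q c with hM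
  have hM1 : 1 ≤ M := weightBound_ge_one Q c
  rw [Metric.tendsto_atTop]
  intro ε hε
  obtain ⟨x, z, hxz, hx⟩ := hG.dense_domain hQ y (δ := ε / (2 * (M + 1))) (by positivity)
  obtain ⟨N, hN⟩ := exists_nat_gt (2 * (M * ‖z‖) / ε)
  refine ⟨N, fun n hn => ?_⟩
  have hn0 : (0 : ℝ) < (n : ℝ) + 1 := by positivity
  have h1 := hG.norm_smul_resolvent_le hQ hn0.le (hR n) (y - x)
  have h2 := hG.norm_smul_resolvent_le hQ hn0.le (hR n) z
  have h3 := hG.yosida_apply hQ hn0.le (hR n) hxz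
  have h4 : ((n : ℝ) + 1) • R n x - x = R n z := by
    have : yosida ((n : ℝ) + 1) (R n) x = ((n : ℝ) + 1) • (((n : ℝ) + 1) • R n x - x) := by
      simp [yosida]
    rw [this] at h3
    exact smul_right_injective E hn0.ne' h3
  have h5 : ‖R n z‖ < ε / 2 := by
    rw [norm_smul, Real.norm_of_nonneg hn0.le] at h2
    have h6 : 2 * (M * ‖z‖) < ((n : ℝ) + 1) * ε := by
      rw [div_lt_iff₀ hε] at hN
      have : (N : ℝ) ≤ n := by exact_mod_cast hn
      nlinarith
    by_contra! h7
    nlinarith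
  rw [dist_eq_norm]
  have e : ((n : ℝ) + 1) • R n y - y = ((n : ℝ) + 1) • R n (y - x)
      + (((n : ℝ) + 1) • R n x - x) - (y - x) := by
    rw [map_sub]; module
  rw [e, h4]
  have h8 : (M + 1) * ‖y - x‖ < ε / 2 := by
    have := mul_lt_mul_of_pos_left hx (by positivity : 0 < M + 1)
    refine this.trans_eq ?_
    field_simp
  have h9 := norm_sub_le (((n : ℝ) + 1) • R n (y - x) + R n z) (y - x)
  have h10 := norm_add_le (((n : ℝ) + 1) • R n (y - x)) (R n z)
  linarith

/-- The Hille–Yosida theorem for operators that are strictly dissipative in a weighted inner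
product: the flows of the Yosida approximations converge strongly. -/
theorem IsMaxDissipative.exists_semigroup (hG : IsMaxDissipative Q κ G) (hQ : IsWeight Q c) :
    ∃ T : ℝ → E →L[ℝ] E, IsSemigroupOf T G := by
  have hn0 : ∀ n : ℕ, (0 : ℝ) < (n : ℝ) + 1 := fun n => by positivity
  choose R hR using fun n : ℕ => hG.exists_resolvent hQ (hn0 n).le
  set M := weightBound Q c with hM
  have hM1 : 1 ≤ M := weightBound_ge_one Q c
  have hM0 : 0 ≤ M := by linarith
  set A : ℕ → E →L[ℝ] E := fun n => yosida ((n : ℝ) + 1) (R n) with hA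
  have hAx : ∀ n {x y : E}, (x, y) ∈ G → A n x = ((n : ℝ) + 1) • R n y := fun n x y h =>
    hG.yosida_apply hQ (hn0 n).le (hR n) h
  have hJ := fun y => hG.tendsto_smul_resolvent hQ hR y
  have hJb : ∀ (n : ℕ) (y : E), ‖((n : ℝ) + 1) • R n y‖ ≤ M * ‖y‖ := fun n y =>
    hG.norm_smul_resolvent_le hQ (hn0 n).le (hR n) y
  have hU : ∀ n t, 0 ≤ t → ∀ x, ‖expFlow (A n) t x‖ ≤ M * ‖x‖ := fun n t ht x =>
    hG.norm_yosida_flow_le hQ (hn0 n) (hR n) ht x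
  have hcomm : ∀ n m, Commute (A n) (A m) := fun n m =>
    commute_yosida (hG.commute_resolvent hQ (hn0 n).le (hn0 m).le (hR n) (hR m))
  -- strong convergence of the approximating flows
  have hcauchy : ∀ t, 0 ≤ t → ∀ x, CauchySeq fun n => expFlow (A n) t x := by
    intro t ht x
    rw [Metric.cauchySeq_iff]
    intro ε hε
    obtain ⟨x', y, hy, hx'⟩ := hG.dense_domain hQ x (δ := ε / (4 * M)) (by positivity)
    obtain ⟨N, hN⟩ := Metric.cauchySeq_iff.1 (hJ y).cauchySeq (ε / (2 * (M * M * t + 1)))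
      (by positivity)
    refine ⟨N, fun n hn m hm => ?_⟩
    have h1 := norm_expFlow_sub_le (hcomm n m) hM0 ht (hU n) (hU m) x'
    rw [hAx n hy, hAx m hy] at h1
    have h2 := hN n hn m hm
    rw [dist_eq_norm] at h2 ⊢
    have h3 : M * (M * ‖((n : ℝ) + 1) • R n y - ((m : ℝ) + 1) • R m y‖) * t < ε / 2 := by
      rw [lt_div_iff₀ (by positivity)] at h2
      nlinarith [norm_nonneg (((n : ℝ) + 1) • R n y - ((m : ℝ) + 1) • R m y)]
    have h4 := hU n t ht (x - x')
    have h5 := hU m t ht (x - x')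
    have h6 : M * ‖x - x'‖ < ε / 4 := by
      have := mul_lt_mul_of_pos_left hx' (by positivity : 0 < M)
      refine this.trans_eq ?_
      field_simp
    have e : expFlow (A n) t x - expFlow (A m) t x = (expFlow (A n) t x' - expFlow (A m) t x')
        + expFlow (A n) t (x - x') - expFlow (A m) t (x - x') := by
      rw [map_sub, map_sub]; abel
    rw [e]
    have h7 := norm_sub_le ((expFlow (A n) t x' - expFlow (A m) t x')
        + expFlow (A n) t (x - x')) (expFlow (A m) t (x - x'))
    have h8 := norm_add_le (expFlow (A n) t x' - expFlow (A m) t x') (expFlow (A n) t (x - x'))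
    linarith
  have hlim : ∀ t, 0 ≤ t → ∃ S : E →L[ℝ] E,
      ∀ x, Tendsto (fun n => expFlow (A n) t x) atTop (𝓝 (S x)) := by
    intro t ht
    choose f hf using fun x => cauchySeq_tendsto_of_complete (hcauchy t ht x)
    exact ⟨continuousLinearMapOfTendsto (fun n => expFlow (A n) t) (f := f)
      (tendsto_pi_nhds.2 hf), hf⟩
  choose! T hT using hlim
  have hTb : ∀ t, 0 ≤ t → ∀ x, wsq Q (T t x) ≤ wsq Q x := fun t ht x =>
    le_of_tendsto (((continuous_wsq Q).tendsto _).comp (hT t ht x)) (Eventually.of_forall fun n =>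
      hG.wsq_yosida_flow_le hQ (hn0 n) (hR n) ht x)
  have hTM : ∀ t, 0 ≤ t → ∀ x, ‖T t x‖ ≤ M * ‖x‖ := fun t ht x => hQ.norm_le (hTb t ht x)
  have hUsub : ∀ n t, 0 ≤ t → ∀ {x y : E}, (x, y) ∈ G →
      ‖expFlow (A n) t x - x‖ ≤ M * (M * ‖y‖) * t := by
    intro n t ht x y hxy
    have := norm_image_sub_le_of_norm_deriv_le_segment' (a := 0) (b := t)
      (C := M * (M * ‖y‖)) (fun s _ => (hasDerivAt_expFlow_apply (A n) x s).hasDerivWithinAt)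
      (fun s hs => by
        refine (hU n s hs.1 _).trans ?_
        rw [hAx n hxy]
        gcongr
        exact hJb n y) t ⟨ht, le_rfl⟩
    simpa [expFlow_zero] using this
  have hTsub : ∀ t, 0 ≤ t → ∀ {x y : E}, (x, y) ∈ G → ‖T t x - x‖ ≤ M * (M * ‖y‖) * t :=
    fun t ht x y hxy => le_of_tendsto ((hT t ht x).sub_const x).norm
      (Eventually.of_forall fun n => hUsub n t ht hxy)
  have hT0 : ∀ x, Tendsto (fun t => T t x) (𝓝[>] 0) (𝓝 x) := by
    intro x
    rw [Metric.tendsto_nhds]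
    intro ε hε
    obtain ⟨x', y, hy, hx'⟩ := hG.dense_domain hQ x (δ := ε / (2 * (M + 1))) (by positivity)
    have hpos : 0 < ε / (2 * (M * (M * ‖y‖) + 1)) := by positivity
    filter_upwards [Ioo_mem_nhdsGT hpos] with t ht
    have h1 := hTsub t ht.1.le hy
    have h2 := hTM t ht.1.le (x - x')
    have h3 : M * (M * ‖y‖) * t < ε / 2 := by
      have h4 := ht.2
      rw [lt_div_iff₀ (by positivity)] at h4
      nlinarith [ht.1]
    have h5 : (M + 1) * ‖x - x'‖ < ε / 2 := by
      have := mul_lt_mul_of_pos_left hx' (by positivity : 0 < M + 1)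
      refine this.trans_eq ?_
      field_simp
    have e : T t x - x = (T t x' - x') + T t (x - x') - (x - x') := by rw [map_sub]; abel
    rw [dist_eq_norm, e]
    have h7 := norm_sub_le ((T t x' - x') + T t (x - x')) (x - x')
    have h8 := norm_add_le (T t x' - x') (T t (x - x'))
    linarith
  have hgen : ∀ t, 0 ≤ t → ∀ {x y y' z : E}, (x, y) ∈ G → (y', z) ∈ G →
      ‖T t x - x - t • y‖ ≤ (M * (M * ‖z‖) * t + (M + 1) * ‖y - y'‖) * t := by
    intro t ht x y y' z hxy hyz
    have hn : ∀ n, ‖expFlow (A n) t x - x - t • y‖ ≤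
        (M * ‖((n : ℝ) + 1) • R n y - y‖ + (M * (M * ‖z‖) * t + (M + 1) * ‖y - y'‖)) * t := by
      intro n
      have hd : ∀ s, HasDerivAt (fun s => expFlow (A n) s x - s • y)
          (expFlow (A n) s (A n x) - y) s := fun s => by
        have h := (hasDerivAt_expFlow_apply (A n) x s).sub ((hasDerivAt_id s).smul_const y)
        rw [one_smul] at h
        exact h
      have := norm_image_sub_le_of_norm_deriv_le_segment' (a := 0) (b := t)
        (C := M * ‖((n : ℝ) + 1) • R n y - y‖ + (M * (M * ‖z‖) * t + (M + 1) * ‖y - y'‖))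
        (fun s _ => (hd s).hasDerivWithinAt)
        (fun s hs => by
          rw [hAx n hxy]
          have e : expFlow (A n) s (((n : ℝ) + 1) • R n y) - y
              = expFlow (A n) s (((n : ℝ) + 1) • R n y - y) + ((expFlow (A n) s y' - y')
                + expFlow (A n) s (y - y') - (y - y')) := by
            simp only [map_sub]; abel
          rw [e]
          have h1 := hU n s hs.1 (((n : ℝ) + 1) • R n y - y)
          have h2 := hU n s hs.1 (y - y')
          have h3 := hUsub n s hs.1 hyz
          have h3' : M * (M * ‖z‖) * s ≤ M * (M * ‖z‖) * t := by
            have := hs.2.le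
            gcongr
          have h4 := norm_add_le (expFlow (A n) s (((n : ℝ) + 1) • R n y - y))
            ((expFlow (A n) s y' - y') + expFlow (A n) s (y - y') - (y - y'))
          have h5 := norm_sub_le ((expFlow (A n) s y' - y') + expFlow (A n) s (y - y')) (y - y')
          have h6 := norm_add_le (expFlow (A n) s y' - y') (expFlow (A n) s (y - y'))
          linarith) t ⟨ht, le_rfl⟩
      simp only [expFlow_zero, one_apply_eq_self, zero_smul, sub_zero] at this
      rwa [sub_right_comm] at this
    have h1 : Tendsto (fun n : ℕ =>
        (M * ‖((n : ℝ) + 1) • R n y - y‖ + (M * (M * ‖z‖) * t + (M + 1) * ‖y - y'‖)) * t) atTop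
        (𝓝 ((M * ‖y - y‖ + (M * (M * ‖z‖) * t + (M + 1) * ‖y - y'‖)) * t)) :=
      ((((hJ y).sub_const y).norm.const_mul M).add_const _).mul_const t
    have h2 := le_of_tendsto_of_tendsto (((hT t ht x).sub_const x).sub_const (t • y)).norm h1
      (Eventually.of_forall hn)
    simpa using h2
  have hfwd : ∀ {x y : E}, (x, y) ∈ G →
      Tendsto (fun t : ℝ => t⁻¹ • (T t x - x)) (𝓝[>] 0) (𝓝 y) := by
    intro x y hxy
    rw [Metric.tendsto_nhds]
    intro ε hε
    obtain ⟨y', z, hz, hy'⟩ := hG.dense_domain hQ y (δ := ε / (2 * (M + 1))) (by positivity)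
    have hpos : 0 < ε / (2 * (M * (M * ‖z‖) + 1)) := by positivity
    filter_upwards [Ioo_mem_nhdsGT hpos] with t ht
    have ht0 : 0 < t := ht.1
    have h1 := hgen t ht0.le hxy hz
    have h3 : M * (M * ‖z‖) * t < ε / 2 := by
      have h4 := ht.2
      rw [lt_div_iff₀ (by positivity)] at h4
      nlinarith [ht.1]
    have h5 : (M + 1) * ‖y - y'‖ < ε / 2 := by
      have := mul_lt_mul_of_pos_left hy' (by positivity : 0 < M + 1)
      refine this.trans_eq ?_
      field_simp
    have e : t⁻¹ • (T t x - x) - y = t⁻¹ • (T t x - x - t • y) := by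
      rw [smul_sub _ _ (t • y), inv_smul_smul₀ ht0.ne']
    rw [dist_eq_norm, e, norm_smul, norm_inv, Real.norm_of_nonneg ht0.le,
      inv_mul_lt_iff₀ ht0]
    refine h1.trans_lt ?_
    rw [mul_comm t]
    gcongr
    linarith
  refine ⟨T, ⟨?_, ?_, hT0, fun x y => ⟨hfwd, fun h => ?_⟩⟩⟩
  · ext x
    refine tendsto_nhds_unique (hT 0 le_rfl x) ?_
    simp [expFlow_zero]
  · intro s t hs ht
    ext x
    refine tendsto_nhds_unique (hT (s + t) (by positivity) x) ?_
    rw [ContinuousLinearMap.comp_apply]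
    have h1 := hT s hs (T t x)
    have h2 : Tendsto (fun n => expFlow (A n) s (expFlow (A n) t x - T t x)) atTop (𝓝 0) := by
      refine squeeze_zero_norm (fun n => hU n s hs _) ?_
      simpa using (((hT t ht x).sub_const (T t x)).norm.const_mul M)
    have h3 := h2.add h1
    rw [zero_add] at h3
    refine h3.congr fun n => ?_
    rw [expFlow_add, mul_apply_eq_comp, ← map_add]
    congr 1
    abel
  · -- the generator is dissipative, so that it cannot properly extend `A`
    obtain ⟨R1, hR1⟩ := hG.exists_resolvent hQ zero_le_one
    have hmem := hR1 (x - y)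
    have h2 := h.sub (hfwd hmem)
    set x' := R1 (x - y) with hx'
    have h3 : Tendsto (fun t : ℝ => t⁻¹ • (T t (x - x') - (x - x'))) (𝓝[>] 0)
        (𝓝 (x - x')) := by
      convert h2 using 2 with t
      · rw [map_sub, ← smul_sub]; congr 1; abel
      · rw [one_smul]; abel
    have h4 : Tendsto (fun t : ℝ => inner ℝ (t⁻¹ • (T t (x - x') - (x - x'))) (Q (x - x')))
        (𝓝[>] 0) (𝓝 (wsq Q (x - x'))) := h3.inner tendsto_const_nhds
    have h5 : wsq Q (x - x') ≤ 0 := by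
      refine le_of_tendsto h4 ?_
      filter_upwards [self_mem_nhdsWithin] with t ht
      have ht0 : (0 : ℝ) < t := ht
      rw [inner_smul_left, conj_trivial, inner_sub_left]
      refine mul_nonpos_of_nonneg_of_nonpos (by positivity) ?_
      have h6 := hQ.wsq_nonneg (T t (x - x') - (x - x'))
      rw [hQ.wsq_sub] at h6
      have h7 := hTb t ht0.le (x - x')
      have h8 : wsq Q (x - x') = inner ℝ (x - x') (Q (x - x')) := rfl
      linarith
    have h6 := sub_eq_zero.1 (hQ.eq_zero h5)
    rw [one_smul, ← h6] at hmem
    simpa using hmem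

end HilleYosida

end SingleTrack

namespace SingleTrack

/-! ### Decay, uniqueness and energy estimates for semigroups -/

section Semigroup

variable {E : Type*} [NormedAddCommGroup E] [InnerProductSpace ℝ E]
variable {Q : E →L[ℝ] E} {c κ : ℝ} {G : Submodule ℝ (E × E)} {T S : ℝ → E →L[ℝ] E}

/-- The exponential decay rate, in the weighted norm, of the semigroup generated by a strictly
dissipative operator with constant `κ`. -/
noncomputable def decayRate (Q : E →L[ℝ] E) (κ : ℝ) : ℝ := κ / (‖Q‖ + 1)

theorem IsSemigroupOf.tendsto_nonneg (hT : IsSemigroupOf T G) (x : E) :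
    Tendsto (fun t => T t x) (𝓝[≥] 0) (𝓝 x) := by
  rw [← Ioi_insert, nhdsWithin_insert]
  have h := tendsto_pure_nhds (fun t => T t x) 0
  simp only [hT.zero, ContinuousLinearMap.id_apply] at h
  exact h.sup (hT.tendsto_zero x)

/-- A `C₀`-semigroup is bounded near `0`, by the uniform boundedness principle. -/
theorem IsSemigroupOf.exists_bound_near_zero [CompleteSpace E] (hT : IsSemigroupOf T G) :
    ∃ δ > 0, ∃ C, 1 ≤ C ∧ ∀ t ∈ Icc 0 δ, ‖T t‖ ≤ C := by
  by_contra! h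
  have h' : ∀ n : ℕ, ∃ t ∈ Icc (0 : ℝ) (1 / ((n : ℝ) + 1)), (n : ℝ) + 1 < ‖T t‖ := fun n =>
    h (1 / ((n : ℝ) + 1)) (by positivity) ((n : ℝ) + 1) (by linarith [n.cast_nonneg (α := ℝ)])
  choose t ht hn using h'
  have ht0 : Tendsto t atTop (𝓝[≥] 0) := by
    rw [tendsto_nhdsWithin_iff]
    exact ⟨squeeze_zero (fun n => (ht n).1) (fun n => (ht n).2)
      tendsto_one_div_add_atTop_nhds_zero_nat, Eventually.of_forall fun n => (ht n).1⟩
  obtain ⟨C, hC⟩ := banach_steinhaus (g := fun n => T (t n)) fun x => by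
    have h1 := ((hT.tendsto_nonneg x).comp ht0).norm
    obtain ⟨C, hC⟩ := h1.bddAbove_range
    exact ⟨C, fun n => hC ⟨n, rfl⟩⟩
  obtain ⟨n, hCn⟩ := exists_nat_gt C
  have := hn n
  have := hC n
  linarith

theorem IsSemigroupOf.exists_bound [CompleteSpace E] (hT : IsSemigroupOf T G) (τ : ℝ) :
    ∃ K, ∀ t ∈ Icc 0 τ, ‖T t‖ ≤ K := by
  obtain ⟨δ, hδ, C, hC1, hC⟩ := hT.exists_bound_near_zero
  have key : ∀ n : ℕ, ∀ t ∈ Icc 0 ((n : ℝ) * δ), ‖T t‖ ≤ C ^ (n + 1) := by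
    intro n
    induction n with
    | zero =>
      intro t ht
      rw [Nat.cast_zero, zero_mul] at ht
      simpa using hC t ⟨ht.1, ht.2.trans hδ.le⟩
    | succ n ih =>
      intro t ht
      push_cast at ht
      rcases le_total t δ with h | h
      · exact (hC t ⟨ht.1, h⟩).trans (le_self_pow₀ hC1 (by omega))
      · have h1 := hT.add δ (t - δ) hδ.le (by linarith)
        rw [add_sub_cancel] at h1
        rw [h1, pow_succ' C (n + 1)]
        refine ((T δ).opNorm_comp_le _).trans ?_
        have h2 := ih (t - δ) ⟨by linarith, by linarith [ht.2]⟩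
        have h3 := hC δ ⟨hδ.le, le_rfl⟩
        gcongr
  obtain ⟨n, hn⟩ := exists_nat_gt (τ / δ)
  rw [div_lt_iff₀ hδ] at hn
  exact ⟨_, fun t ht => key n t ⟨ht.1, ht.2.trans hn.le⟩⟩

theorem IsSemigroupOf.continuousOn [CompleteSpace E] (hT : IsSemigroupOf T G) (x : E) :
    ContinuousOn (fun t => T t x) (Ici 0) := by
  intro t ht
  obtain ⟨K, hK⟩ := hT.exists_bound (t + 1)
  have key : ∀ s r, 0 ≤ s → s ≤ r → r ≤ t + 1 → ‖T r x - T s x‖ ≤ K * ‖T (r - s) x - x‖ := by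
    intro s r hs hsr hr
    have h1 := hT.add s (r - s) hs (by linarith)
    rw [add_sub_cancel] at h1
    rw [h1, ContinuousLinearMap.comp_apply, ← map_sub]
    refine ((T s).le_opNorm _).trans ?_
    gcongr
    exact hK s ⟨hs, by linarith⟩
  have habs : Tendsto (fun s : ℝ => |s - t|) (𝓝[≥] t ⊔ 𝓝[Ici 0] t) (𝓝[≥] 0) := by
    rw [tendsto_nhdsWithin_iff]
    refine ⟨?_, Eventually.of_forall fun s => mem_Ici.2 (abs_nonneg _)⟩
    have : Tendsto (fun s : ℝ => |s - t|) (𝓝 t) (𝓝 |t - t|) :=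
      (continuous_abs.comp (continuous_sub_right t)).tendsto t
    rw [sub_self, abs_zero] at this
    exact this.mono_left (sup_le nhdsWithin_le_nhds nhdsWithin_le_nhds)
  have h2 : Tendsto (fun s => K * ‖T |s - t| x - x‖) (𝓝[Ici 0] t) (𝓝 0) := by
    have := ((hT.tendsto_nonneg x).comp (habs.mono_left le_sup_right)).sub_const x
    simpa using this.norm.const_mul K
  rw [ContinuousWithinAt, tendsto_iff_norm_sub_tendsto_zero]
  refine squeeze_zero' (Eventually.of_forall fun s => norm_nonneg _) ?_ h2
  have h3 : ∀ᶠ s in 𝓝[Ici 0] t, s < t + 1 :=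
    nhdsWithin_le_nhds (Iio_mem_nhds (by linarith))
  filter_upwards [self_mem_nhdsWithin, h3] with s hs hs1
  rcases le_total t s with h | h
  · rw [abs_of_nonneg (by linarith)]
    exact key t s ht h hs1.le
  · rw [abs_of_nonpos (by linarith), neg_sub, norm_sub_rev]
    exact key s t hs h (by linarith)

theorem IsSemigroupOf.mem_graph (hT : IsSemigroupOf T G) {x y : E} (h : (x, y) ∈ G) {t : ℝ}
    (ht : 0 ≤ t) : (T t x, T t y) ∈ G := by
  rw [hT.generator]
  refine (((T t).continuous.tendsto y).comp ((hT.generator x y).1 h)).congr' ?_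
  filter_upwards [self_mem_nhdsWithin] with s hs
  have h1 := hT.add t s ht (le_of_lt hs)
  have h2 := hT.add s t (le_of_lt hs) ht
  rw [add_comm s t, h1] at h2
  rw [Function.comp_apply, map_smul, map_sub, ← ContinuousLinearMap.comp_apply, h2]
  rfl

theorem IsSemigroupOf.hasDerivWithinAt (hT : IsSemigroupOf T G) {x y : E} (h : (x, y) ∈ G)
    {t : ℝ} (ht : 0 ≤ t) : HasDerivWithinAt (fun t => T t x) (T t y) (Ici t) t := by
  rw [← hasDerivWithinAt_Ioi_iff_Ici, hasDerivWithinAt_iff_tendsto_slope' (by simp)]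
  have h1 : Tendsto (fun s : ℝ => s - t) (𝓝[>] t) (𝓝[>] 0) := by
    rw [tendsto_nhdsWithin_iff]
    refine ⟨?_, ?_⟩
    · have : Tendsto (fun s : ℝ => s - t) (𝓝 t) (𝓝 (t - t)) := (continuous_sub_right t).tendsto t
      rw [sub_self] at this
      exact this.mono_left nhdsWithin_le_nhds
    · filter_upwards [self_mem_nhdsWithin] with s hs
      exact mem_Ioi.2 (sub_pos.2 (mem_Ioi.1 hs))
  refine (((T t).continuous.tendsto y).comp (((hT.generator x y).1 h).comp h1)).congr' ?_
  filter_upwards [self_mem_nhdsWithin] with s hs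
  have h2 := hT.add t (s - t) ht (sub_nonneg.2 (le_of_lt hs))
  rw [add_sub_cancel] at h2
  simp [slope_def_module, h2]

/-- Strong solutions of `u' = A u` decay exponentially in the weighted norm. -/
theorem IsMaxDissipative.energy_decay (hG : IsMaxDissipative Q κ G) (hQ : IsWeight Q c)
    {u w : ℝ → E} (hu : ContinuousOn u (Ici 0)) (hw : ∀ t, 0 ≤ t → (u t, w t) ∈ G)
    (hd : ∀ t, 0 ≤ t → HasDerivWithinAt u (w t) (Ici t) t) {t : ℝ} (ht : 0 ≤ t) :
    wsq Q (u t) ≤ Real.exp (-(2 * decayRate Q κ) * t) * wsq Q (u 0) := by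
  set k := decayRate Q κ with hk
  have hd' : ∀ s ∈ Ico 0 t, HasDerivWithinAt (fun s => Real.exp (2 * k * s) * wsq Q (u s))
      (Real.exp (2 * k * s) * (2 * k * wsq Q (u s) + 2 * inner ℝ (w s) (Q (u s)))) (Ici s) s := by
    intro s hs
    have h1 := hd s hs.1
    have h2 := h1.inner ℝ (Q.hasFDerivAt.comp_hasDerivWithinAt s h1)
    have h3 : HasDerivAt (fun s : ℝ => Real.exp (2 * k * s)) (Real.exp (2 * k * s) * (2 * k)) s :=
      by simpa using ((hasDerivAt_id s).const_mul (2 * k)).exp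
    refine (h3.hasDerivWithinAt.mul h2).congr_deriv ?_
    rw [hQ.symm (u s), Function.comp_apply, wsq]
    ring
  have h := image_le_of_deriv_right_le_deriv_boundary (a := 0) (b := t) (B' := fun _ => 0)
    (B := fun _ => Real.exp (2 * k * 0) * wsq Q (u 0))
    (ContinuousOn.mul (by fun_prop)
      ((continuous_wsq Q).comp_continuousOn (hu.mono Icc_subset_Ici_self))) hd' le_rfl
    continuousOn_const (fun s _ => hasDerivWithinAt_const _ _ _) (fun s hs => by
      refine mul_nonpos_of_nonneg_of_nonpos (Real.exp_pos _).le ?_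
      have h1 := hG.diss _ _ (hw s hs.1)
      have h2 := weight_diss_le hG.pos Q (u s)
      rw [hk, decayRate]
      linarith) ⟨ht, le_rfl⟩
  rw [mul_zero, Real.exp_zero, one_mul] at h
  rw [neg_mul, Real.exp_neg, le_inv_mul_iff₀ (Real.exp_pos _)]
  exact h

variable [CompleteSpace E]

/-- A semigroup is determined by its generator. -/
theorem IsSemigroupOf.unique (hG : IsMaxDissipative Q κ G) (hQ : IsWeight Q c)
    (hT : IsSemigroupOf T G) (hS : IsSemigroupOf S G) {t : ℝ} (ht : 0 ≤ t) : T t = S t := by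
  have key : ∀ x y, (x, y) ∈ G → T t x = S t x := by
    intro x y h
    have h1 := hG.energy_decay hQ (u := fun t => T t x - S t x) (w := fun t => T t y - S t y)
      ((hT.continuousOn x).sub (hS.continuousOn x))
      (fun t ht => G.sub_mem (hT.mem_graph h ht) (hS.mem_graph h ht))
      (fun t ht => (hT.hasDerivWithinAt h ht).sub (hS.hasDerivWithinAt h ht)) ht
    rw [hT.zero, hS.zero, sub_self] at h1
    have h2 : wsq Q (0 : E) = 0 := by simp [wsq]
    rw [h2, mul_zero] at h1
    exact sub_eq_zero.1 (hQ.eq_zero h1)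
  ext x
  have hcl : IsClosed {x | T t x = S t x} := isClosed_eq (T t).continuous (S t).continuous
  have : x ∈ closure {x | T t x = S t x} := by
    rw [Metric.mem_closure_iff]
    intro ε hε
    obtain ⟨x', y, hy, hx'⟩ := hG.dense_domain hQ x hε
    exact ⟨x', key x' y hy, by rwa [dist_eq_norm]⟩
  rw [hcl.closure_eq] at this
  exact this

/-- The decay of strong solutions extends to all initial values, by density of the domain. -/
theorem IsSemigroupOf.wsq_le (hG : IsMaxDissipative Q κ G) (hQ : IsWeight Q c)
    (hT : IsSemigroupOf T G) {t : ℝ} (ht : 0 ≤ t) (x : E) :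
    wsq Q (T t x) ≤ Real.exp (-(2 * decayRate Q κ) * t) * wsq Q x := by
  have hcl : IsClosed {x | wsq Q (T t x) ≤ Real.exp (-(2 * decayRate Q κ) * t) * wsq Q x} :=
    isClosed_le ((continuous_wsq Q).comp (T t).continuous) ((continuous_wsq Q).const_mul _)
  have : x ∈ closure {x | wsq Q (T t x) ≤ Real.exp (-(2 * decayRate Q κ) * t) * wsq Q x} := by
    rw [Metric.mem_closure_iff]
    intro ε hε
    obtain ⟨x', y, h, hx'⟩ := hG.dense_domain hQ x hε
    refine ⟨x', ?_, by rwa [dist_eq_norm]⟩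
    have := hG.energy_decay hQ (hT.continuousOn x') (fun t ht => hT.mem_graph h ht)
      (fun t ht => hT.hasDerivWithinAt h ht) ht
    simpa [hT.zero] using this
  rw [hcl.closure_eq] at this
  exact this

theorem IsSemigroupOf.norm_le (hG : IsMaxDissipative Q κ G) (hQ : IsWeight Q c)
    (hT : IsSemigroupOf T G) {t : ℝ} (ht : 0 ≤ t) : ‖T t‖ ≤ weightBound Q c := by
  refine hQ.opNorm_le fun x => (hT.wsq_le hG hQ ht x).trans ?_
  have h1 : 0 ≤ decayRate Q κ := by have := hG.pos; unfold decayRate; positivity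
  have h2 : Real.exp (-(2 * decayRate Q κ) * t) ≤ 1 := by
    rw [Real.exp_le_one_iff]; nlinarith
  have := hQ.wsq_nonneg x
  nlinarith

/-- Joint continuity of a bounded, strongly continuous family of operators. -/
theorem continuous_family_apply {F : Type*} [NormedAddCommGroup F] [NormedSpace ℝ F]
    {S : ℝ → F →L[ℝ] F} {M : ℝ} (hM : ∀ t, ‖S t‖ ≤ M) (hc : ∀ x, Continuous fun t => S t x) :
    Continuous fun p : ℝ × F => S p.1 p.2 := by
  rw [continuous_iff_continuousAt]
  rintro ⟨t, x⟩
  rw [ContinuousAt, tendsto_iff_norm_sub_tendsto_zero]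
  have h1 : Tendsto (fun p : ℝ × F => M * ‖p.2 - x‖ + ‖S p.1 x - S t x‖) (𝓝 (t, x)) (𝓝 0) := by
    have h2 : Continuous fun p : ℝ × F => M * ‖p.2 - x‖ + ‖S p.1 x - S t x‖ := by
      have := (hc x).comp (continuous_fst (X := ℝ) (Y := F))
      exact (continuous_const.mul (by fun_prop)).add (this.sub continuous_const).norm
    have h3 := h2.tendsto (t, x)
    simpa using h3
  refine squeeze_zero (fun _ => norm_nonneg _) (fun p => ?_) h1
  have e : S p.1 p.2 - S t x = S p.1 (p.2 - x) + (S p.1 x - S t x) := by rw [map_sub]; abel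
  rw [e]
  refine (norm_add_le _ _).trans ?_
  gcongr
  exact (S p.1).le_of_opNorm_le (hM _) _

theorem IsSemigroupOf.continuous_apply (hG : IsMaxDissipative Q κ G) (hQ : IsWeight Q c)
    (hT : IsSemigroupOf T G) : Continuous fun p : ℝ × E => T (max p.1 0) p.2 := by
  refine continuous_family_apply (S := fun t => T (max t 0)) (M := weightBound Q c)
    (fun t => hT.norm_le hG hQ (le_max_right _ _)) fun x => ?_
  exact (hT.continuousOn x).comp_continuous (by fun_prop) fun t => mem_Ici.2 (le_max_right _ _)

theorem IsSemigroupOf.apply_sub_eq_integral (hT : IsSemigroupOf T G) {x y : E}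
    (h : (x, y) ∈ G) {t : ℝ} (ht : 0 ≤ t) :
    T t x - x = ∫ s in (0 : ℝ)..t, T (max (t - s) 0) y := by
  have h1 := intervalIntegral.integral_eq_sub_of_hasDeriv_right_of_le ht
    ((hT.continuousOn x).mono Icc_subset_Ici_self)
    (fun s hs => (hT.hasDerivWithinAt h hs.1.le).mono Ioi_subset_Ici_self)
    (ContinuousOn.intervalIntegrable (by
      rw [uIcc_of_le ht]
      exact (hT.continuousOn y).mono Icc_subset_Ici_self))
  rw [intervalIntegral.integral_comp_sub_left (fun s => T (max s 0) y), sub_self, sub_zero]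
  rw [hT.zero, ContinuousLinearMap.id_apply] at h1
  rw [← h1]
  refine intervalIntegral.integral_congr fun s hs => ?_
  rw [uIcc_of_le ht] at hs
  simp [hs.1]

/-- The variation of constants formula for `u' = A u + f`. The truncation `max (t - s) 0` changes
nothing on the domain of integration; it makes the integrand continuous on the whole line. -/
def IsMild (T : ℝ → E →L[ℝ] E) (f u : ℝ → E) : Prop :=
  ∀ t, 0 ≤ t → u t = T t (u 0) + ∫ s in (0 : ℝ)..t, T (max (t - s) 0) (f s)

/-- A mild solution can be restarted at any time. -/
theorem IsMild.restart (hG : IsMaxDissipative Q κ G) (hQ : IsWeight Q c)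
    (hT : IsSemigroupOf T G) {f u : ℝ → E} (hf : Continuous f) (hu : IsMild T f u) {t h : ℝ}
    (ht : 0 ≤ t) (hh : 0 ≤ h) :
    u (t + h) = T h (u t) + ∫ s in (0 : ℝ)..h, T (max (h - s) 0) (f (t + s)) := by
  have hc : ∀ r, Continuous fun s => T (max (r - s) 0) (f s) := fun r =>
    (hT.continuous_apply hG hQ).comp (by fun_prop : Continuous fun s => (r - s, f s))
  have hi : ∀ r a b, IntervalIntegrable (fun s => T (max (r - s) 0) (f s)) volume a b :=
    fun r a b => (hc r).intervalIntegrable a b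
  rw [hu (t + h) (by positivity), hu t ht, map_add, ← ContinuousLinearMap.intervalIntegral_comp_comm
    _ (hi t 0 t), ← intervalIntegral.integral_add_adjacent_intervals (hi _ 0 t) (hi _ t (t + h)),
    ← add_assoc]
  congr 1
  · congr 1
    · rw [add_comm t h, hT.add h t hh ht, ContinuousLinearMap.comp_apply]
    · refine intervalIntegral.integral_congr fun s hs => ?_
      rw [uIcc_of_le ht] at hs
      have h0 : 0 ≤ t - s := by linarith [hs.2]
      have e : t + h - s = h + (t - s) := by ring
      simp only [max_eq_left h0, e]
      rw [max_eq_left (by positivity), hT.add h _ hh h0, ContinuousLinearMap.comp_apply]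
  · have := intervalIntegral.integral_comp_add_left (a := 0) (b := h)
      (fun s => T (max (t + h - s) 0) (f s)) t
    rw [add_zero] at this
    rw [← this]
    refine intervalIntegral.integral_congr fun s _ => ?_
    simp only [add_sub_add_left_eq_sub]

/-- Right energy estimate for a mild solution `u`, relative to a moving element `p` of the domain
of the generator: the weighted square of `u - p` has a right upper Dini derivative of at most
`-2 k ‖u - p‖² + 2 ⟨u - p, f + A p⟩ + 2 ‖Q‖ ‖u - p‖ m`, where `m` bounds the speed of `p`.
No differentiability of `u` is required. -/
theorem IsMild.exists_dini_bound (hG : IsMaxDissipative Q κ G) (hQ : IsWeight Q c)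
    (hT : IsSemigroupOf T G) {f u p : ℝ → E} (hf : Continuous f) (hu : IsMild T f u) {t : ℝ}
    (ht : 0 ≤ t) {a : E} (ha : (p t, a) ∈ G) {m : ℝ → ℝ} {m₀ : ℝ}
    (hm : Tendsto m (𝓝[>] 0) (𝓝 m₀))
    (hp : ∀ h, 0 < h → ‖p (t + h) - p t‖ ≤ h * m h) :
    ∃ ψ : ℝ → ℝ, Tendsto ψ (𝓝[>] 0) (𝓝 (-(2 * decayRate Q κ) * wsq Q (u t - p t)
        + 2 * inner ℝ (u t - p t) (Q (f t + a)) + 2 * (‖Q‖ * (‖u t - p t‖ * m₀)))) ∧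
      ∀ h, 0 < h →
        wsq Q (u (t + h) - p (t + h)) ≤ wsq Q (u t - p t) + h * ψ h := by
  set z := u t - p t with hz
  set k := decayRate Q κ with hk
  have hcT := hT.continuous_apply hG hQ
  -- the average of the forcing term over `[0, h]`
  set J : ℝ → E := fun h => ∫ r in (0 : ℝ)..1, T (max (h - h * r) 0) (f (t + h * r) + a) with hJ
  have hJc : Continuous J := by
    refine intervalIntegral.continuous_parametric_intervalIntegral_of_continuous' ?_ _ _
    exact hcT.comp (by fun_prop : Continuous fun q : ℝ × ℝ =>
      (q.1 - q.1 * q.2, f (t + q.1 * q.2) + a))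
  have hJ0 : J 0 = f t + a := by simp [hJ, hT.zero]
  have hSz : Tendsto (fun h => T h z) (𝓝[>] 0) (𝓝 z) := hT.tendsto_zero z
  have hJt : Tendsto J (𝓝[>] 0) (𝓝 (f t + a)) := by
    rw [← hJ0]
    exact (hJc.tendsto 0).mono_left nhdsWithin_le_nhds
  have hexp : Tendsto (fun h : ℝ => h⁻¹ * (Real.exp (-(2 * k) * h) - 1)) (𝓝[>] 0)
      (𝓝 (-(2 * k))) := by
    have h1 : HasDerivAt (fun h : ℝ => Real.exp (-(2 * k) * h)) (-(2 * k)) 0 := by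
      simpa using ((hasDerivAt_id (0 : ℝ)).const_mul (-(2 * k))).exp
    have h2 := (hasDerivAt_iff_tendsto_slope_zero.1 h1).mono_left
      (nhdsWithin_mono _ (fun x hx => ne_of_gt hx) : 𝓝[>] (0 : ℝ) ≤ 𝓝[≠] 0)
    simpa using h2
  refine ⟨fun h => h⁻¹ * (Real.exp (-(2 * k) * h) - 1) * wsq Q z + 2 * inner ℝ (T h z) (Q (J h))
    + 2 * (‖Q‖ * (‖T h z‖ * m h)) + h * (‖Q‖ * (‖J h‖ + m h) ^ 2), ?_, fun h hh => ?_⟩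
  · have h1 : Tendsto (fun h : ℝ => h) (𝓝[>] 0) (𝓝 0) := nhdsWithin_le_nhds
    have h2 := (((hexp.mul_const (wsq Q z)).add
      ((hSz.inner ((Q.continuous.tendsto _).comp hJt)).const_mul 2)).add
      (((hSz.norm.mul hm).const_mul ‖Q‖).const_mul 2)).add
      (h1.mul (((hJt.norm.add hm).pow 2).const_mul ‖Q‖))
    rw [zero_mul, add_zero] at h2
    exact h2
  · set d := p (t + h) - p t with hd
    have hdm := hp h hh
    have hm0 : 0 ≤ m h := by
      have := (norm_nonneg _).trans hdm
      exact nonneg_of_mul_nonneg_right this hh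
    -- since `T h p - p` is the integral of `T (h - s) A p`, the increment is `T h z` plus terms of
    -- order `h`
    have e : u (t + h) - p (t + h) = T h z + (h • J h - d) := by
      have h1 := hu.restart hG hQ hT hf ht hh.le
      have h2 := hT.apply_sub_eq_integral ha hh.le
      have h3 : h • J h = (∫ s in (0 : ℝ)..h, T (max (h - s) 0) (f (t + s)))
          + ∫ s in (0 : ℝ)..h, T (max (h - s) 0) a := by
        have := intervalIntegral.smul_integral_comp_mul_left (a := 0) (b := 1)
          (fun s => T (max (h - s) 0) (f (t + s) + a)) h
        rw [mul_zero, mul_one] at this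
        rw [hJ]
        simp only
        rw [this, ← intervalIntegral.integral_add]
        · simp
        · exact (hcT.comp (by fun_prop : Continuous fun s =>
            (h - s, f (t + s)))).intervalIntegrable _ _
        · exact (hcT.comp (by fun_prop : Continuous fun s : ℝ =>
            (h - s, a))).intervalIntegrable _ _
      rw [h3, ← h2, h1, hz, map_sub, hd]
      abel
    rw [e, hQ.wsq_add]
    have h1 := hT.wsq_le hG hQ hh.le z
    have h2 : inner ℝ (T h z) (Q (h • J h - d)) ≤ h * inner ℝ (T h z) (Q (J h))
        + h * (‖Q‖ * (‖T h z‖ * m h)) := by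
      rw [map_sub Q, map_smul Q, inner_sub_right, inner_smul_right]
      have h3 := inner_weight_le Q (-(T h z)) d
      rw [inner_neg_left, norm_neg] at h3
      have h4 : ‖Q‖ * (‖T h z‖ * ‖d‖) ≤ h * (‖Q‖ * (‖T h z‖ * m h)) := by
        calc ‖Q‖ * (‖T h z‖ * ‖d‖) ≤ ‖Q‖ * (‖T h z‖ * (h * m h)) := by gcongr
          _ = _ := by ring
      linarith
    have h5 : wsq Q (h • J h - d) ≤ h * (h * (‖Q‖ * (‖J h‖ + m h) ^ 2)) := by
      have h6 : ‖h • J h - d‖ ≤ h * (‖J h‖ + m h) := by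
        refine (norm_sub_le _ _).trans ?_
        rw [norm_smul, Real.norm_of_nonneg hh.le, mul_add]
        gcongr
      calc wsq Q (h • J h - d) ≤ ‖Q‖ * ‖h • J h - d‖ ^ 2 := SingleTrack.wsq_le Q _
        _ ≤ ‖Q‖ * (h * (‖J h‖ + m h)) ^ 2 := by gcongr
        _ = _ := by ring
    have h7 : h * (h⁻¹ * (Real.exp (-(2 * k) * h) - 1) * wsq Q z)
        = Real.exp (-(2 * k) * h) * wsq Q z - wsq Q z := by
      field_simp
    rw [mul_add, mul_add, mul_add, h7]
    linarith

end Semigroup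

/-! ### Rescaling of time -/

section Scaling

variable {E : Type*} [NormedAddCommGroup E] [InnerProductSpace ℝ E]
variable {Q : E →L[ℝ] E} {c κ : ℝ} {G : Submodule ℝ (E × E)} {T : ℝ → E →L[ℝ] E}

/-- The graph of `ε⁻¹ A`, where `G` is the graph of `A`. -/
def scaledGraph (ε : ℝ) (G : Submodule ℝ (E × E)) : Submodule ℝ (E × E) :=
  G.comap (LinearMap.prodMap LinearMap.id (ε • LinearMap.id))

theorem mem_scaledGraph {ε : ℝ} {x y : E} : (x, y) ∈ scaledGraph ε G ↔ (x, ε • y) ∈ G := by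
  simp [scaledGraph]

theorem IsMaxDissipative.scaled (hG : IsMaxDissipative Q κ G) {ε : ℝ} (hε : 0 < ε) :
    IsMaxDissipative Q (κ / ε) (scaledGraph ε G) where
  pos := div_pos hG.pos hε
  diss x y h := by
    have h1 := hG.diss _ _ (mem_scaledGraph.1 h)
    rw [inner_smul_left, conj_trivial] at h1
    have h2 : -(κ / ε) * ‖x‖ ^ 2 = (-κ * ‖x‖ ^ 2) / ε := by ring
    rw [h2, le_div_iff₀ hε]
    linarith
  surj f := by
    obtain ⟨x, hx⟩ := hG.surj (ε • f)
    exact ⟨x, mem_scaledGraph.2 (by simpa using hx)⟩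
  single y h := by
    have := hG.single _ (mem_scaledGraph.1 h)
    simpa [hε.ne'] using this

theorem IsSemigroupOf.scaled (hT : IsSemigroupOf T G) {ε : ℝ} (hε : 0 < ε) :
    IsSemigroupOf (fun t => T (t / ε)) (scaledGraph ε G) := by
  have h0 : Tendsto (fun t : ℝ => t / ε) (𝓝[>] 0) (𝓝[>] 0) := by
    rw [tendsto_nhdsWithin_iff]
    refine ⟨?_, ?_⟩
    · have : Tendsto (fun t : ℝ => t / ε) (𝓝 0) (𝓝 (0 / ε)) :=
        (continuous_id.div_const ε).tendsto 0
      rw [zero_div] at this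
      exact this.mono_left nhdsWithin_le_nhds
    · filter_upwards [self_mem_nhdsWithin] with t ht
      exact div_pos ht hε
  have h0' : Tendsto (fun t : ℝ => t * ε) (𝓝[>] 0) (𝓝[>] 0) := by
    rw [tendsto_nhdsWithin_iff]
    refine ⟨?_, ?_⟩
    · have : Tendsto (fun t : ℝ => t * ε) (𝓝 0) (𝓝 (0 * ε)) :=
        (continuous_id.mul continuous_const).tendsto 0
      rw [zero_mul] at this
      exact this.mono_left nhdsWithin_le_nhds
    · filter_upwards [self_mem_nhdsWithin] with t ht
      exact mul_pos ht hε
  refine ⟨by simpa using hT.zero, fun s t hs ht => ?_, fun x => (hT.tendsto_zero x).comp h0,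
    fun x y => ?_⟩
  · rw [add_div]
    exact hT.add _ _ (by positivity) (by positivity)
  · rw [mem_scaledGraph, hT.generator]
    constructor
    · intro h
      have h1 := (h.comp h0).const_smul ε⁻¹
      rw [inv_smul_smul₀ hε.ne'] at h1
      refine h1.congr fun t => ?_
      rw [Function.comp_apply, smul_smul, inv_div]
      congr 1
      field_simp
    · intro h
      have h1 := (h.comp h0').const_smul ε
      refine h1.congr fun t => ?_
      rw [Function.comp_apply, smul_smul, mul_div_assoc, div_self hε.ne', mul_one, mul_inv]
      congr 1
      field_simp

end Scaling

end SingleTrack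

namespace SingleTrack

/-! ### Lipschitz continuity on bounded sets -/

section LipOnBounded

variable {V W Z : Type*} [NormedAddCommGroup V] [NormedAddCommGroup W] [NormedAddCommGroup Z]

/-- `f` is Lipschitz continuous on every bounded set. -/
def LipOnBounded (f : V → W) : Prop :=
  ∀ R : ℝ, ∃ L, 0 ≤ L ∧ ∀ x y, ‖x‖ ≤ R → ‖y‖ ≤ R → ‖f x - f y‖ ≤ L * ‖x - y‖

theorem LipOnBounded.of_lipschitz {f : V → W} {L : ℝ} (hL : 0 ≤ L)
    (h : ∀ x y, ‖f x - f y‖ ≤ L * ‖x - y‖) : LipOnBounded f :=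
  fun _ => ⟨L, hL, fun x y _ _ => h x y⟩

theorem LipOnBounded.const (b : W) : LipOnBounded fun _ : V => b :=
  .of_lipschitz le_rfl fun x y => by simp

theorem LipOnBounded.add {f g : V → W} (hf : LipOnBounded f) (hg : LipOnBounded g) :
    LipOnBounded fun x => f x + g x := by
  intro R
  obtain ⟨L, hL, h⟩ := hf R
  obtain ⟨K, hK, h'⟩ := hg R
  refine ⟨L + K, by positivity, fun x y hx hy => ?_⟩
  rw [add_sub_add_comm, add_mul]
  exact (norm_add_le _ _).trans (add_le_add (h x y hx hy) (h' x y hx hy))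

theorem LipOnBounded.exists_bound {f : V → W} (hf : LipOnBounded f) (R : ℝ) :
    ∃ B, 0 ≤ B ∧ ∀ x, ‖x‖ ≤ R → ‖f x‖ ≤ B := by
  obtain ⟨L, hL, h⟩ := hf |R|
  refine ⟨L * |R| + ‖f 0‖, by positivity, fun x hx => ?_⟩
  have hx' : ‖x‖ ≤ |R| := hx.trans (le_abs_self R)
  have h1 := h x 0 hx' (by simp)
  rw [sub_zero] at h1
  have h2 := norm_sub_norm_le (f x) (f 0)
  have := mul_le_mul_of_nonneg_left hx' hL
  linarith

theorem LipOnBounded.comp {g : W → Z} {f : V → W} (hg : LipOnBounded g) (hf : LipOnBounded f) :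
    LipOnBounded fun x => g (f x) := by
  intro R
  obtain ⟨B, hB, hb⟩ := hf.exists_bound R
  obtain ⟨L, hL, h⟩ := hf R
  obtain ⟨K, hK, h'⟩ := hg B
  refine ⟨K * L, by positivity, fun x y hx hy => ?_⟩
  refine (h' _ _ (hb x hx) (hb y hy)).trans ?_
  rw [mul_assoc]
  exact mul_le_mul_of_nonneg_left (h x y hx hy) hK

theorem LipOnBounded.continuous {f : V → W} (hf : LipOnBounded f) : Continuous f := by
  rw [continuous_iff_continuousAt]
  intro x
  obtain ⟨L, hL, h⟩ := hf (‖x‖ + 1)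
  rw [ContinuousAt, tendsto_iff_norm_sub_tendsto_zero]
  have h1 : Tendsto (fun y => L * ‖y - x‖) (𝓝 x) (𝓝 0) := by
    have : Continuous fun y => L * ‖y - x‖ := by fun_prop
    simpa using this.tendsto x
  refine squeeze_zero' (Eventually.of_forall fun _ => norm_nonneg _) ?_ h1
  filter_upwards [Metric.ball_mem_nhds x one_pos] with y hy
  rw [mem_ball_iff_norm] at hy
  refine h y x ?_ (by linarith)
  have := norm_sub_norm_le y x
  linarith

/-- The cutoff function, equal to `1` on `[0, R]` and to `0` on `[R + 1, ∞)`. -/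
noncomputable def cutoff (R r : ℝ) : ℝ := max 0 (min 1 (R + 1 - r))

theorem cutoff_eq_one {R r : ℝ} (h : r ≤ R) : cutoff R r = 1 := by
  unfold cutoff
  rw [min_eq_left (by linarith), max_eq_right zero_le_one]

theorem cutoff_eq_zero {R r : ℝ} (h : R + 1 ≤ r) : cutoff R r = 0 := by
  unfold cutoff
  exact max_eq_left ((min_le_right _ _).trans (by linarith))

theorem abs_cutoff_le (R r : ℝ) : |cutoff R r| ≤ 1 := by
  unfold cutoff
  rw [abs_of_nonneg (le_max_left _ _)]
  exact max_le zero_le_one (min_le_left _ _)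

theorem abs_cutoff_sub_le (R r s : ℝ) : |cutoff R r - cutoff R s| ≤ |r - s| := by
  unfold cutoff
  refine (abs_max_sub_max_le_max _ _ _ _).trans ?_
  rw [sub_self, abs_zero, max_eq_right (abs_nonneg _)]
  refine (abs_min_sub_min_le_max _ _ _ _).trans ?_
  rw [sub_self, abs_zero, max_eq_right (abs_nonneg _)]
  rw [abs_sub_comm r s]
  apply le_of_eq
  congr 1
  ring

theorem LipOnBounded.neg {f : V → W} (hf : LipOnBounded f) : LipOnBounded fun x => -f x := by
  intro R
  obtain ⟨L, hL, h⟩ := hf R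
  refine ⟨L, hL, fun x y hx hy => ?_⟩
  rw [← neg_sub', norm_neg]
  exact h x y hx hy

theorem LipOnBounded.sub {f g : V → W} (hf : LipOnBounded f) (hg : LipOnBounded g) :
    LipOnBounded fun x => f x - g x := by
  simpa only [sub_eq_add_neg] using hf.add hg.neg

variable [NormedSpace ℝ W] [NormedSpace ℝ Z]

theorem LipOnBounded.clm_apply {f : V → W →L[ℝ] Z} {g : V → W} (hf : LipOnBounded f)
    (hg : LipOnBounded g) : LipOnBounded fun x => f x (g x) := by
  intro R
  obtain ⟨A, hA, ha⟩ := hf.exists_bound R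
  obtain ⟨B, hB, hb⟩ := hg.exists_bound R
  obtain ⟨L, hL, h⟩ := hf R
  obtain ⟨K, hK, h'⟩ := hg R
  refine ⟨L * B + A * K, by positivity, fun x y hx hy => ?_⟩
  have e : f x (g x) - f y (g y) = (f x - f y) (g x) + f y (g x - g y) := by
    rw [sub_apply, map_sub]; abel
  rw [e]
  refine (norm_add_le _ _).trans ?_
  have h1 : ‖(f x - f y) (g x)‖ ≤ L * ‖x - y‖ * B :=
    (ContinuousLinearMap.le_opNorm _ _).trans
      (mul_le_mul (h x y hx hy) (hb x hx) (norm_nonneg _) (by positivity))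
  have h2 : ‖f y (g x - g y)‖ ≤ A * (K * ‖x - y‖) :=
    (ContinuousLinearMap.le_opNorm _ _).trans
      (mul_le_mul (ha y hy) (h' x y hx hy) (norm_nonneg _) hA)
  linarith

/-- Multiplication by a cutoff makes a map that is Lipschitz on bounded sets Lipschitz. -/
theorem LipOnBounded.exists_lipschitz_cutoff {f : V → W} (hf : LipOnBounded f) (R : ℝ) :
    ∃ L, 0 ≤ L ∧ ∀ x y,
      ‖cutoff R ‖x‖ • f x - cutoff R ‖y‖ • f y‖ ≤ L * ‖x - y‖ := by
  obtain ⟨B, hB, hb⟩ := hf.exists_bound (R + 1)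
  obtain ⟨L, hL, h⟩ := hf (R + 1)
  have hχ : ∀ x y : V, |cutoff R ‖x‖ - cutoff R ‖y‖| ≤ ‖x - y‖ := fun x y =>
    (abs_cutoff_sub_le R _ _).trans (abs_norm_sub_norm_le x y)
  have one_in : ∀ x y : V, ‖x‖ ≤ R + 1 → R + 1 ≤ ‖y‖ →
      ‖cutoff R ‖x‖ • f x - cutoff R ‖y‖ • f y‖ ≤ (B + L) * ‖x - y‖ := by
    intro x y hx hy
    have h1 := hχ x y
    rw [cutoff_eq_zero hy] at h1 ⊢
    rw [zero_smul, sub_zero, norm_smul, Real.norm_eq_abs]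
    rw [sub_zero] at h1
    have := mul_le_mul h1 (hb x hx) (norm_nonneg _) (norm_nonneg _)
    nlinarith [mul_nonneg hL (norm_nonneg (x - y))]
  refine ⟨B + L, by positivity, fun x y => ?_⟩
  rcases le_total ‖x‖ (R + 1) with hx | hx <;> rcases le_total ‖y‖ (R + 1) with hy | hy
  · have e : cutoff R ‖x‖ • f x - cutoff R ‖y‖ • f y
        = (cutoff R ‖x‖ - cutoff R ‖y‖) • f x + cutoff R ‖y‖ • (f x - f y) := by module
    rw [e]
    refine (norm_add_le _ _).trans ?_
    rw [norm_smul, norm_smul, Real.norm_eq_abs, Real.norm_eq_abs]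
    have h1 := mul_le_mul (hχ x y) (hb x hx) (norm_nonneg _) (norm_nonneg _)
    have h2 := mul_le_mul (abs_cutoff_le R ‖y‖) (h x y hx hy) (norm_nonneg _) zero_le_one
    linarith
  · exact one_in x y hx hy
  · rw [norm_sub_rev, norm_sub_rev x y]
    exact one_in y x hy hx
  · rw [cutoff_eq_zero hx, cutoff_eq_zero hy]
    simp only [zero_smul, sub_zero, norm_zero]
    positivity

variable [NormedSpace ℝ V]

theorem LipOnBounded.clm (A : V →L[ℝ] W) : LipOnBounded A :=
  .of_lipschitz (norm_nonneg A) fun x y => by rw [← map_sub]; exact A.le_opNorm _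

theorem LipOnBounded.of_contDiff [FiniteDimensional ℝ V] {f : V → W} (hf : ContDiff ℝ 1 f) :
    LipOnBounded f := by
  intro R
  obtain ⟨C, hC⟩ := (isCompact_closedBall (0 : V) R).exists_bound_of_continuousOn
    (hf.continuous_fderiv one_ne_zero).continuousOn
  refine ⟨|C|, abs_nonneg C, fun x y hx hy => ?_⟩
  exact (convex_closedBall (0 : V) R).norm_image_sub_le_of_norm_fderiv_le (𝕜 := ℝ)
    (fun z _ => hf.differentiable one_ne_zero z) (fun z hz => (hC z hz).trans (le_abs_self C))
    (by simpa using hy) (by simpa using hx)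

end LipOnBounded

/-! ### The variation of constants equation -/

section Picard

variable {H : Type*} [NormedAddCommGroup H] [NormedSpace ℝ H]

theorem integral_exp_le {l : ℝ} (hl : 0 < l) (t : ℝ) :
    ∫ s in (0 : ℝ)..t, Real.exp (-(l * (t - s))) ≤ 1 / l := by
  have hd : ∀ s : ℝ, HasDerivAt (fun s => Real.exp (-(l * (t - s))) / l)
      (Real.exp (-(l * (t - s)))) s := by
    intro s
    have h1 : HasDerivAt (fun s : ℝ => -(l * (t - s))) l s := by
      have h := (((hasDerivAt_id s).const_sub t).const_mul l).neg
      rw [mul_neg, mul_one, neg_neg] at h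
      exact h
    refine (h1.exp.div_const l).congr_deriv ?_
    field_simp
  rw [intervalIntegral.integral_eq_sub_of_hasDerivAt (fun s _ => hd s)
    (Continuous.intervalIntegrable (by fun_prop) _ _)]
  simp only [sub_self, mul_zero, neg_zero, Real.exp_zero]
  have : 0 ≤ Real.exp (-(l * (t - 0))) / l := by positivity
  linarith

/-- Global solvability of the variation of constants equation with a Lipschitz nonlinearity.
Banach's fixed point theorem is applied to `y(t) = e^{-l t} w(t)` in the space of bounded
continuous functions, for `l` large. -/
theorem exists_mild_of_lipschitz [CompleteSpace H] {S : ℝ → H →L[ℝ] H} {M : ℝ}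
    (hM : ∀ t, ‖S t‖ ≤ M)
    (hc : ∀ x, Continuous fun t => S t x) {F : H → H} {L : ℝ} (hL : 0 ≤ L)
    (hF : ∀ x y, ‖F x - F y‖ ≤ L * ‖x - y‖) (w₀ : H) :
    ∃ w : ℝ → H, Continuous w ∧ ∀ t, 0 ≤ t →
      w t = S t w₀ + ∫ s in (0 : ℝ)..t, S (t - s) (F (w s)) := by
  have hM0 : 0 ≤ M := (norm_nonneg _).trans (hM 0)
  -- the fixed point map is a contraction with constant `M L / l`
  set l := M * L + 1 with hl
  have hl0 : 0 < l := by positivity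
  have hSc := continuous_family_apply hM hc
  have hFc : Continuous F := (LipOnBounded.of_lipschitz hL hF).continuous
  -- the rescaled nonlinearity
  set N : ℝ → H → H := fun s y => Real.exp (-(l * s)) • F (Real.exp (l * s) • y) with hN
  have hNc : Continuous fun p : ℝ × H => N p.1 p.2 := by
    simp only [hN]
    fun_prop
  have hNL : ∀ s x y, ‖N s x - N s y‖ ≤ L * ‖x - y‖ := by
    intro s x y
    simp only [hN]
    rw [← smul_sub, norm_smul, Real.norm_of_nonneg (Real.exp_pos _).le]
    have h1 := hF (Real.exp (l * s) • x) (Real.exp (l * s) • y)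
    rw [← smul_sub, norm_smul, Real.norm_of_nonneg (Real.exp_pos _).le] at h1
    have h2 := mul_le_mul_of_nonneg_left h1 (Real.exp_pos (-(l * s))).le
    refine h2.trans (le_of_eq ?_)
    have h3 : Real.exp (-(l * s)) * Real.exp (l * s) = 1 := by rw [← Real.exp_add]; simp
    calc _ = (Real.exp (-(l * s)) * Real.exp (l * s)) * (L * ‖x - y‖) := by ring
      _ = _ := by rw [h3, one_mul]
  have hN0 : ∀ s, 0 ≤ s → ‖N s 0‖ ≤ ‖F 0‖ := by
    intro s hs
    simp only [hN, smul_zero]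
    rw [norm_smul, Real.norm_of_nonneg (Real.exp_pos _).le]
    have : Real.exp (-(l * s)) ≤ 1 := by rw [Real.exp_le_one_iff]; nlinarith
    nlinarith [norm_nonneg (F 0)]
  -- the integral operator
  set I : (ℝ → H) → ℝ → H := fun y t =>
    ∫ s in (0 : ℝ)..t, Real.exp (-(l * (t - s))) • S (t - s) (N s (y s)) with hI
  have hint : ∀ {y : ℝ → H}, Continuous y →
      Continuous fun p : ℝ × ℝ => Real.exp (-(l * (p.1 - p.2))) • S (p.1 - p.2) (N p.2 (y p.2)) :=
    by
    intro y hy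
    refine Continuous.smul (by fun_prop) ?_
    exact hSc.comp ((by fun_prop : Continuous fun p : ℝ × ℝ => p.1 - p.2).prodMk
      (hNc.comp (by fun_prop : Continuous fun p : ℝ × ℝ => (p.2, y p.2))))
  have hIc : ∀ {y : ℝ → H}, Continuous y → Continuous (I y) := fun {y} hy =>
    intervalIntegral.continuous_parametric_intervalIntegral_of_continuous (hint hy) continuous_id
  have hIb : ∀ (g : ℝ → H) (C t : ℝ), 0 ≤ t → 0 ≤ C → (∀ s, 0 ≤ s → ‖g s‖ ≤ C) →
      ‖∫ s in (0 : ℝ)..t, Real.exp (-(l * (t - s))) • S (t - s) (g s)‖ ≤ M * C / l := by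
    intro g C t ht hC hg
    have h1 : ∀ᵐ s, s ∈ Ioc 0 t → ‖Real.exp (-(l * (t - s))) • S (t - s) (g s)‖
        ≤ Real.exp (-(l * (t - s))) * (M * C) := by
      refine Eventually.of_forall fun s hs => ?_
      rw [norm_smul, Real.norm_of_nonneg (Real.exp_pos _).le]
      gcongr
      refine ((S (t - s)).le_of_opNorm_le (hM _) _).trans ?_
      gcongr
      exact hg s hs.1.le
    refine (intervalIntegral.norm_integral_le_of_norm_le ht h1
      (Continuous.intervalIntegrable (by fun_prop) _ _)).trans ?_
    rw [intervalIntegral.integral_mul_const]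
    have := mul_le_mul_of_nonneg_right (integral_exp_le hl0 t) (mul_nonneg hM0 hC)
    refine this.trans (le_of_eq (by ring))
  set Φ : (ℝ → H) → ℝ → H := fun y t =>
    Real.exp (-(l * max t 0)) • S (max t 0) w₀ + I y (max t 0) with hΦ
  have hΦc : ∀ {y : ℝ → H}, Continuous y → Continuous (Φ y) := by
    intro y hy
    have h1 : Continuous fun t : ℝ => max t 0 := by fun_prop
    exact (Continuous.smul (by fun_prop) ((hc w₀).comp h1)).add ((hIc hy).comp h1)
  have hΦb : ∀ y : BoundedContinuousFunction ℝ H, ∀ t,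
      ‖Φ y t‖ ≤ M * ‖w₀‖ + M * (‖F 0‖ + L * ‖y‖) / l := by
    intro y t
    have ht : 0 ≤ max t 0 := le_max_right _ _
    refine (norm_add_le _ _).trans (add_le_add ?_ ?_)
    · rw [norm_smul, Real.norm_of_nonneg (Real.exp_pos _).le]
      have h1 : Real.exp (-(l * max t 0)) ≤ 1 := by rw [Real.exp_le_one_iff]; nlinarith
      have h2 := (S (max t 0)).le_of_opNorm_le (hM _) w₀
      nlinarith [norm_nonneg (S (max t 0) w₀)]
    · refine hIb (fun s => N s (y s)) _ _ ht (by positivity) fun s hs => ?_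
      have h1 := hNL s (y s) 0
      rw [sub_zero] at h1
      have h2 := norm_sub_norm_le (N s (y s)) (N s 0)
      have h3 := mul_le_mul_of_nonneg_left (y.norm_coe_le_norm s) hL
      have := hN0 s hs
      linarith
  let Ψ : BoundedContinuousFunction ℝ H → BoundedContinuousFunction ℝ H := fun y =>
    BoundedContinuousFunction.ofNormedAddCommGroup (Φ y) (hΦc y.continuous) _ (hΦb y)
  have hΨ : ContractingWith (Real.toNNReal (M * L / l)) Ψ := by
    constructor
    · rw [← NNReal.coe_lt_coe, Real.coe_toNNReal _ (by positivity), NNReal.coe_one,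
        div_lt_one hl0, hl]
      linarith
    · refine LipschitzWith.of_dist_le_mul fun y y' => ?_
      rw [Real.coe_toNNReal _ (by positivity)]
      refine (BoundedContinuousFunction.dist_le (by positivity)).2 fun t => ?_
      have ht : 0 ≤ max t 0 := le_max_right _ _
      have e : Ψ y t - Ψ y' t = ∫ s in (0 : ℝ)..(max t 0), Real.exp (-(l * (max t 0 - s))) •
          S (max t 0 - s) (N s (y s) - N s (y' s)) := by
        change Φ y t - Φ y' t = _
        simp only [hΦ, hI]
        rw [add_sub_add_left_eq_sub, ← intervalIntegral.integral_sub]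
        · simp only [map_sub, smul_sub]
        · exact ((hint y.continuous).comp
            (by fun_prop : Continuous fun s : ℝ => (max t 0, s))).intervalIntegrable _ _
        · exact ((hint y'.continuous).comp
            (by fun_prop : Continuous fun s : ℝ => (max t 0, s))).intervalIntegrable _ _
      rw [dist_eq_norm, e]
      refine (hIb _ (L * dist y y') _ ht (by positivity) fun s _ => ?_).trans
        (le_of_eq (by ring))
      refine (hNL s _ _).trans ?_
      gcongr
      rw [← dist_eq_norm]
      exact BoundedContinuousFunction.dist_coe_le_dist s
  obtain ⟨y, hy, -⟩ := hΨ.exists_fixedPoint 0 (edist_ne_top _ _)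
  have hy' : ∀ t, 0 ≤ t → y t = Real.exp (-(l * t)) • S t w₀ + I y t := by
    intro t ht
    have h1 : Ψ y t = y t := by rw [hy.eq]
    rw [← h1]
    change Φ y t = _
    simp only [hΦ, max_eq_left ht]
  refine ⟨fun t => Real.exp (l * t) • y t, by fun_prop, fun t ht => ?_⟩
  simp only
  rw [hy' t ht, smul_add, smul_smul, ← Real.exp_add, add_neg_cancel, Real.exp_zero, one_smul]
  congr 1
  simp only [hI]
  rw [← intervalIntegral.integral_smul]
  refine intervalIntegral.integral_congr fun s _ => ?_
  simp only [hN]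
  rw [map_smul, smul_smul, smul_smul, ← Real.exp_add, ← Real.exp_add]
  have : l * t + -(l * (t - s)) + -(l * s) = 0 := by ring
  rw [this, Real.exp_zero, one_smul]

/-- Uniqueness for the variation of constants equation, by Gronwall's inequality. -/
theorem eqOn_of_mild {S : ℝ → H →L[ℝ] H} {M : ℝ} (hM : ∀ t, ‖S t‖ ≤ M)
    (hc : ∀ x, Continuous fun t => S t x) {F : H → H} (hF : LipOnBounded F) {w₀ : H}
    {v w : ℝ → H} (hvc : Continuous v) (hwc : Continuous w)
    (hv : ∀ t, 0 ≤ t → v t = S t w₀ + ∫ s in (0 : ℝ)..t, S (t - s) (F (v s)))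
    (hw : ∀ t, 0 ≤ t → w t = S t w₀ + ∫ s in (0 : ℝ)..t, S (t - s) (F (w s))) {τ : ℝ}
    (hτ : 0 ≤ τ) : v τ = w τ := by
  have hM0 : 0 ≤ M := (norm_nonneg _).trans (hM 0)
  have hSc := continuous_family_apply hM hc
  obtain ⟨R₁, hR₁⟩ := isCompact_Icc.exists_bound_of_continuousOn
    (hvc.continuousOn (s := Icc 0 τ))
  obtain ⟨R₂, hR₂⟩ := isCompact_Icc.exists_bound_of_continuousOn
    (hwc.continuousOn (s := Icc 0 τ))
  obtain ⟨L, hL, hLip⟩ := hF (max R₁ R₂)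
  set d : ℝ → ℝ := fun t => ‖v t - w t‖ with hd
  have hdc : Continuous d := (hvc.sub hwc).norm
  set D : ℝ → ℝ := fun t => ∫ s in (0 : ℝ)..t, d s with hD
  have hint : ∀ t {y : ℝ → H}, Continuous y →
      IntervalIntegrable (fun s => S (t - s) (F (y s))) volume 0 t := fun t y hy =>
    (hSc.comp ((by fun_prop : Continuous fun s : ℝ => t - s).prodMk
      (hF.continuous.comp hy))).intervalIntegrable _ _
  have hdD : ∀ t ∈ Icc 0 τ, d t ≤ M * L * D t := by
    intro t ht
    have e : v t - w t = ∫ s in (0 : ℝ)..t, S (t - s) (F (v s) - F (w s)) := by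
      rw [hv t ht.1, hw t ht.1, add_sub_add_left_eq_sub,
        ← intervalIntegral.integral_sub (hint t hvc) (hint t hwc)]
      simp only [map_sub]
    simp only [hd, hD]
    rw [e, ← intervalIntegral.integral_const_mul]
    refine intervalIntegral.norm_integral_le_of_norm_le ht.1 (Eventually.of_forall fun s hs => ?_)
      ((hdc.const_mul _).intervalIntegrable _ _)
    have hs' : s ∈ Icc 0 τ := ⟨hs.1.le, hs.2.trans ht.2⟩
    rw [mul_assoc]
    refine ((S (t - s)).le_of_opNorm_le (hM _) _).trans ?_
    gcongr
    exact hLip _ _ ((hR₁ s hs').trans (le_max_left _ _)) ((hR₂ s hs').trans (le_max_right _ _))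
  have hDd : ∀ t, HasDerivAt D (d t) t := fun t =>
    intervalIntegral.integral_hasDerivAt_right (hdc.intervalIntegrable _ _)
      (hdc.stronglyMeasurableAtFilter _ _) hdc.continuousAt
  have hD0 : ∀ t, 0 ≤ t → 0 ≤ D t := fun t ht =>
    intervalIntegral.integral_nonneg ht fun s _ => norm_nonneg _
  have h := norm_le_gronwallBound_of_norm_deriv_right_le (f := D) (f' := d) (δ := 0)
    (K := M * L) (ε := 0) (a := 0) (b := τ)
    (fun t _ => (hDd t).continuousAt.continuousWithinAt) (fun t _ => (hDd t).hasDerivWithinAt)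
    (by simp [hD]) (fun t ht => by
      rw [Real.norm_of_nonneg (norm_nonneg _), Real.norm_of_nonneg (hD0 t ht.1), add_zero]
      exact hdD t ⟨ht.1, ht.2.le⟩) τ ⟨hτ, le_rfl⟩
  rw [gronwallBound_ε0, zero_mul] at h
  have h2 : D τ = 0 := norm_le_zero_iff.1 h
  have h3 := hdD τ ⟨hτ, le_rfl⟩
  rw [h2, mul_zero] at h3
  exact sub_eq_zero.1 (norm_le_zero_iff.1 h3)

end Picard

/-! ### Product of a semigroup with the identity -/

section Product

variable {E F : Type*} [NormedAddCommGroup E] [InnerProductSpace ℝ E]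
  [NormedAddCommGroup F] [InnerProductSpace ℝ F]
variable {Q : E →L[ℝ] E} {c κ : ℝ} {G : Submodule ℝ (E × E)} {T : ℝ → E →L[ℝ] E}

/-- The semigroup `(X, z) ↦ (X, T(t) z)`, extended by the identity to negative times. -/
noncomputable def prodFlow (F : Type*) [NormedAddCommGroup F] [InnerProductSpace ℝ F]
    (T : ℝ → E →L[ℝ] E) (t : ℝ) : WithLp 2 (F × E) →L[ℝ] WithLp 2 (F × E) :=
  (WithLp.prodContinuousLinearEquiv 2 ℝ F E).symm.toContinuousLinearMap.comp
    (((ContinuousLinearMap.id ℝ F).prodMap (T (max t 0))).comp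
      (WithLp.prodContinuousLinearEquiv 2 ℝ F E).toContinuousLinearMap)

theorem prodFlow_apply (t : ℝ) (w : WithLp 2 (F × E)) :
    prodFlow F T t w = WithLp.toLp 2 (w.fst, T (max t 0) w.snd) := rfl

variable [CompleteSpace E]

theorem norm_prodFlow_le (hG : IsMaxDissipative Q κ G) (hQ : IsWeight Q c)
    (hT : IsSemigroupOf T G) (t : ℝ) : ‖prodFlow F T t‖ ≤ weightBound Q c := by
  have hM := weightBound_ge_one Q c
  refine ContinuousLinearMap.opNorm_le_bound _ (by linarith) fun w => ?_
  have h1 := (T (max t 0)).le_of_opNorm_le (hT.norm_le hG hQ (le_max_right t 0)) w.snd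
  refine abs_le_of_sq_le_sq' ?_ (by positivity) |>.2
  rw [prodFlow_apply, mul_pow, WithLp.prod_norm_sq_eq_of_L2, WithLp.prod_norm_sq_eq_of_L2]
  simp only [WithLp.toLp_fst, WithLp.toLp_snd]
  have h2 := pow_le_pow_left₀ (norm_nonneg _) h1 2
  rw [mul_pow] at h2
  have h3 : 1 ≤ weightBound Q c ^ 2 := one_le_pow₀ hM
  nlinarith [sq_nonneg ‖w.fst‖]

theorem continuous_prodFlow (hG : IsMaxDissipative Q κ G) (hQ : IsWeight Q c)
    (hT : IsSemigroupOf T G) (w : WithLp 2 (F × E)) : Continuous fun t => prodFlow F T t w := by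
  have h1 : Continuous fun t : ℝ => (w.fst, T (max t 0) w.snd) :=
    continuous_const.prodMk ((hT.continuous_apply hG hQ).comp
      (by fun_prop : Continuous fun t : ℝ => (t, w.snd)))
  exact (WithLp.prodContinuousLinearEquiv 2 ℝ F E).symm.continuous.comp h1

/-- The variation of constants equation on the product, in components. -/
theorem prodFlow_eq_iff [CompleteSpace F] (hG : IsMaxDissipative Q κ G) (hQ : IsWeight Q c)
    (hT : IsSemigroupOf T G) {f : ℝ → WithLp 2 (F × E)} (hf : Continuous f)
    (x w₀ : WithLp 2 (F × E)) {t : ℝ} (ht : 0 ≤ t) :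
    x = prodFlow F T t w₀ + ∫ s in (0 : ℝ)..t, prodFlow F T (t - s) (f s) ↔
      x.fst = w₀.fst + ∫ s in (0 : ℝ)..t, (f s).fst ∧
      x.snd = T t w₀.snd + ∫ s in (0 : ℝ)..t, T (max (t - s) 0) (f s).snd := by
  have hSc : Continuous fun p : ℝ × WithLp 2 (F × E) => prodFlow F T p.1 p.2 :=
    continuous_family_apply (S := fun t => prodFlow F T t) (M := weightBound Q c)
      (fun t => norm_prodFlow_le hG hQ hT t) (fun x => continuous_prodFlow hG hQ hT x)
  have hi : IntervalIntegrable (fun s => prodFlow F T (t - s) (f s)) volume 0 t :=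
    (hSc.comp ((by fun_prop : Continuous fun s : ℝ => t - s).prodMk hf)).intervalIntegrable _ _
  have h1 : (∫ s in (0 : ℝ)..t, prodFlow F T (t - s) (f s)).fst
      = ∫ s in (0 : ℝ)..t, (f s).fst :=
    ((WithLp.fstL 2 ℝ F E).intervalIntegral_comp_comm hi).symm
  have h2 : (∫ s in (0 : ℝ)..t, prodFlow F T (t - s) (f s)).snd
      = ∫ s in (0 : ℝ)..t, T (max (t - s) 0) (f s).snd :=
    ((WithLp.sndL 2 ℝ F E).intervalIntegral_comp_comm hi).symm
  rw [← h1, ← h2]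
  constructor
  · intro h
    rw [h, WithLp.add_fst, WithLp.add_snd, prodFlow_apply]
    simp only [WithLp.toLp_fst, WithLp.toLp_snd, max_eq_left ht, and_self]
  · rintro ⟨h3, h4⟩
    refine (WithLp.equiv 2 (F × E)).injective (Prod.ext ?_ ?_)
    · change x.fst = _
      rw [h3]
      rfl
    · change x.snd = _
      rw [h4]
      conv_rhs => change T (max t 0) w₀.snd + _
      rw [max_eq_left ht]
      rfl

end Product

end SingleTrack

namespace SingleTrack

/-! ### Bounded operators on square-integrable functions -/

section Operators

/-- The action of matrices on the plane, as a linear map in the matrix. -/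
noncomputable def opLin : Mat →ₗ[ℝ] Plane →L[ℝ] Plane where
  toFun := op
  map_add' := map_add _
  map_smul' := map_smul _

theorem continuous_op : Continuous op := opLin.continuous_of_finiteDimensional

theorem op_apply (A : Mat) (v : Plane) (i : Fin 2) : op A v i = ∑ j, A i j * v j := by
  simp [op, Matrix.mulVec, dotProduct]

theorem op_mul_apply (A B : Mat) (v : Plane) : op (A * B) v = op A (op B v) := by
  simp [op]

theorem op_one_apply (v : Plane) : op 1 v = v := by
  simp [op]

theorem memLp_op {K : ℝ → Mat} (hK : ContinuousOn K (Icc 0 1)) (p : ENNReal) :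
    MemLp (fun ξ => op (K ξ)) p unitMeasure := by
  have hc : ContinuousOn (fun ξ => op (K ξ)) (Icc 0 1) := continuous_op.comp_continuousOn hK
  obtain ⟨C, hC⟩ := isCompact_Icc.exists_bound_of_continuousOn hc
  refine MemLp.of_bound
    ((hc.mono Ioo_subset_Icc_self).aestronglyMeasurable measurableSet_Ioo) C ?_
  filter_upwards [ae_restrict_mem measurableSet_Ioo] with ξ hξ
  exact hC ξ (Ioo_subset_Icc_self hξ)

/-- Multiplication by a continuous matrix-valued function on `L²`. -/
noncomputable def mulOp (K : ℝ → Mat) (hK : ContinuousOn K (Icc 0 1)) : L2 →L[ℝ] L2 :=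
  (ContinuousLinearMap.id ℝ (Plane →L[ℝ] Plane)).holderL unitMeasure ⊤ 2 2 (memLp_op hK ⊤).toLp

theorem coeFn_mulOp {K : ℝ → Mat} (hK : ContinuousOn K (Icc 0 1)) (f : L2) :
    mulOp K hK f =ᵐ[unitMeasure] fun ξ => op (K ξ) (f ξ) := by
  filter_upwards [(ContinuousLinearMap.id ℝ (Plane →L[ℝ] Plane)).coeFn_holder (r := 2)
    (memLp_op hK ⊤).toLp f, (memLp_op hK ⊤).coeFn_toLp] with ξ h1 h2
  simp only [mulOp, ContinuousLinearMap.holderL_apply_apply]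
  rw [h1, h2]
  rfl

/-- The integral operator with a continuous kernel, as a bounded operator on `L²`. -/
noncomputable def kernelOp (K : ℝ → Mat) (hK : ContinuousOn K (Icc 0 1)) : L2 →L[ℝ] Plane :=
  (ContinuousLinearMap.id ℝ (Plane →L[ℝ] Plane)).lpPairing unitMeasure 2 2 (memLp_op hK 2).toLp

theorem kernelOp_apply {K : ℝ → Mat} (hK : ContinuousOn K (Icc 0 1)) (f : L2) :
    kernelOp K hK f = kernelInt K f := by
  rw [kernelOp, ContinuousLinearMap.lpPairing_eq_integral, kernelInt]
  refine integral_congr_ae ?_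
  filter_upwards [(memLp_op hK 2).coeFn_toLp] with ξ h
  rw [h]
  rfl

theorem kernelInt_congr (K : ℝ → Mat) {f g : ℝ → Plane} (h : f =ᵐ[unitMeasure] g) :
    kernelInt K f = kernelInt K g := by
  refine integral_congr_ae ?_
  filter_upwards [h] with ξ h
  rw [h]

/-- Pointwise application of a constant matrix on `L²`. -/
noncomputable abbrev liftOp (A : Plane →L[ℝ] Plane) : L2 →L[ℝ] L2 :=
  ContinuousLinearMap.compLpL 2 unitMeasure A

/-- The embedding of constants into `L²`. -/
noncomputable abbrev constOp : Plane →L[ℝ] L2 := Lp.constL 2 unitMeasure ℝ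

theorem constOp_apply (v : Plane) : constOp v = Lp.const 2 unitMeasure v := rfl

theorem liftOp_comp (A B : Plane →L[ℝ] Plane) (f : L2) :
    liftOp A (liftOp B f) = liftOp (A.comp B) f := by
  apply Lp.ext
  filter_upwards [A.coeFn_compLpL (p := 2) (μ := unitMeasure) (liftOp B f),
    B.coeFn_compLpL (p := 2) (μ := unitMeasure) f,
    (A.comp B).coeFn_compLpL (p := 2) (μ := unitMeasure) f] with ξ h1 h2 h3
  rw [h1, h2, h3]
  rfl

theorem liftOp_id (f : L2) : liftOp (ContinuousLinearMap.id ℝ Plane) f = f := by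
  apply Lp.ext
  filter_upwards [(ContinuousLinearMap.id ℝ Plane).coeFn_compLpL (p := 2) (μ := unitMeasure) f]
    with ξ h1
  rw [h1]
  rfl

theorem constOp_eq_zero {v : Plane} (h : constOp v = 0) : v = 0 := by
  have h1 : NeZero unitMeasure := by
    refine ⟨fun h0 => ?_⟩
    have : unitMeasure univ = 1 := by simp
    rw [h0] at this
    simp at this
  have h2 := Lp.norm_const 2 unitMeasure v (by norm_num)
  rw [← constOp_apply, h, norm_zero] at h2
  simpa [Measure.real] using h2.symm

theorem liftOp_sub (A B : Plane →L[ℝ] Plane) : liftOp (A - B) = liftOp A - liftOp B := by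
  ext1 f
  rw [sub_apply]
  apply Lp.ext
  filter_upwards [(A - B).coeFn_compLpL (p := 2) (μ := unitMeasure) f,
    A.coeFn_compLpL (p := 2) (μ := unitMeasure) f, B.coeFn_compLpL (p := 2) (μ := unitMeasure) f,
    Lp.coeFn_sub (liftOp A f) (liftOp B f)] with ξ h1 h2 h3 h4
  rw [h1, h4, Pi.sub_apply, h2, h3]
  rfl

theorem norm_liftOp_le (A : Plane →L[ℝ] Plane) : ‖liftOp A‖ ≤ ‖A‖ :=
  ContinuousLinearMap.opNorm_le_bound _ (norm_nonneg _) fun f => A.norm_compLp_le f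

end Operators

/-! ### The weight -/

section Weight

variable {Q : ℝ → Mat}

theorem inner_op_of_isDiag {A : Mat} (h : A.IsDiag) (v w : Plane) :
    inner ℝ v (op A w) = A 0 0 * (v 0 * w 0) + A 1 1 * (v 1 * w 1) := by
  have h01 : A 0 1 = 0 := h (by decide)
  have h10 : A 1 0 = 0 := h (by decide)
  simp only [PiLp.inner_apply, Fin.sum_univ_two, op_apply, h01, h10]
  simp
  ring

/-- A continuous field of diagonal positive definite matrices is uniformly positive on `[0,1]`. -/
theorem isWeight_mulOp (hQ : ContinuousOn Q (Icc 0 1))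
    (hd : ∀ ξ ∈ Icc (0 : ℝ) 1, (Q ξ).IsDiag ∧ (Q ξ).PosDef) :
    ∃ c, IsWeight (mulOp Q hQ) c := by
  have hii : ∀ i : Fin 2, ∃ c > 0, ∀ ξ ∈ Icc (0 : ℝ) 1, c ≤ Q ξ i i := by
    intro i
    have hc : ContinuousOn (fun ξ => Q ξ i i) (Icc 0 1) := by
      have : Continuous fun M : Mat => M i i := by fun_prop
      exact this.comp_continuousOn hQ
    obtain ⟨ξ, hξ, hm⟩ := isCompact_Icc.exists_isMinOn (nonempty_Icc.2 zero_le_one) hc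
    exact ⟨Q ξ i i, (hd ξ hξ).2.diag_pos, fun η hη => hm hη⟩
  obtain ⟨c₀, hc₀, h0⟩ := hii 0
  obtain ⟨c₁, hc₁, h1⟩ := hii 1
  refine ⟨min c₀ c₁, lt_min hc₀ hc₁, fun x y => ?_, fun x => ?_⟩
  · rw [L2.inner_def, L2.inner_def]
    refine integral_congr_ae ?_
    filter_upwards [coeFn_mulOp hQ x, coeFn_mulOp hQ y, ae_restrict_mem measurableSet_Ioo]
      with ξ hx hy hξ
    have hdiag := (hd ξ (Ioo_subset_Icc_self hξ)).1
    rw [hx, hy, inner_op_of_isDiag hdiag, inner_op_of_isDiag hdiag]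
    ring
  · have e : min c₀ c₁ * ‖x‖ ^ 2 = inner ℝ x (min c₀ c₁ • x) := by
      rw [inner_smul_right, real_inner_self_eq_norm_sq]
    rw [e, wsq, L2.inner_def, L2.inner_def]
    refine integral_mono_ae (L2.integrable_inner _ _) (L2.integrable_inner _ _) ?_
    filter_upwards [coeFn_mulOp hQ x, Lp.coeFn_smul (min c₀ c₁) x,
      ae_restrict_mem measurableSet_Ioo] with ξ hx hs hξ
    have hξ' := Ioo_subset_Icc_self hξ
    simp only [hx, hs, Pi.smul_apply, inner_smul_right]
    rw [inner_op_of_isDiag (hd ξ hξ').1]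
    have e2 : inner ℝ (x ξ) (x ξ) = x ξ 0 * x ξ 0 + x ξ 1 * x ξ 1 := by
      simp only [PiLp.inner_apply, Fin.sum_univ_two]
      simp [pow_two]
    rw [e2, mul_add]
    have h2 : min c₀ c₁ ≤ Q ξ 0 0 := (min_le_left _ _).trans (h0 ξ hξ')
    have h3 : min c₀ c₁ ≤ Q ξ 1 1 := (min_le_right _ _).trans (h1 ξ hξ')
    exact add_le_add (mul_le_mul_of_nonneg_right h2 (mul_self_nonneg _))
      (mul_le_mul_of_nonneg_right h3 (mul_self_nonneg _))

theorem integral_inner_op (hQ : ContinuousOn Q (Icc 0 1)) (w ζ : L2) :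
    ∫ ξ, inner ℝ (w ξ) (op (Q ξ) (ζ ξ)) ∂unitMeasure = inner ℝ w (mulOp Q hQ ζ) := by
  rw [L2.inner_def]
  refine integral_congr_ae ?_
  filter_upwards [coeFn_mulOp hQ ζ] with ξ h
  rw [h]

end Weight

/-! ### Weak derivatives and primitives -/

section WeakDerivative

theorem integrable_coeFn (g : L2) : Integrable g unitMeasure :=
  (Lp.memLp g).integrable (by norm_num)

theorem integral_smul_eq_kernelOp {ψ : ℝ → ℝ} (hψ : Continuous ψ) (ζ : L2) :
    ∫ ξ, ψ ξ • ζ ξ ∂unitMeasure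
      = kernelOp (fun ξ => ψ ξ • (1 : Mat)) (by fun_prop) ζ := by
  rw [kernelOp_apply, kernelInt]
  refine integral_congr_ae (Eventually.of_forall fun ξ => ?_)
  simp [op]

/-- The weak derivative, expressed by bounded operators of both functions. -/
theorem hasWeakDeriv_iff {ζ g : L2} : HasWeakDeriv ζ g ↔
    ∀ θ : ℝ → ℝ, ∀ hθ : ContDiff ℝ ∞ θ, HasCompactSupport θ → tsupport θ ⊆ Ioo 0 1 →
      kernelOp (fun ξ => deriv θ ξ • (1 : Mat))
          ((hθ.continuous_deriv (by simp)).smul continuous_const).continuousOn ζ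
        = -kernelOp (fun ξ => θ ξ • (1 : Mat))
          (hθ.continuous.smul continuous_const).continuousOn g := by
  unfold HasWeakDeriv
  refine forall_congr' fun θ => forall_congr' fun hθ => ?_
  rw [integral_smul_eq_kernelOp (hθ.continuous_deriv (by simp)),
    integral_smul_eq_kernelOp hθ.continuous]

theorem HasWeakDeriv.zero_unique {g : L2} (h : HasWeakDeriv 0 g) : g = 0 := by
  have h1 := isOpen_Ioo.ae_eq_zero_of_integral_contDiff_smul_eq_zero (μ := unitMeasure)
    (U := Ioo (0 : ℝ) 1) (f := g) ((integrable_coeFn g).locallyIntegrable.locallyIntegrableOn _)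
    fun θ hθ hc hs => by
      have h2 := h θ hθ hc hs
      rw [integral_smul_eq_kernelOp (hθ.continuous_deriv (by simp)), map_zero] at h2
      exact neg_eq_zero.1 h2.symm
  apply Lp.ext
  filter_upwards [h1, ae_restrict_mem measurableSet_Ioo, Lp.coeFn_zero Plane 2 unitMeasure]
    with ξ h2 h3 h4
  rw [h2 h3, h4]
  rfl

/-- The primitive of an `L²` function that vanishes at `0`. -/
noncomputable def primitive (g : L2) (ξ : ℝ) : Plane := ∫ s in (0 : ℝ)..ξ, g s

theorem intervalIntegrable_coeFn (g : L2) {ξ : ℝ} (hξ : ξ ∈ Icc (0 : ℝ) 1) :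
    IntervalIntegrable g volume 0 ξ := by
  rw [intervalIntegrable_iff_integrableOn_Ioo_of_le hξ.1]
  exact IntegrableOn.mono_set (t := Ioo 0 1) (integrable_coeFn g) (Ioo_subset_Ioo_right hξ.2)

theorem primitive_congr {g : L2} {f : ℝ → Plane} (h : g =ᵐ[unitMeasure] f) {ξ : ℝ}
    (hξ : ξ ∈ Icc (0 : ℝ) 1) : primitive g ξ = ∫ s in (0 : ℝ)..ξ, f s := by
  rw [primitive, intervalIntegral.integral_of_le hξ.1, intervalIntegral.integral_of_le hξ.1,
    integral_Ioc_eq_integral_Ioo, integral_Ioc_eq_integral_Ioo]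
  exact integral_congr_ae (ae_restrict_of_ae_restrict_of_subset (Ioo_subset_Ioo_right hξ.2) h)

theorem continuousOn_primitive (g : L2) : ContinuousOn (primitive g) (Icc 0 1) := by
  have := intervalIntegral.continuousOn_primitive_interval (μ := volume) (f := g) (a := 0) (b := 1)
    (by
      rw [uIcc_of_le zero_le_one, integrableOn_Icc_iff_integrableOn_Ioo]
      exact integrable_coeFn g)
  rwa [uIcc_of_le zero_le_one] at this

theorem memLp_of_continuousOn {f : ℝ → Plane} (hf : ContinuousOn f (Icc 0 1)) :
    MemLp f 2 unitMeasure := by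
  obtain ⟨C, hC⟩ := isCompact_Icc.exists_bound_of_continuousOn hf
  refine MemLp.of_bound
    ((hf.mono Ioo_subset_Icc_self).aestronglyMeasurable measurableSet_Ioo) C ?_
  filter_upwards [ae_restrict_mem measurableSet_Ioo] with ξ hξ
  exact hC ξ (Ioo_subset_Icc_self hξ)

/-- The primitive as an element of `L²`. -/
noncomputable def primitiveL2 (g : L2) : L2 :=
  (memLp_of_continuousOn (continuousOn_primitive g)).toLp

theorem coeFn_primitiveL2 (g : L2) : primitiveL2 g =ᵐ[unitMeasure] primitive g :=
  MemLp.coeFn_toLp _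

theorem primitive_add (g h : L2) {ξ : ℝ} (hξ : ξ ∈ Icc (0 : ℝ) 1) :
    primitive (g + h) ξ = primitive g ξ + primitive h ξ := by
  rw [primitive_congr (Lp.coeFn_add g h) hξ]
  exact intervalIntegral.integral_add (intervalIntegrable_coeFn g hξ)
    (intervalIntegrable_coeFn h hξ)

theorem primitive_smul (a : ℝ) (g : L2) {ξ : ℝ} (hξ : ξ ∈ Icc (0 : ℝ) 1) :
    primitive (a • g) ξ = a • primitive g ξ := by
  rw [primitive_congr (Lp.coeFn_smul a g) hξ]
  exact intervalIntegral.integral_smul a _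

theorem primitiveL2_add (g h : L2) : primitiveL2 (g + h) = primitiveL2 g + primitiveL2 h := by
  apply Lp.ext
  filter_upwards [coeFn_primitiveL2 g, coeFn_primitiveL2 h, coeFn_primitiveL2 (g + h),
    Lp.coeFn_add (primitiveL2 g) (primitiveL2 h), ae_restrict_mem measurableSet_Ioo]
    with ξ h1 h2 h3 h4 h5
  rw [h3, h4, Pi.add_apply, h1, h2, primitive_add g h (Ioo_subset_Icc_self h5)]

theorem primitiveL2_smul (a : ℝ) (g : L2) : primitiveL2 (a • g) = a • primitiveL2 g := by
  apply Lp.ext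
  filter_upwards [coeFn_primitiveL2 g, coeFn_primitiveL2 (a • g),
    Lp.coeFn_smul a (primitiveL2 g), ae_restrict_mem measurableSet_Ioo] with ξ h1 h3 h4 h5
  rw [h3, h4, Pi.smul_apply, h1, primitive_smul a g (Ioo_subset_Icc_self h5)]

/-- An `L²` function is the weak derivative of its primitive, by Fubini's theorem on the triangle
`s < ξ`. -/
theorem hasWeakDeriv_primitiveL2 (g : L2) : HasWeakDeriv (primitiveL2 g) g := by
  intro θ hθ _ hs
  have hθd : Continuous (deriv θ) := hθ.continuous_deriv (by simp)
  have hθ1 : θ 1 = 0 := by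
    by_contra h
    exact (hs (subset_tsupport θ h)).2.ne rfl
  set f : ℝ × ℝ → Plane := {z : ℝ × ℝ | z.2 < z.1}.indicator fun z => deriv θ z.1 • g z.2 with hf
  have hfi : Integrable f (unitMeasure.prod unitMeasure) := by
    refine Integrable.indicator ?_ (measurableSet_lt measurable_snd measurable_fst)
    refine Integrable.smul_prod ?_ (integrable_coeFn g)
    exact (hθd.integrableOn_Icc (a := 0) (b := 1)).mono_set Ioo_subset_Icc_self
  have h1 := integral_integral_swap (f := fun ξ s => f (ξ, s)) hfi
  have h2 : ∫ ξ, deriv θ ξ • primitiveL2 g ξ ∂unitMeasure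
      = ∫ ξ, ∫ s, f (ξ, s) ∂unitMeasure ∂unitMeasure := by
    refine integral_congr_ae ?_
    filter_upwards [coeFn_primitiveL2 g, ae_restrict_mem measurableSet_Ioo] with ξ h3 hξ
    rw [h3, primitive, intervalIntegral.integral_of_le hξ.1.le, integral_Ioc_eq_integral_Ioo,
      ← integral_smul]
    have e : (fun s => f (ξ, s)) = (Iio ξ).indicator fun s => deriv θ ξ • g s := by
      ext1 s
      simp only [hf, indicator, mem_ofPred_eq, mem_Iio]
    rw [e, setIntegral_indicator measurableSet_Iio, Ioo_inter_Iio, min_eq_right hξ.2.le]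
  have h4 : ∀ s ∈ Ioo (0 : ℝ) 1, ∫ ξ, f (ξ, s) ∂unitMeasure = -(θ s • g s) := by
    intro s hs'
    have e : (fun ξ => f (ξ, s)) = (Ioi s).indicator fun ξ => deriv θ ξ • g s := by
      ext1 ξ
      simp only [hf, indicator, mem_ofPred_eq, mem_Ioi]
    rw [e, setIntegral_indicator measurableSet_Ioi, Ioo_inter_Ioi, max_eq_right hs'.1.le,
      integral_smul_const, ← integral_Ioc_eq_integral_Ioo,
      ← intervalIntegral.integral_of_le hs'.2.le,
      intervalIntegral.integral_deriv_eq_sub (fun x _ => hθ.differentiable (by simp) x)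
        (hθd.intervalIntegrable _ _), hθ1, zero_sub, neg_smul]
  rw [h2, h1, ← integral_neg]
  exact integral_congr_ae (by
    filter_upwards [ae_restrict_mem measurableSet_Ioo] with s hs'
    exact h4 s hs')

end WeakDerivative

end SingleTrack

namespace SingleTrack

/-! ### The transport operator -/

namespace Model

variable (D : Model)

/-- The bounded functional `ζ ↦ 𝒦₄ ζ` without its boundary term. -/
noncomputable abbrev k₄ : L2 →L[ℝ] Plane := kernelOp D.K₄ D.K₄_continuousOn

theorem op_lam_inv (v : Plane) : op D.Lam (op D.Lam⁻¹ v) = v := by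
  have h : IsUnit D.Lam.det := (Matrix.isUnit_iff_isUnit_det _).1 D.Lam_posDef.isUnit
  rw [← op_mul_apply, Matrix.mul_nonsing_inv _ h, op_one_apply]

theorem liftOp_lam_inv (f : L2) : liftOp (op D.Lam) (liftOp (op D.Lam⁻¹) f) = f := by
  rw [liftOp_comp]
  have : (op D.Lam).comp (op D.Lam⁻¹) = ContinuousLinearMap.id ℝ Plane := by
    ext1 v
    exact D.op_lam_inv v
  rw [this, liftOp_id]

theorem transportGraph_iff {ζ w : L2} : D.TransportGraph ζ w ↔
    ∃ (g : L2) (f : ℝ → Plane), HasWeakDeriv ζ g ∧ ContinuousOn f (Icc 0 1) ∧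
      ζ =ᵐ[unitMeasure] f ∧ f 0 = 0 ∧
      w = -liftOp (op D.Lam) g + constOp (D.k₄ ζ + op D.K₅ (f 1)) := by
  simp only [TransportGraph, kernelOp_apply]
  rfl

/-- The graph of the transport operator, as a linear subspace. -/
noncomputable def transportSubmodule : Submodule ℝ (L2 × L2) where
  carrier := {p | D.TransportGraph p.1 p.2}
  add_mem' := by
    rintro ⟨ζ, w⟩ ⟨ζ', w'⟩ h h'
    simp only [mem_ofPred_eq, Prod.mk_add_mk, transportGraph_iff] at h h' ⊢
    obtain ⟨g, f, hg, hf, hζ, h0, rfl⟩ := h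
    obtain ⟨g', f', hg', hf', hζ', h0', rfl⟩ := h'
    refine ⟨g + g', fun ξ => f ξ + f' ξ, ?_, hf.add hf', ?_, by simp [h0, h0'], ?_⟩
    · rw [hasWeakDeriv_iff] at *
      intro θ hθ hc hs
      rw [map_add, map_add, hg θ hθ hc hs, hg' θ hθ hc hs]
      abel
    · filter_upwards [hζ, hζ', Lp.coeFn_add ζ ζ'] with ξ h1 h2 h3
      rw [h3, Pi.add_apply, h1, h2]
    · simp only [map_add]
      abel
  zero_mem' := by
    simp only [mem_ofPred_eq, transportGraph_iff, Prod.fst_zero, Prod.snd_zero]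
    refine ⟨0, fun _ => 0, ?_, continuousOn_const, Lp.coeFn_zero _ _ _, rfl, by simp⟩
    rw [hasWeakDeriv_iff]
    intro θ hθ hc hs
    simp
  smul_mem' := by
    rintro a ⟨ζ, w⟩ h
    simp only [mem_ofPred_eq, Prod.smul_mk, transportGraph_iff] at h ⊢
    obtain ⟨g, f, hg, hf, hζ, h0, rfl⟩ := h
    refine ⟨a • g, fun ξ => a • f ξ, ?_, hf.const_smul a, ?_, by simp [h0], ?_⟩
    · rw [hasWeakDeriv_iff] at *
      intro θ hθ hc hs
      rw [map_smul, map_smul, hg θ hθ hc hs, smul_neg]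
    · filter_upwards [hζ, Lp.coeFn_smul a ζ] with ξ h1 h3
      rw [h3, Pi.smul_apply, h1]
    · simp only [map_smul, smul_add, smul_neg]
      rw [← smul_add, map_smul, map_add, smul_add]

theorem mem_transportSubmodule {ζ w : L2} :
    (ζ, w) ∈ D.transportSubmodule ↔ D.TransportGraph ζ w := Iff.rfl

/-- The operator `𝒜` is single-valued, because weak derivatives and continuous representatives are
unique. -/
theorem transportGraph_single {w : L2} (h : D.TransportGraph 0 w) : w = 0 := by
  rw [transportGraph_iff] at h
  obtain ⟨g, f, hg, hf, hζ, h0, rfl⟩ := h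
  have hf0 : EqOn f 0 (Icc 0 1) := by
    have h1 : f =ᵐ[volume.restrict (Ioo (0 : ℝ) 1)] (0 : ℝ → Plane) := by
      filter_upwards [hζ, Lp.coeFn_zero Plane 2 unitMeasure] with ξ h2 h3
      rw [← h2, h3]
    have h2 : f =ᵐ[volume.restrict (Icc (0 : ℝ) 1)] (0 : ℝ → Plane) := by
      rwa [Measure.restrict_congr_set Ioo_ae_eq_Icc] at h1
    exact Measure.eqOn_Icc_of_ae_eq volume zero_ne_one h2 hf continuousOn_const
  rw [hg.zero_unique, hf0 ⟨zero_le_one, le_rfl⟩]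
  simp

/-- With `g` determined by `Λ g = f + c`, the primitive of `g` satisfies `𝒜 (∫ g) = -f` as soon as
`c` is the nonlocal term `𝒦₄ (∫ g)` of the primitive. -/
theorem transportGraph_primitive (f : L2) (c : Plane)
    (hc : c = D.k₄ (primitiveL2 (liftOp (op D.Lam⁻¹) (f + constOp c)))
      + op D.K₅ (primitive (liftOp (op D.Lam⁻¹) (f + constOp c)) 1)) :
    D.TransportGraph (primitiveL2 (liftOp (op D.Lam⁻¹) (f + constOp c))) (-f) := by
  rw [transportGraph_iff]
  refine ⟨_, _, hasWeakDeriv_primitiveL2 _, continuousOn_primitive _, coeFn_primitiveL2 _,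
    by simp [primitive], ?_⟩
  rw [← hc, liftOp_lam_inv]
  abel

variable {D} {Q : ℝ → Mat}

/-- For strictly dissipative `𝒜`, the equation `𝒜 ζ = -f` has a solution for each `f`. It is the
primitive of `Λ⁻¹ (f + c)` where the constant vector `c`, the nonlocal term of the solution, solves
a linear system of two equations; dissipativity makes this system injective. -/
theorem exists_primitive_solution (hA : D.StrictlyDissipative Q) (f : L2) : ∃ c : Plane,
    c = D.k₄ (primitiveL2 (liftOp (op D.Lam⁻¹) (f + constOp c)))
      + op D.K₅ (primitive (liftOp (op D.Lam⁻¹) (f + constOp c)) 1) := by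
  obtain ⟨-, -, κ, hκ, hdiss⟩ := hA
  have h1 : (1 : ℝ) ∈ Icc (0 : ℝ) 1 := ⟨zero_le_one, le_rfl⟩
  let N : L2 →ₗ[ℝ] Plane :=
    { toFun := fun f => D.k₄ (primitiveL2 (liftOp (op D.Lam⁻¹) f))
        + op D.K₅ (primitive (liftOp (op D.Lam⁻¹) f) 1)
      map_add' := fun f g => by
        rw [map_add, primitiveL2_add, primitive_add _ _ h1, map_add, map_add]
        abel
      map_smul' := fun a f => by
        rw [map_smul, primitiveL2_smul, primitive_smul _ _ h1, map_smul, map_smul, ← smul_add]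
        rfl }
  let S : Plane →ₗ[ℝ] Plane := LinearMap.id - N.comp constOp.toLinearMap
  have hS : Function.Injective S := by
    rw [injective_iff_map_eq_zero]
    intro c hc
    have hc' : c = N (0 + constOp c) := by
      rw [zero_add]
      exact sub_eq_zero.1 hc
    have hT := D.transportGraph_primitive 0 c hc'
    have hd := hdiss _ _ hT
    set ζ := primitiveL2 (liftOp (op D.Lam⁻¹) (0 + constOp c)) with hζ
    have h0 : ∫ ξ, inner ℝ ((-0 : L2) ξ) (op (Q ξ) (ζ ξ)) ∂unitMeasure = 0 := by
      rw [neg_zero]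
      refine integral_eq_zero_of_ae ?_
      filter_upwards [Lp.coeFn_zero Plane 2 unitMeasure] with ξ h
      rw [h]
      simp
    rw [h0] at hd
    have hζ0 : ζ = 0 := by
      have h2 : ‖ζ‖ ^ 2 ≤ 0 := by
        by_contra! h
        have := mul_pos hκ h
        linarith
      have h3 : ‖ζ‖ = 0 := by nlinarith [norm_nonneg ζ]
      simpa using h3
    have hw := hasWeakDeriv_primitiveL2 (liftOp (op D.Lam⁻¹) (0 + constOp c))
    rw [← hζ, hζ0] at hw
    have h4 := hw.zero_unique
    have h5 := D.liftOp_lam_inv (0 + constOp c)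
    rw [h4, map_zero, zero_add] at h5
    exact constOp_eq_zero h5.symm
  obtain ⟨c, hc⟩ := LinearMap.injective_iff_surjective.1 hS (N f)
  refine ⟨c, ?_⟩
  change c = N (f + constOp c)
  rw [map_add, ← hc]
  simp [S]

/-- The weight of a strictly dissipative model, as an operator on `L²`. -/
noncomputable abbrev StrictlyDissipative.weight (hA : D.StrictlyDissipative Q) : L2 →L[ℝ] L2 :=
  mulOp Q hA.1

theorem StrictlyDissipative.exists_isWeight (hA : D.StrictlyDissipative Q) :
    ∃ c, IsWeight hA.weight c :=
  isWeight_mulOp hA.1 hA.2.1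

theorem StrictlyDissipative.isMaxDissipative (hA : D.StrictlyDissipative Q) :
    ∃ κ, IsMaxDissipative hA.weight κ D.transportSubmodule := by
  obtain ⟨κ, hκ, hdiss⟩ := hA.2.2
  refine ⟨κ, hκ, fun x y h => ?_, fun f => ?_, fun y h => D.transportGraph_single h⟩
  · rw [← integral_inner_op hA.1]
    exact hdiss x y h
  · obtain ⟨c, hc⟩ := exists_primitive_solution hA f
    exact ⟨_, D.transportGraph_primitive f c hc⟩

theorem generates_iff {T : ℝ → L2 →L[ℝ] L2} :
    D.Generates T ↔ IsSemigroupOf T D.transportSubmodule :=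
  ⟨fun h => ⟨h.1.zero, h.1.add, h.1.tendsto_zero, h.2⟩,
    fun h => ⟨⟨h.zero, h.add, h.tendsto_zero⟩, h.generator⟩⟩

/-! ### Existence of the steady profile -/

/-- The bounded operator `ζ ↦ Σ(y) [ζ + 𝒦₃ ζ]`. -/
noncomputable def sourceOp (D : Model) (y : Plane) : L2 →L[ℝ] L2 :=
  (liftOp (op (D.Sig y))).comp
    (ContinuousLinearMap.id ℝ L2 + constOp.comp (kernelOp D.K₃ D.K₃_continuousOn))

theorem sourceOp_apply (y : Plane) (ζ : L2) : D.sourceOp y ζ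
    = (op (D.Sig y)).compLp (ζ + Lp.const 2 unitMeasure (kernelInt D.K₃ ζ)) := by
  rw [← kernelOp_apply D.K₃_continuousOn]
  rfl

theorem coeFn_sourceOp (y : Plane) (ζ : L2) :
    D.sourceOp y ζ =ᵐ[unitMeasure] fun ξ => op (D.Sig y) (ζ ξ + kernelInt D.K₃ ζ) := by
  rw [sourceOp_apply]
  filter_upwards [(op (D.Sig y)).coeFn_compLp
    (ζ + Lp.const 2 unitMeasure (kernelInt D.K₃ ζ)),
    Lp.coeFn_add ζ (Lp.const 2 unitMeasure (kernelInt D.K₃ ζ)),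
    Lp.coeFn_const 2 unitMeasure (kernelInt D.K₃ ζ)] with ξ h1 h2 h3
  rw [h1, h2, Pi.add_apply, h3]
  rfl

theorem inner_sourceOp_le (hA : D.StrictlyDissipative Q) (hS : D.SourceDissipativeLipschitz Q)
    (y : Plane) (ζ : L2) : inner ℝ (D.sourceOp y ζ) (hA.weight ζ) ≤ 0 := by
  obtain ⟨c, hQ⟩ := hA.exists_isWeight
  rw [hQ.symm]
  refine le_of_eq_of_le ?_ (hS.1 y ζ)
  rw [L2.inner_def]
  refine integral_congr_ae ?_
  filter_upwards [coeFn_sourceOp (D := D) y ζ, coeFn_mulOp hA.1 (D.sourceOp y ζ)] with ξ h1 h2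
  rw [h2, h1]

/-- The steady profile exists for each `y`. The equation `𝒜 φ + Σ(y) [φ + 𝒦₃ φ] = -h₂(y)` has a
solution in `L²`, by dissipativity of the bounded perturbation; this is a
primitive, hence continuous, and by the equation its derivative is continuous too. -/
theorem exists_isSteadyProfile (hA : D.StrictlyDissipative Q)
    (hS : D.SourceDissipativeLipschitz Q) (y : Plane) : ∃ f, D.IsSteadyProfile y f := by
  obtain ⟨c₀, hQ⟩ := hA.exists_isWeight
  obtain ⟨κ, hG⟩ := hA.isMaxDissipative
  obtain ⟨φ, hφ⟩ := hG.surj_add hQ (D.sourceOp y) (inner_sourceOp_le hA hS y) (constOp (D.h₂ y))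
  set ψ := D.sourceOp y φ + constOp (D.h₂ y) with hψ
  obtain ⟨c, hc⟩ := exists_primitive_solution hA ψ
  have hT := D.transportGraph_primitive ψ c hc
  set g := liftOp (op D.Lam⁻¹) (ψ + constOp c) with hg
  have hφg : φ = primitiveL2 g :=
    hG.eq_of_resolvent hQ le_rfl (f := ψ) (by simpa using hφ)
      (by simpa using D.mem_transportSubmodule.2 hT)
  have hφp : φ =ᵐ[unitMeasure] primitive g := by rw [hφg]; exact coeFn_primitiveL2 g
  -- the continuous representative of the derivative, extended to the real line
  set γ₀ : ℝ → Plane := fun ξ =>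
    op D.Lam⁻¹ (op (D.Sig y) (primitive g ξ + kernelInt D.K₃ φ) + D.h₂ y + c) with hγ₀
  have hγ₀c : ContinuousOn γ₀ (Icc 0 1) := by
    have := continuousOn_primitive g
    fun_prop
  set γ : ℝ → Plane := fun ξ => γ₀ (projIcc 0 1 zero_le_one ξ) with hγ
  have hγc : Continuous γ := hγ₀c.domRestrict.comp continuous_projIcc
  have hγe : ∀ ξ ∈ Icc (0 : ℝ) 1, γ ξ = γ₀ ξ := fun ξ hξ => by
    simp only [hγ, projIcc_of_mem _ hξ]
  have hgγ : g =ᵐ[unitMeasure] γ := by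
    filter_upwards [(op D.Lam⁻¹).coeFn_compLpL (p := 2) (μ := unitMeasure) (ψ + constOp c),
      Lp.coeFn_add ψ (constOp c), Lp.coeFn_add (D.sourceOp y φ) (constOp (D.h₂ y)),
      Lp.coeFn_const 2 unitMeasure c, Lp.coeFn_const 2 unitMeasure (D.h₂ y),
      coeFn_sourceOp (D := D) y φ, hφp, ae_restrict_mem measurableSet_Ioo]
      with ξ h1 h2 h3 h4 h5 h6 h7 h8
    rw [hγe ξ (Ioo_subset_Icc_self h8), h1, h2, Pi.add_apply, hψ, h3, Pi.add_apply, h6, h7]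
    rw [constOp_apply c, h4, constOp_apply (D.h₂ y), h5]
    rfl
  set f : ℝ → Plane := fun ξ => ∫ s in (0 : ℝ)..ξ, γ s with hf
  have hfd : ∀ ξ, HasDerivAt f (γ ξ) ξ := fun ξ =>
    intervalIntegral.integral_hasDerivAt_right (hγc.intervalIntegrable _ _)
      (hγc.stronglyMeasurableAtFilter _ _) hγc.continuousAt
  have hfp : ∀ ξ ∈ Icc (0 : ℝ) 1, primitive g ξ = f ξ := fun ξ hξ => primitive_congr hgγ hξ
  have hfφ : f =ᵐ[unitMeasure] φ := by
    filter_upwards [hφp, ae_restrict_mem measurableSet_Ioo] with ξ h1 h2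
    rw [h1, hfp ξ (Ioo_subset_Icc_self h2)]
  have hderiv : deriv f = γ := funext fun ξ => (hfd ξ).deriv
  refine ⟨f, ?_, by simp [hf], fun ξ hξ => ?_⟩
  · refine (contDiff_one_iff_deriv.2 ⟨fun ξ => (hfd ξ).differentiableAt, ?_⟩).contDiffOn
    rw [hderiv]
    exact hγc
  · have hξ' := Ioo_subset_Icc_self hξ
    rw [hderiv, hγe ξ hξ']
    simp only [hγ₀]
    rw [op_lam_inv, hfp ξ hξ', kernelInt_congr D.K₃ hfφ, kernelInt_congr D.K₄ hfφ,
      ← hfp 1 ⟨zero_le_one, le_rfl⟩]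
    have hc' : c = kernelInt D.K₄ φ + op D.K₅ (primitive g 1) := by
      rw [← kernelOp_apply D.K₄_continuousOn, hφg]
      exact hc
    rw [← hc']
    abel

theorem isSteadyProfile_profile (hA : D.StrictlyDissipative Q)
    (hS : D.SourceDissipativeLipschitz Q) (y : Plane) : D.IsSteadyProfile y (D.profile y) := by
  have h := exists_isSteadyProfile hA hS y
  unfold profile
  rw [dif_pos h]
  exact h.choose_spec

end Model

end SingleTrack

namespace SingleTrack

/-! ### The steady profile and local Lipschitz continuity of the coefficients -/

namespace Model

variable {D : Model} {Q : ℝ → Mat}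

/-- The mean of an `L²` function, as a bounded operator. -/
noncomputable def meanOp : L2 →L[ℝ] Plane := kernelOp (fun _ => 1) continuousOn_const

theorem meanOp_apply (f : L2) : meanOp f = ∫ ξ, f ξ ∂unitMeasure := by
  rw [meanOp, kernelOp_apply, kernelInt]
  refine integral_congr_ae (Eventually.of_forall fun ξ => ?_)
  exact op_one_apply _

theorem meanOp_constOp (v : Plane) : meanOp (constOp v) = v := by
  rw [meanOp_apply, constOp_apply v, integral_congr_ae (Lp.coeFn_const 2 unitMeasure v)]
  simp

theorem meanOp_liftOp (A : Plane →L[ℝ] Plane) (f : L2) :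
    meanOp (liftOp A f) = A (meanOp f) := by
  rw [meanOp_apply, meanOp_apply, integral_congr_ae (A.coeFn_compLpL f)]
  exact A.integral_comp_comm (integrable_coeFn f)

theorem meanOp_eq_primitive (f : L2) : meanOp f = primitive f 1 := by
  rw [meanOp_apply, primitive, intervalIntegral.integral_of_le zero_le_one,
    integral_Ioc_eq_integral_Ioo]

theorem coeFn_profileL2 (y : Plane) : D.profileL2 y =ᵐ[unitMeasure] D.profile y :=
  (D.profile_memLp y).coeFn_toLp

/-- The steady equation in `L²`, with the derivative `g` of the profile. -/
theorem exists_deriv_profile (hA : D.StrictlyDissipative Q)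
    (hS : D.SourceDissipativeLipschitz Q) (y : Plane) : ∃ g : L2,
      (∀ ξ ∈ Icc (0 : ℝ) 1, primitive g ξ = D.profile y ξ) ∧
      liftOp (op D.Lam) g = D.sourceOp y (D.profileL2 y)
        + constOp (D.k₄ (D.profileL2 y) + op D.K₅ (D.profile y 1)) + constOp (D.h₂ y) := by
  obtain ⟨hf, hf0, heq⟩ := isSteadyProfile_profile hA hS y
  set f := D.profile y with hfdef
  have hu : UniqueDiffOn ℝ (Icc (0 : ℝ) 1) := uniqueDiffOn_Icc zero_lt_one
  have hdc : ContinuousOn (derivWithin f (Icc 0 1)) (Icc 0 1) :=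
    hf.continuousOn_derivWithin hu le_rfl
  have hmem := memLp_of_continuousOn hdc
  have hda : ∀ ξ ∈ Ioo (0 : ℝ) 1, HasDerivAt f (derivWithin f (Icc 0 1) ξ) ξ := fun ξ hξ =>
    ((hf.differentiableOn one_ne_zero ξ (Ioo_subset_Icc_self hξ)).hasDerivWithinAt).hasDerivAt
      (Icc_mem_nhds hξ.1 hξ.2)
  refine ⟨hmem.toLp, fun ξ hξ => ?_, ?_⟩
  · rw [primitive_congr hmem.coeFn_toLp hξ]
    have h1 := intervalIntegral.integral_eq_sub_of_hasDerivAt_of_le hξ.1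
      (hf.continuousOn.mono (Icc_subset_Icc_right hξ.2))
      (fun s hs => hda s ⟨hs.1, hs.2.trans_le hξ.2⟩)
      ((hdc.mono (by rw [uIcc_of_le hξ.1]; exact Icc_subset_Icc_right hξ.2)).intervalIntegrable)
    rw [h1, hf0, sub_zero]
  · apply Lp.ext
    set p := D.profileL2 y with hp
    set v := D.k₄ p + op D.K₅ (f 1) with hv
    have hpf : p =ᵐ[unitMeasure] f := coeFn_profileL2 y
    have hv' : v = kernelInt D.K₄ f + op D.K₅ (f 1) := by
      rw [hv, kernelOp_apply, kernelInt_congr D.K₄ hpf]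
    filter_upwards [(op D.Lam).coeFn_compLpL (p := 2) (μ := unitMeasure) hmem.toLp,
      hmem.coeFn_toLp, Lp.coeFn_add (D.sourceOp y p + constOp v) (constOp (D.h₂ y)),
      Lp.coeFn_add (D.sourceOp y p) (constOp v), coeFn_sourceOp (D := D) y p, hpf,
      Lp.coeFn_const 2 unitMeasure v, Lp.coeFn_const 2 unitMeasure (D.h₂ y),
      ae_restrict_mem measurableSet_Ioo] with ξ h1 h2 h3 h4 h5 h6 h7 h8 h9
    rw [h1, h2, h3, Pi.add_apply, h4, Pi.add_apply, h5, h6, constOp_apply v, h7,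
      constOp_apply (D.h₂ y), h8, ← (hda ξ h9).deriv, heq ξ h9, hv', kernelInt_congr D.K₃ hpf]
    rfl

/-- The steady profile lies in the domain of the transport operator and
`𝒜 φ = -(Σ(y) [φ + 𝒦₃ φ] + h₂(y))`. -/
theorem profile_mem_graph (hA : D.StrictlyDissipative Q) (hS : D.SourceDissipativeLipschitz Q)
    (y : Plane) : (D.profileL2 y, -(D.sourceOp y (D.profileL2 y) + constOp (D.h₂ y))) ∈
      D.transportSubmodule := by
  obtain ⟨g, hg, heq⟩ := exists_deriv_profile hA hS y
  rw [mem_transportSubmodule, transportGraph_iff]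
  have hc := (D.profile_contDiffOn y).continuousOn
  have h1 : D.profileL2 y = primitiveL2 g := by
    apply Lp.ext
    filter_upwards [coeFn_profileL2 (D := D) y, coeFn_primitiveL2 g,
      ae_restrict_mem measurableSet_Ioo] with ξ h1 h2 h3
    rw [h1, h2, hg ξ (Ioo_subset_Icc_self h3)]
  refine ⟨g, D.profile y, ?_, hc, coeFn_profileL2 y, ?_, ?_⟩
  · rw [h1]
    exact hasWeakDeriv_primitiveL2 g
  · rw [← hg 0 ⟨le_rfl, zero_le_one⟩]
    simp [primitive]
  · rw [heq]
    abel

/-- The profile depends Lipschitz continuously on the slip angles, uniformly in `ξ`. -/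
theorem exists_profile_lipschitz (hR : D.SteadyRegular) : ∃ M, 0 ≤ M ∧ ∀ ξ ∈ Icc (0 : ℝ) 1,
    ∀ y₁ y₂, ‖D.profile y₁ ξ - D.profile y₂ ξ‖ ≤ M * ‖y₁ - y₂‖ := by
  obtain ⟨hφ, -, M, hM, hb⟩ := hR
  refine ⟨M, hM, fun ξ hξ y₁ y₂ => ?_⟩
  have hd : ContDiffOn ℝ 1 (fun v => D.profile v ξ) univ :=
    hφ.comp (f := fun v : Plane => (ξ, v)) (contDiff_const.prodMk contDiff_id).contDiffOn
      fun v _ => ⟨hξ, mem_univ v⟩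
  exact convex_univ.norm_image_sub_le_of_norm_fderiv_le (𝕜 := ℝ)
    (fun v _ => (contDiffOn_univ.1 hd).differentiable one_ne_zero v) (fun v _ => hb ξ hξ v)
    (mem_univ y₂) (mem_univ y₁)

theorem exists_profileL2_lipschitz (hR : D.SteadyRegular) : ∃ M, 0 ≤ M ∧
    ∀ y₁ y₂, ‖D.profileL2 y₁ - D.profileL2 y₂‖ ≤ M * ‖y₁ - y₂‖ := by
  obtain ⟨M, hM, h⟩ := exists_profile_lipschitz hR
  refine ⟨M, hM, fun y₁ y₂ => ?_⟩
  have h1 := Lp.norm_le_of_ae_bound (f := D.profileL2 y₁ - D.profileL2 y₂)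
    (C := M * ‖y₁ - y₂‖) (by positivity) (by
      filter_upwards [Lp.coeFn_sub (D.profileL2 y₁) (D.profileL2 y₂), coeFn_profileL2 (D := D) y₁,
        coeFn_profileL2 (D := D) y₂, ae_restrict_mem measurableSet_Ioo] with ξ h1 h2 h3 h4
      rw [h1, Pi.sub_apply, h2, h3]
      exact h ξ (Ioo_subset_Icc_self h4) y₁ y₂)
  have h2 : measureUnivNNReal unitMeasure = 1 := by
    simp [measureUnivNNReal]
  simpa [h2] using h1

theorem lipOnBounded_sig (hS : D.SourceDissipativeLipschitz Q) :
    LipOnBounded fun y => op (D.Sig y) := by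
  obtain ⟨L, hL, h⟩ := hS.2
  refine .of_lipschitz hL fun x y => ?_
  have : op (D.Sig x) - op (D.Sig y) = op (D.Sig x - D.Sig y) := (map_sub _ _ _).symm
  rw [this]
  exact h x y

theorem lipOnBounded_profileL2 (hR : D.SteadyRegular) : LipOnBounded D.profileL2 := by
  obtain ⟨M, hM, h⟩ := exists_profileL2_lipschitz hR
  exact .of_lipschitz hM h

/-- The coefficient `h₂` is locally Lipschitz, because the integrated steady equation expresses it
by the profile. -/
theorem lipOnBounded_h₂ (hA : D.StrictlyDissipative Q) (hS : D.SourceDissipativeLipschitz Q)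
    (hR : D.SteadyRegular) : LipOnBounded D.h₂ := by
  have e : ∀ y, D.h₂ y = op D.Lam (D.profile y 1)
      - (op (D.Sig y) (meanOp (D.profileL2 y) + kernelOp D.K₃ D.K₃_continuousOn (D.profileL2 y))
        + (D.k₄ (D.profileL2 y) + op D.K₅ (D.profile y 1))) := by
    intro y
    obtain ⟨g, hg, heq⟩ := exists_deriv_profile hA hS y
    have h1 := congrArg meanOp heq
    rw [meanOp_liftOp, meanOp_eq_primitive, hg 1 ⟨zero_le_one, le_rfl⟩, map_add, map_add,
      meanOp_constOp, meanOp_constOp] at h1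
    have h2 : meanOp (D.sourceOp y (D.profileL2 y)) = op (D.Sig y) (meanOp (D.profileL2 y)
        + kernelOp D.K₃ D.K₃_continuousOn (D.profileL2 y)) := by
      rw [sourceOp, ContinuousLinearMap.comp_apply, meanOp_liftOp, add_apply, map_add,
        ContinuousLinearMap.comp_apply, meanOp_constOp]
      rfl
    rw [h1, h2]
    abel
  have hp := lipOnBounded_profileL2 hR
  have h1 : LipOnBounded fun y => D.profile y 1 := by
    obtain ⟨M, hM, h⟩ := exists_profile_lipschitz hR
    exact .of_lipschitz hM (h 1 ⟨zero_le_one, le_rfl⟩)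
  have := ((LipOnBounded.clm (op D.Lam)).comp h1).sub
    (((lipOnBounded_sig hS).clm_apply (((LipOnBounded.clm meanOp).comp hp).add
      ((LipOnBounded.clm (kernelOp D.K₃ D.K₃_continuousOn)).comp hp))).add
    (((LipOnBounded.clm D.k₄).comp hp).add ((LipOnBounded.clm (op D.K₅)).comp h1)))
  simpa only [← e] using this

/-- The part `𝒦₁ z + Σ(y) 𝒦₂ z` of the tire force that depends linearly on the state of the
bristles. -/
noncomputable def forceOp (D : Model) (y : Plane) : L2 →L[ℝ] Plane :=
  kernelOp D.K₁ D.K₁_continuousOn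
    + (op (D.Sig y)).comp (kernelOp D.K₂ D.K₂_continuousOn)

theorem steadyForce_eq (y : Plane) :
    D.steadyForce y = D.forceOp y (D.profileL2 y) + D.h₁ y := by
  rw [steadyForce, forceOp, add_apply, ContinuousLinearMap.comp_apply,
    kernelOp_apply, kernelOp_apply, kernelInt_congr D.K₁ (coeFn_profileL2 y),
    kernelInt_congr D.K₂ (coeFn_profileL2 y)]

theorem lipOnBounded_forceOp (hS : D.SourceDissipativeLipschitz Q) {V : Type*}
    [NormedAddCommGroup V] {y : V → Plane} {z : V → L2} (hy : LipOnBounded y)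
    (hz : LipOnBounded z) : LipOnBounded fun w => D.forceOp (y w) (z w) :=
  ((LipOnBounded.clm (kernelOp D.K₁ D.K₁_continuousOn)).comp hz).add
    (((lipOnBounded_sig hS).comp hy).clm_apply
      ((LipOnBounded.clm (kernelOp D.K₂ D.K₂_continuousOn)).comp hz))

theorem lipOnBounded_sourceOp (hS : D.SourceDissipativeLipschitz Q) {V : Type*}
    [NormedAddCommGroup V] {y : V → Plane} {z : V → L2} (hy : LipOnBounded y)
    (hz : LipOnBounded z) : LipOnBounded fun w => D.sourceOp (y w) (z w) := by
  have h1 : LipOnBounded fun A : Plane →L[ℝ] Plane => liftOp A := by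
    refine .of_lipschitz zero_le_one fun A B => ?_
    rw [← liftOp_sub, one_mul]
    exact norm_liftOp_le _
  exact (h1.comp ((lipOnBounded_sig hS).comp hy)).clm_apply
    ((LipOnBounded.clm (ContinuousLinearMap.id ℝ L2
      + constOp.comp (kernelOp D.K₃ D.K₃_continuousOn))).comp hz)

/-- The coefficient `h₁` is locally Lipschitz, because it is the difference of the `C¹` steady
force and of the linear force of the profile. -/
theorem lipOnBounded_h₁ (hS : D.SourceDissipativeLipschitz Q) (hR : D.SteadyRegular) :
    LipOnBounded D.h₁ := by
  have e : ∀ y, D.h₁ y = D.steadyForce y - D.forceOp y (D.profileL2 y) := fun y => by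
    rw [steadyForce_eq]; abel
  have := (LipOnBounded.of_contDiff hR.2.1).sub (lipOnBounded_forceOp hS
    (LipOnBounded.clm (ContinuousLinearMap.id ℝ Plane)) (lipOnBounded_profileL2 hR))
  simp only [ContinuousLinearMap.id_apply, ← e] at this
  exact this

theorem odeField_eq (U : Plane) (w : StateSpace) : D.odeField U w = op D.A₁ w.fst
    + op D.G₁ (D.forceOp (D.slip w.fst U) w.snd + D.h₁ (D.slip w.fst U)) + D.b := by
  rw [odeField, forceOp, add_apply, ContinuousLinearMap.comp_apply, kernelOp_apply,
    kernelOp_apply, map_add (op D.G₁) (_ + _) (D.h₁ _)]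
  abel

theorem source_eq (U : Plane) (w : StateSpace) : D.source U w
    = D.sourceOp (D.slip w.fst U) w.snd + constOp (D.h₂ (D.slip w.fst U)) := by
  rw [source, sourceOp_apply]
  rfl

theorem lipOnBounded_slip (U : Plane) : LipOnBounded fun w : StateSpace => D.slip w.fst U :=
  ((LipOnBounded.clm (op D.A₂)).comp (LipOnBounded.clm (WithLp.fstL 2 ℝ Plane L2))).add
    (LipOnBounded.const _)

theorem lipOnBounded_odeField (hS : D.SourceDissipativeLipschitz Q) (hR : D.SteadyRegular)
    (U : Plane) : LipOnBounded (D.odeField U) := by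
  have h1 := LipOnBounded.clm (WithLp.fstL 2 ℝ Plane L2)
  have h2 := LipOnBounded.clm (WithLp.sndL 2 ℝ Plane L2)
  have h3 := lipOnBounded_slip (D := D) U
  have := (((LipOnBounded.clm (op D.A₁)).comp h1).add ((LipOnBounded.clm (op D.G₁)).comp
    ((lipOnBounded_forceOp hS h3 h2).add ((lipOnBounded_h₁ hS hR).comp h3)))).add
    (LipOnBounded.const D.b)
  have e : D.odeField U = _ := funext (odeField_eq U)
  rw [e]
  exact this

theorem lipOnBounded_source (hA : D.StrictlyDissipative Q) (hS : D.SourceDissipativeLipschitz Q)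
    (hR : D.SteadyRegular) (U : Plane) : LipOnBounded (D.source U) := by
  have h2 := LipOnBounded.clm (WithLp.sndL 2 ℝ Plane L2)
  have h3 := lipOnBounded_slip (D := D) U
  have := (lipOnBounded_sourceOp hS h3 h2).add
    ((LipOnBounded.clm constOp).comp ((lipOnBounded_h₂ hA hS hR).comp h3))
  have e : D.source U = _ := funext (source_eq U)
  rw [e]
  exact this

/-- The nonlinearity of the whole system, `(X, z) ↦ (X', ε⁻¹ (Σ(α) [z + 𝒦₃ z] + h₂(α)))`. -/
noncomputable def field (D : Model) (ε : ℝ) (U : Plane) (w : StateSpace) : StateSpace :=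
  WithLp.toLp 2 (D.odeField U w, ε⁻¹ • D.source U w)

theorem lipOnBounded_field (hA : D.StrictlyDissipative Q) (hS : D.SourceDissipativeLipschitz Q)
    (hR : D.SteadyRegular) (ε : ℝ) (U : Plane) : LipOnBounded (D.field ε U) := by
  let i : Plane →L[ℝ] StateSpace :=
    (WithLp.prodContinuousLinearEquiv 2 ℝ Plane L2).symm.toContinuousLinearMap.comp
      (ContinuousLinearMap.inl ℝ Plane L2)
  let j : L2 →L[ℝ] StateSpace :=
    (WithLp.prodContinuousLinearEquiv 2 ℝ Plane L2).symm.toContinuousLinearMap.comp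
      (ContinuousLinearMap.inr ℝ Plane L2)
  have h := ((LipOnBounded.clm i).comp (lipOnBounded_odeField hS hR U)).add
    ((LipOnBounded.clm (ε⁻¹ • j)).comp (lipOnBounded_source hA hS hR U))
  have e : D.field ε U = fun w => i (D.odeField U w) + (ε⁻¹ • j) (D.source U w) := by
    funext w
    refine (WithLp.equiv 2 (Plane × L2)).injective (Prod.ext ?_ ?_)
    · change D.odeField U w = D.odeField U w + ε⁻¹ • (0 : Plane)
      simp
    · change ε⁻¹ • D.source U w = 0 + ε⁻¹ • D.source U w
      simp
  rw [e]
  exact h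

end Model

end SingleTrack

namespace SingleTrack

/-! ### Lyapunov matrices -/

section Hurwitz

/-- The roots of the characteristic polynomial are eigenvalues. -/
theorem mem_spectrum_of_root (A : Mat) (μ : ℂ)
    (h : μ ^ 2 - (A.trace : ℂ) * μ + (A.det : ℂ) = 0) :
    μ ∈ spectrum ℂ (A.map (algebraMap ℝ ℂ)) := by
  rw [spectrum.mem_iff, Matrix.isUnit_iff_isUnit_det, isUnit_iff_ne_zero, not_not,
    Matrix.det_fin_two]
  rw [Matrix.det_fin_two, Matrix.trace_fin_two] at h
  push_cast at h
  simp [Matrix.algebraMap_matrix_apply]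
  linear_combination h

/-- A Hurwitz `2 × 2` matrix has negative trace and positive determinant. -/
theorem IsHurwitz.trace_neg_det_pos {A : Mat} (hA : IsHurwitz A) : A.trace < 0 ∧ 0 < A.det := by
  have key : ∀ s : ℂ, s ^ 2 = (A.trace : ℂ) ^ 2 - 4 * A.det →
      A.trace + s.re < 0 ∧ A.trace - s.re < 0 := by
    intro s hs
    have h1 := hA _ (mem_spectrum_of_root A ((A.trace + s) / 2) (by linear_combination hs / 4))
    have h2 := hA _ (mem_spectrum_of_root A ((A.trace - s) / 2) (by linear_combination hs / 4))
    have e1 : (((A.trace : ℂ) + s) / 2).re = (A.trace + s.re) / 2 := by simp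
    have e2 : (((A.trace : ℂ) - s) / 2).re = (A.trace - s.re) / 2 := by simp
    rw [e1] at h1
    rw [e2] at h2
    constructor <;> linarith
  obtain ⟨s, hs⟩ := IsAlgClosed.exists_pow_nat_eq ((A.trace : ℂ) ^ 2 - 4 * A.det) two_pos
  obtain ⟨h1, h2⟩ := key s hs
  have htr : A.trace < 0 := by linarith
  refine ⟨htr, ?_⟩
  by_contra! hdet
  have h3 : 0 ≤ A.trace ^ 2 - 4 * A.det := by nlinarith [sq_nonneg A.trace]
  obtain ⟨h4, -⟩ := key (Real.sqrt (A.trace ^ 2 - 4 * A.det) : ℝ) (by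
    rw [← Complex.ofReal_pow, Real.sq_sqrt h3]
    push_cast
    ring)
  rw [Complex.ofReal_re] at h4
  have h5 : -A.trace ≤ Real.sqrt (A.trace ^ 2 - 4 * A.det) :=
    Real.le_sqrt_of_sq_le (by nlinarith)
  linarith

/-- For a Hurwitz `2 × 2` matrix `A` with adjugate `B`, the matrix `P = det A + Bᵀ B` solves
`Aᵀ P + P A = 2 tr A det A`, because `A + B = tr A` and `A B = B A = det A`. -/
theorem IsHurwitz.exists_isLyapunovMatrix {A : Mat} (hA : IsHurwitz A) :
    ∃ P, IsLyapunovMatrix A P := by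
  obtain ⟨htr, hdet⟩ := hA.trace_neg_det_pos
  refine ⟨A.det • (1 : Mat) + A.adjugate.transpose * A.adjugate, ?_, -(A.trace * A.det), ?_, ?_⟩
  · refine Matrix.PosDef.add_posSemidef (Matrix.PosDef.one.smul hdet) ?_
    have := Matrix.posSemidef_conjTranspose_mul_self A.adjugate
    rwa [Matrix.conjTranspose_eq_transpose_of_trivial] at this
  · nlinarith
  · rw [Matrix.det_fin_two, Matrix.trace_fin_two, Matrix.adjugate_fin_two]
    ext i j
    fin_cases i <;> fin_cases j <;>
      simp [Matrix.mul_apply, Fin.sum_univ_two] <;> ring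

theorem inner_op_eq (A : Mat) (v w : Plane) :
    inner ℝ v (op A w) = v 0 * (A 0 0 * w 0 + A 0 1 * w 1) + v 1 * (A 1 0 * w 0 + A 1 1 * w 1) := by
  simp only [PiLp.inner_apply, Fin.sum_univ_two, op_apply]
  simp
  ring

/-- A positive definite matrix is coercive, by compactness of the unit circle. -/
theorem isWeight_op {P : Mat} (hP : P.PosDef) : ∃ c, IsWeight (op P) c := by
  have hs : P 0 1 = P 1 0 := by
    have := hP.isHermitian.apply 0 1
    simpa using this.symm
  have hpos : ∀ v : Plane, v ≠ 0 → 0 < inner ℝ v (op P v) := by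
    intro v hv
    have h1 : (WithLp.ofLp v) ≠ 0 := fun h => hv (by ext i; exact congrFun h i)
    have h2 := hP.dotProduct_mulVec_pos h1
    rw [inner_op_eq]
    simp [dotProduct, Matrix.mulVec, Fin.sum_univ_two] at h2
    linarith
  have hc : ContinuousOn (fun v : Plane => inner ℝ v (op P v)) (Metric.sphere 0 1) := by fun_prop
  obtain ⟨v₀, hv₀, hmin⟩ := (isCompact_sphere (0 : Plane) 1).exists_isMinOn
    (NormedSpace.sphere_nonempty.2 zero_le_one) hc
  have hv₀' : v₀ ≠ 0 := fun h => by simp [h] at hv₀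
  refine ⟨inner ℝ v₀ (op P v₀), hpos v₀ hv₀', fun v w => ?_, fun v => ?_⟩
  · rw [inner_op_eq, inner_op_eq, hs]
    ring
  · rcases eq_or_ne v 0 with rfl | hv
    · simp [wsq]
    · have hn : 0 < ‖v‖ := norm_pos_iff.2 hv
      have h1 : ‖v‖⁻¹ • v ∈ Metric.sphere (0 : Plane) 1 := by
        rw [mem_sphere_zero_iff_norm, norm_smul, norm_inv, norm_norm, inv_mul_cancel₀ hn.ne']
      have h2 : inner ℝ v₀ (op P v₀) ≤ wsq (op P) (‖v‖⁻¹ • v) := hmin h1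
      rw [wsq_smul, inv_pow, le_inv_mul_iff₀ (by positivity)] at h2
      linarith

/-- The Lyapunov equation as the derivative of `½ Zᵀ P Z` along `Z' = A Z`. -/
theorem IsLyapunovMatrix.inner_eq {A P : Mat} {q : ℝ} (hP : P.PosDef)
    (h : A.transpose * P + P * A = -(2 * q) • (1 : Mat)) (v : Plane) :
    inner ℝ (op A v) (op P v) = -q * ‖v‖ ^ 2 := by
  have hs : P 0 1 = P 1 0 := by
    have := hP.isHermitian.apply 0 1
    simpa using this.symm
  have h00 := congrFun (congrFun h 0) 0
  have h01 := congrFun (congrFun h 0) 1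
  have h11 := congrFun (congrFun h 1) 1
  simp [Matrix.mul_apply, Fin.sum_univ_two] at h00 h01 h11
  have e : ‖v‖ ^ 2 = v 0 * v 0 + v 1 * v 1 := by
    rw [← real_inner_self_eq_norm_sq]
    simp only [PiLp.inner_apply, Fin.sum_univ_two]
    simp [pow_two]
  rw [inner_op_eq, e, op_apply, op_apply]
  simp only [Fin.sum_univ_two]
  rw [hs] at *
  linear_combination (v 0 * v 0 / 2) * h00 + (v 0 * v 1) * h01 + (v 1 * v 1 / 2) * h11

end Hurwitz

/-! ### The reduced vector field -/

namespace Model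

variable {D : Model}

/-- The reduced vector field `X ↦ A₁ X + G₁ Φ(α(X, U)) + b`. -/
noncomputable def reducedField (D : Model) (U X : Plane) : Plane :=
  op D.A₁ X + op D.G₁ (D.steadyForce (D.slip X U)) + D.b

theorem op_cornering (y v : Plane) : op (D.cornering y) v = fderiv ℝ D.steadyForce y v := by
  have h : v = v 0 • EuclideanSpace.single 0 1 + v 1 • EuclideanSpace.single 1 1 := by
    ext i
    fin_cases i <;> simp
  conv_rhs => rw [h]
  rw [map_add, map_smul, map_smul]
  ext i
  rw [op_apply, Fin.sum_univ_two]
  simp [cornering]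
  ring

theorem hasFDerivAt_reducedField (hR : D.SteadyRegular) (U X : Plane) :
    HasFDerivAt (D.reducedField U) (op (D.reducedMatrix (D.slip X U))) X := by
  have h1 : HasFDerivAt (fun X => D.slip X U) (op D.A₂) X :=
    (op D.A₂).hasFDerivAt.add_const _
  have h2 := (hR.2.1.differentiable one_ne_zero (D.slip X U)).hasFDerivAt
  have h3 := ((op D.A₁).hasFDerivAt.add ((op D.G₁).hasFDerivAt.comp X (h2.comp X h1))).add_const D.b
  refine h3.congr_fderiv ?_
  ext1 v
  have e : op (D.reducedMatrix (D.slip X U)) v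
      = op D.A₁ v + op (D.G₁ * D.cornering (D.slip X U) * D.A₂) v := by
    rw [reducedMatrix]
    simp only [op, map_add, add_apply]
  rw [e, op_mul_apply, op_mul_apply, op_cornering]
  rfl

/-- The vehicle dynamics is the reduced dynamics perturbed by the deviation of the bristles. -/
theorem odeField_eq_reducedField (U : Plane) (w : StateSpace) : D.odeField U w
    = D.reducedField U w.fst
      + op D.G₁ (D.forceOp (D.slip w.fst U) (w.snd - D.profileL2 (D.slip w.fst U))) := by
  rw [odeField_eq, reducedField, steadyForce_eq, map_sub, map_add, map_add, map_sub]
  abel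

theorem norm_forceOp_le (y : Plane) (ζ : L2) : ‖D.forceOp y ζ‖ ≤
    (‖kernelOp D.K₁ D.K₁_continuousOn‖ + ‖op (D.Sig y)‖ * ‖kernelOp D.K₂ D.K₂_continuousOn‖)
      * ‖ζ‖ := by
  refine ContinuousLinearMap.le_of_opNorm_le _ ?_ ζ
  exact (norm_add_le _ _).trans (add_le_add le_rfl (ContinuousLinearMap.opNorm_comp_le _ _))

end Model

end SingleTrack

namespace SingleTrack

/-! ### Decay of the Lyapunov function -/

namespace Model

variable {D : Model} {Q : ℝ → Mat}

theorem lyapunov_eq (hA : D.StrictlyDissipative Q) (P : Mat) (δ : StateSpace) :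
    lyapunov P Q δ = 1 / 2 * wsq (op P) δ.fst + wsq hA.weight δ.snd := by
  rw [lyapunov, integral_inner_op hA.1]
  rfl

theorem deviation_fst (Xs U : Plane) (w : StateSpace) :
    (D.deviation Xs U w).fst = w.fst - Xs := rfl

theorem deviation_snd (Xs U : Plane) (w : StateSpace) :
    (D.deviation Xs U w).snd = w.snd - D.profileL2 (D.slip w.fst U) := rfl

theorem lyapunov_le (hA : D.StrictlyDissipative Q) (P : Mat) (δ : StateSpace) :
    lyapunov P Q δ ≤ (‖op P‖ + ‖hA.weight‖ + 1) * ‖δ‖ ^ 2 := by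
  rw [lyapunov_eq hA, WithLp.prod_norm_sq_eq_of_L2]
  have h1 := wsq_le (op P) δ.fst
  have h2 := wsq_le hA.weight δ.snd
  nlinarith [sq_nonneg ‖δ.fst‖, sq_nonneg ‖δ.snd‖, norm_nonneg (op P), norm_nonneg hA.weight,
    mul_nonneg (norm_nonneg (op P)) (sq_nonneg ‖δ.fst‖),
    mul_nonneg (norm_nonneg (op P)) (sq_nonneg ‖δ.snd‖),
    mul_nonneg (norm_nonneg hA.weight) (sq_nonneg ‖δ.fst‖)]

theorem le_lyapunov (hA : D.StrictlyDissipative Q) {P : Mat} {cP c : ℝ} (hP : IsWeight (op P) cP)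
    (hQ : IsWeight hA.weight c) (δ : StateSpace) :
    min (cP / 2) c * ‖δ‖ ^ 2 ≤ lyapunov P Q δ := by
  rw [lyapunov_eq hA, WithLp.prod_norm_sq_eq_of_L2]
  have h1 := hP.coercive δ.fst
  have h2 := hQ.coercive δ.snd
  have h3 := mul_le_mul_of_nonneg_right (min_le_left (cP / 2) c) (sq_nonneg ‖δ.fst‖)
  have h4 := mul_le_mul_of_nonneg_right (min_le_right (cP / 2) c) (sq_nonneg ‖δ.snd‖)
  linarith

/-- The form that bounds the right derivative of the Lyapunov function along solutions with
velocity `v` of the vehicle state, with `L` a Lipschitz constant of the profile in the vehicle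
state. -/
noncomputable def lyapunovRate (hA : D.StrictlyDissipative Q) (P : Mat) (k L : ℝ) (Z v : Plane)
    (ζ F : L2) : ℝ :=
  inner ℝ v (op P Z) + (-(2 * k) * wsq hA.weight ζ + 2 * inner ℝ ζ (hA.weight F)
    + 2 * (‖hA.weight‖ * (‖ζ‖ * (L * ‖v‖))))

/-- Young's inequality. -/
theorem mul_le_young {q : ℝ} (hq : 0 < q) (a x z : ℝ) :
    a * (x * z) ≤ q / 4 * x ^ 2 + a ^ 2 / q * z ^ 2 := by
  have h1 : q / 4 * x ^ 2 + a ^ 2 / q * z ^ 2 - a * (x * z) = (q * x / 2 - a * z) ^ 2 / q := by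
    field_simp
    ring
  have h2 : 0 ≤ (q * x / 2 - a * z) ^ 2 / q := by positivity
  linarith

theorem le_one_add_of_sq_le {x t : ℝ} (h : x ^ 2 ≤ t) : x ≤ 1 + t := by
  nlinarith [sq_nonneg (x - 1)]

/-- The state is bounded by its vehicle part, the deviation of the bristles and the profile. -/
theorem norm_le_add_norm_sub (w : StateSpace) (p : L2) :
    ‖w‖ ≤ ‖w.fst‖ + (‖w.snd - p‖ + ‖p‖) := by
  have h1 : ‖w.snd‖ ≤ ‖w.snd - p‖ + ‖p‖ := norm_le_norm_sub_add _ _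
  refine (abs_le_of_sq_le_sq' ?_ (by positivity)).2
  rw [WithLp.prod_norm_sq_eq_of_L2]
  have h2 := pow_le_pow_left₀ (norm_nonneg w.snd) h1 2
  have h3 := mul_nonneg (norm_nonneg w.fst) ((norm_nonneg _).trans h1)
  linarith [add_sq ‖w.fst‖ (‖w.snd - p‖ + ‖p‖)]

set_option maxHeartbeats 800000 in
/-- On a small sublevel set of the Lyapunov function, which is bounded, the form that bounds its
derivative is at most `-s V` for all small `ε`: near the equilibrium the reduced vector field is its
linearization up to a small error, the vehicle dynamics is the reduced one up to `O(‖ζ‖)`, and for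
small `ε` the dissipation `(k / ε) ‖ζ‖²` of the bristles absorbs all the coupling terms. -/
theorem exists_lyapunovRate_le (hA : D.StrictlyDissipative Q)
    (hS : D.SourceDissipativeLipschitz Q) (hR : D.SteadyRegular) {Xs Us : Plane}
    (hE : D.IsEquilibrium Xs Us) {P : Mat}
    (hP : IsLyapunovMatrix (D.reducedMatrix (D.slip Xs Us)) P) {k L : ℝ} (hk : 0 < k)
    (hL : 0 ≤ L) :
    ∃ εs > 0, ∃ r > 0, ∃ s > 0, (∃ R, ∀ w : StateSpace,
        lyapunov P Q (D.deviation Xs Us w) < r → ‖w‖ ≤ R) ∧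
      ∀ ε, 0 < ε → ε < εs → ∀ w : StateSpace, lyapunov P Q (D.deviation Xs Us w) < r →
        lyapunovRate hA P (k / ε) L (w.fst - Xs) (D.odeField Us w)
          (w.snd - D.profileL2 (D.slip w.fst Us))
          (ε⁻¹ • D.sourceOp (D.slip w.fst Us) (w.snd - D.profileL2 (D.slip w.fst Us)))
          ≤ -s * lyapunov P Q (D.deviation Xs Us w) := by
  obtain ⟨c, hQ⟩ := hA.exists_isWeight
  obtain ⟨cP, hPw⟩ := isWeight_op hP.1
  obtain ⟨hPd, q, hq, hPq⟩ := hP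
  have hc := hQ.pos
  have hcP := hPw.pos
  set A := op (D.reducedMatrix (D.slip Xs Us)) with hAdef
  set p := ‖op P‖ with hp
  have hp0 : 0 ≤ p := norm_nonneg _
  -- the admissible relative error of the linearization: it costs half of the decay `q ‖Z‖²`
  set η := q / (2 * (p + 1)) with hη
  have hη0 : 0 < η := by positivity
  have hpη : p * η ≤ q / 2 := by
    rw [hη, ← mul_div_assoc, div_le_div_iff₀ (by positivity) two_pos]
    nlinarith
  have hg0 : D.reducedField Us Xs = 0 := hE
  obtain ⟨δ, hδ, hlin⟩ : ∃ δ > 0, ∀ X, ‖X - Xs‖ < δ →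
      ‖D.reducedField Us X - A (X - Xs)‖ ≤ η * ‖X - Xs‖ := by
    have h := (hasFDerivAt_reducedField hR Us Xs).isLittleO.def hη0
    obtain ⟨δ, hδ, h⟩ := Metric.eventually_nhds_iff.1 h
    refine ⟨δ, hδ, fun X hX => ?_⟩
    have := h (y := X) (by rwa [dist_eq_norm])
    rwa [hg0, sub_zero] at this
  have hslip : LipOnBounded fun X : Plane => D.slip X Us :=
    (LipOnBounded.clm (op D.A₂)).add (LipOnBounded.const _)
  obtain ⟨S₀, hS₀, hSig⟩ := ((lipOnBounded_sig hS).comp hslip).exists_bound (‖Xs‖ + δ)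
  obtain ⟨B, hB, hprof⟩ := ((lipOnBounded_profileL2 hR).comp hslip).exists_bound (‖Xs‖ + δ)
  -- `C` bounds the influence of the bristles on the vehicle, and `‖X'‖ ≤ Cg ‖Z‖ + C ‖ζ‖`
  set C := ‖op D.G₁‖ * (‖kernelOp D.K₁ D.K₁_continuousOn‖
    + S₀ * ‖kernelOp D.K₂ D.K₂_continuousOn‖) with hC
  have hC0 : 0 ≤ C := by positivity
  set Cg := ‖A‖ + η with hCg
  have hCg0 : 0 ≤ Cg := by positivity
  set n := ‖hA.weight‖ with hn
  have hn0 : 0 ≤ n := norm_nonneg _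
  -- `a` and `b` are the coefficients of the coupling terms `‖Z‖ ‖ζ‖` and `‖ζ‖²`; a dissipation
  -- `K ‖ζ‖²` of the bristles suffices after Young's inequality for the mixed term
  set a := p * C + 2 * n * L * Cg with ha
  set b := 2 * n * L * C with hb
  have ha0 : 0 ≤ a := by positivity
  have hb0 : 0 ≤ b := by positivity
  set K := b + a ^ 2 / q + q / 4 with hK
  have hK0 : 0 < K := by positivity
  set Cv := p + n + 1 with hCv
  have hCv0 : 0 < Cv := by positivity
  -- a small sublevel set of the Lyapunov function is contained in the ball of linearization
  have hX : ∀ w : StateSpace, lyapunov P Q (D.deviation Xs Us w) < cP / 2 * δ ^ 2 →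
      ‖w.fst - Xs‖ < δ ∧
        c * ‖w.snd - D.profileL2 (D.slip w.fst Us)‖ ^ 2 < cP / 2 * δ ^ 2 := by
    intro w hw
    rw [lyapunov_eq hA, deviation_fst, deviation_snd] at hw
    have h1 := hPw.coercive (w.fst - Xs)
    have h2 := hQ.coercive (w.snd - D.profileL2 (D.slip w.fst Us))
    have h3 := hPw.wsq_nonneg (w.fst - Xs)
    have h4 := hQ.wsq_nonneg (w.snd - D.profileL2 (D.slip w.fst Us))
    refine ⟨?_, by linarith⟩
    have h5 : cP / 2 * ‖w.fst - Xs‖ ^ 2 < cP / 2 * δ ^ 2 := by linarith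
    exact lt_of_pow_lt_pow_left₀ 2 hδ.le (lt_of_mul_lt_mul_left h5 (by positivity))
  have hXn : ∀ w : StateSpace, ‖w.fst - Xs‖ < δ → ‖w.fst‖ ≤ ‖Xs‖ + δ := fun w hw => by
    have := norm_sub_norm_le w.fst Xs
    linarith
  refine ⟨2 * k * c / K, by positivity, cP / 2 * δ ^ 2, by positivity, q / (4 * Cv),
    by positivity, ⟨‖Xs‖ + δ + (1 + cP / 2 * δ ^ 2 / c + B), fun w hw => ?_⟩,
    fun ε hε hεs w hw => ?_⟩
  · obtain ⟨h1, h2⟩ := hX w hw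
    have h3 := hXn w h1
    have h4 := hprof w.fst h3
    have h5 : ‖w.snd - D.profileL2 (D.slip w.fst Us)‖ ≤ 1 + cP / 2 * δ ^ 2 / c := by
      have h6 : ‖w.snd - D.profileL2 (D.slip w.fst Us)‖ ^ 2 ≤ cP / 2 * δ ^ 2 / c := by
        rw [le_div_iff₀ hc]; linarith
      exact le_one_add_of_sq_le h6
    have h7 := norm_le_add_norm_sub w (D.profileL2 (D.slip w.fst Us))
    linarith
  · -- `ε < 2 k c / K` is equivalent to `K < 2 k c / ε`
    obtain ⟨h1, -⟩ := hX w hw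
    have h3 := hXn w h1
    set Z := w.fst - Xs with hZ
    set y := D.slip w.fst Us with hy
    set ζ := w.snd - D.profileL2 y with hζ
    set v := D.odeField Us w with hv
    set x := ‖Z‖ with hx
    set z := ‖ζ‖ with hz
    have hx0 : 0 ≤ x := norm_nonneg _
    have hz0 : 0 ≤ z := norm_nonneg _
    set e := op D.G₁ (D.forceOp y ζ) with he
    have hve : v = D.reducedField Us w.fst + e := odeField_eq_reducedField Us w
    have hen : ‖e‖ ≤ C * z := by
      refine ((op D.G₁).le_opNorm _).trans ?_
      rw [hC, mul_assoc]
      gcongr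
      refine (norm_forceOp_le y ζ).trans ?_
      gcongr
      exact hSig w.fst h3
    have hgn := hlin w.fst h1
    rw [← hZ, ← hx] at hgn
    have hAZ : ‖A Z‖ ≤ ‖A‖ * x := A.le_opNorm Z
    have hvn : ‖v‖ ≤ Cg * x + C * z := by
      have h4 : v = (D.reducedField Us w.fst - A Z) + A Z + e := by rw [hve]; abel
      rw [h4, hCg]
      have h5 := norm_add_le ((D.reducedField Us w.fst - A Z) + A Z) e
      have h6 := norm_add_le (D.reducedField Us w.fst - A Z) (A Z)
      linarith
    have hI : inner ℝ v (op P Z) ≤ -(q / 2) * x ^ 2 + p * C * (x * z) := by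
      have h4 : v = A Z + (D.reducedField Us w.fst - A Z) + e := by rw [hve]; abel
      rw [h4, inner_add_left, inner_add_left, IsLyapunovMatrix.inner_eq hPd hPq]
      have h5 := inner_weight_le (op P) (D.reducedField Us w.fst - A Z) Z
      have h6 := inner_weight_le (op P) e Z
      have h7 : p * (‖D.reducedField Us w.fst - A Z‖ * x) ≤ q / 2 * x ^ 2 := by
        calc p * (‖D.reducedField Us w.fst - A Z‖ * x) ≤ p * (η * x * x) := by gcongr
          _ = p * η * x ^ 2 := by ring
          _ ≤ q / 2 * x ^ 2 := by gcongr
      have h8 : p * (‖e‖ * x) ≤ p * C * (x * z) := by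
        calc p * (‖e‖ * x) ≤ p * (C * z * x) := by gcongr
          _ = _ := by ring
      linarith
    have hII : -(2 * (k / ε)) * wsq hA.weight ζ ≤ -K * z ^ 2 := by
      have h4 := hQ.coercive ζ
      have h5 : K ≤ 2 * k * c / ε := by
        rw [lt_div_iff₀ hK0] at hεs
        rw [le_div_iff₀ hε]
        linarith
      have h6 : 2 * (k / ε) * (c * z ^ 2) ≤ 2 * (k / ε) * wsq hA.weight ζ := by gcongr
      have h7 : 2 * (k / ε) * (c * z ^ 2) = 2 * k * c / ε * z ^ 2 := by ring
      have h8 := mul_le_mul_of_nonneg_right h5 (sq_nonneg z)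
      linarith
    have hIII : inner ℝ ζ (hA.weight (ε⁻¹ • D.sourceOp y ζ)) ≤ 0 := by
      rw [map_smul, inner_smul_right, hQ.symm]
      exact mul_nonpos_of_nonneg_of_nonpos (by positivity) (inner_sourceOp_le hA hS y ζ)
    have hIV : 2 * (n * (z * (L * ‖v‖))) ≤ 2 * n * L * Cg * (x * z) + b * z ^ 2 := by
      calc 2 * (n * (z * (L * ‖v‖))) ≤ 2 * (n * (z * (L * (Cg * x + C * z)))) := by gcongr
        _ = _ := by rw [hb]; ring
    have hV := lyapunov_le hA P (D.deviation Xs Us w)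
    rw [WithLp.prod_norm_sq_eq_of_L2, deviation_fst, deviation_snd] at hV
    have hyoung := mul_le_young hq a x z
    have hfin : -(q / (4 * Cv)) * lyapunov P Q (D.deviation Xs Us w)
        ≥ -(q / 4) * (x ^ 2 + z ^ 2) := by
      have h4 := mul_le_mul_of_nonneg_left hV (by positivity : 0 ≤ q / (4 * Cv))
      have h5 : q / (4 * Cv) * (Cv * (x ^ 2 + z ^ 2)) = q / 4 * (x ^ 2 + z ^ 2) := by
        field_simp
      linarith
    have haxz : p * C * (x * z) + 2 * n * L * Cg * (x * z) = a * (x * z) := by rw [ha]; ring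
    have hKz : K * z ^ 2 = b * z ^ 2 + a ^ 2 / q * z ^ 2 + q / 4 * z ^ 2 := by rw [hK]; ring
    unfold lyapunovRate
    linarith

/-- The Lyapunov function decays exponentially along continuous curves `w` that satisfy the
equations with a nonlinearity that is modified only outside of the sublevel set `V < r`. The
comparison function `B e^{-σ t}` with `V(w(0)) < B < r` cannot be crossed from below. -/
theorem lyapunov_decay (hA : D.StrictlyDissipative Q)
    (hS : D.SourceDissipativeLipschitz Q) {Xs Us : Plane} {P : Mat} (hP : P.PosDef) {κ : ℝ}
    (hG : IsMaxDissipative hA.weight κ D.transportSubmodule) {M : ℝ}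
    (hM : 0 ≤ M) (hprof : ∀ y₁ y₂, ‖D.profileL2 y₁ - D.profileL2 y₂‖ ≤ M * ‖y₁ - y₂‖)
    {T : ℝ → L2 →L[ℝ] L2} (hT : IsSemigroupOf T D.transportSubmodule) {ε r s : ℝ} (hε : 0 < ε)
    (hs : 0 < s)
    (hrate : ∀ w : StateSpace, lyapunov P Q (D.deviation Xs Us w) < r →
      lyapunovRate hA P (decayRate hA.weight κ / ε) (M * ‖op D.A₂‖) (w.fst - Xs)
          (D.odeField Us w) (w.snd - D.profileL2 (D.slip w.fst Us))
          (ε⁻¹ • D.sourceOp (D.slip w.fst Us) (w.snd - D.profileL2 (D.slip w.fst Us)))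
          ≤ -s * lyapunov P Q (D.deviation Xs Us w))
    {w : ℝ → StateSpace} (hw : Continuous w) {F : ℝ → StateSpace} (hF : Continuous F)
    (hFw : ∀ t, lyapunov P Q (D.deviation Xs Us (w t)) < r → F t = D.field ε Us (w t))
    (hfst : ∀ t, 0 ≤ t → (w t).fst = (w 0).fst + ∫ τ in (0 : ℝ)..t, (F τ).fst)
    (hsnd : ∀ t, 0 ≤ t → (w t).snd = T (t / ε) (w 0).snd
      + ∫ τ in (0 : ℝ)..t, T (max (t - τ) 0 / ε) (F τ).snd)
    (h0 : lyapunov P Q (D.deviation Xs Us (w 0)) < r) {t : ℝ} (ht : 0 ≤ t) :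
    lyapunov P Q (D.deviation Xs Us (w t))
      ≤ lyapunov P Q (D.deviation Xs Us (w 0)) * Real.exp (-(s / 2) * t) := by
  obtain ⟨c, hQ⟩ := hA.exists_isWeight
  obtain ⟨cP, hPw⟩ := isWeight_op hP
  set V : ℝ → ℝ := fun t => lyapunov P Q (D.deviation Xs Us (w t)) with hV
  set X : ℝ → Plane := fun t => (w t).fst with hX
  set p : ℝ → L2 := fun t => D.profileL2 (D.slip (X t) Us) with hp
  set ζ : ℝ → L2 := fun t => (w t).snd - p t with hζ
  have hfstc : Continuous fun u : StateSpace => u.fst := (WithLp.fstL 2 ℝ Plane L2).continuous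
  have hsndc : Continuous fun u : StateSpace => u.snd := (WithLp.sndL 2 ℝ Plane L2).continuous
  have hXc : Continuous X := hfstc.comp hw
  have hslip : Continuous fun X : Plane => D.slip X Us := by
    unfold slip
    fun_prop
  have hprofc : Continuous D.profileL2 := (LipOnBounded.of_lipschitz hM hprof).continuous
  have hpc : Continuous p := hprofc.comp (hslip.comp hXc)
  have hζc : Continuous ζ := (hsndc.comp hw).sub hpc
  have hVe : ∀ t, V t = 1 / 2 * wsq (op P) (X t - Xs) + wsq hA.weight (ζ t) := fun t =>
    lyapunov_eq hA P _
  have hVc : Continuous V := by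
    have h1 : V = fun t => 1 / 2 * wsq (op P) (X t - Xs) + wsq hA.weight (ζ t) := funext hVe
    rw [h1]
    exact (((continuous_wsq (op P)).comp (hXc.sub continuous_const)).const_mul _).add
      ((continuous_wsq _).comp hζc)
  have hFfc : Continuous fun τ => (F τ).fst := hfstc.comp hF
  have hXd : ∀ t, 0 ≤ t → HasDerivWithinAt X (F t).fst (Ici t) t := by
    intro t ht
    have h1 : HasDerivAt (fun t => (w 0).fst + ∫ τ in (0 : ℝ)..t, (F τ).fst) (F t).fst t :=
      (intervalIntegral.integral_hasDerivAt_right (hFfc.intervalIntegrable _ _)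
        (hFfc.stronglyMeasurableAtFilter _ _) hFfc.continuousAt).const_add _
    exact h1.hasDerivWithinAt.congr (fun τ hτ => hfst τ (ht.trans hτ)) (hfst t ht)
  -- `a t` is the value of `ε⁻¹ 𝒜` at the current profile
  have hGε := hG.scaled hε
  have hTε := hT.scaled hε
  set a : ℝ → L2 := fun t => ε⁻¹ • -(D.sourceOp (D.slip (X t) Us) (p t)
    + constOp (D.h₂ (D.slip (X t) Us))) with ha
  have hmem : ∀ t, (p t, a t) ∈ scaledGraph ε D.transportSubmodule := by
    intro t
    rw [mem_scaledGraph]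
    simp only [ha]
    rw [smul_inv_smul₀ hε.ne']
    exact profile_mem_graph hA hS _
  have hkε : decayRate hA.weight (κ / ε) = decayRate hA.weight κ / ε := by
    unfold decayRate
    ring
  set V' : ℝ → ℝ := fun t => lyapunovRate hA P (decayRate hA.weight κ / ε) (M * ‖op D.A₂‖)
    (X t - Xs) (F t).fst (ζ t) ((F t).snd + a t) with hV'
  have hdini : ∀ t, 0 ≤ t → ∀ ρ, V' t < ρ → ∃ᶠ τ in 𝓝[>] t, slope V t τ < ρ := by
    intro t ht ρ hρ
    have hshift : Tendsto (fun τ : ℝ => τ - t) (𝓝[>] t) (𝓝[>] 0) := by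
      rw [tendsto_nhdsWithin_iff]
      refine ⟨?_, ?_⟩
      · have : Tendsto (fun τ : ℝ => τ - t) (𝓝 t) (𝓝 (t - t)) := (continuous_sub_right t).tendsto t
        rw [sub_self] at this
        exact this.mono_left nhdsWithin_le_nhds
      · filter_upwards [self_mem_nhdsWithin] with τ hτ
        exact mem_Ioi.2 (sub_pos.2 (mem_Ioi.1 hτ))
    have hshift' : Tendsto (fun h : ℝ => t + h) (𝓝[>] 0) (𝓝[>] t) := by
      rw [tendsto_nhdsWithin_iff]
      refine ⟨?_, ?_⟩
      · have : Tendsto (fun h : ℝ => t + h) (𝓝 0) (𝓝 (t + 0)) := (continuous_const_add t).tendsto 0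
        rw [add_zero] at this
        exact this.mono_left nhdsWithin_le_nhds
      · filter_upwards [self_mem_nhdsWithin] with τ hτ
        exact mem_Ioi.2 (by linarith [mem_Ioi.1 hτ])
    have hXs := (hasDerivWithinAt_iff_tendsto_slope' (by simp)).1
      (hasDerivWithinAt_Ioi_iff_Ici.2 (hXd t ht))
    -- the speed of the profile is at most `M ‖A₂‖` times the speed of the vehicle state
    obtain ⟨ψ, hψ, hψle⟩ := IsMild.exists_dini_bound hGε hQ hTε (f := fun τ => (F τ).snd)
      (u := fun τ => (w τ).snd) (p := p) (hsndc.comp hF) hsnd ht (hmem t)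
      (m := fun h => M * ‖op D.A₂‖ * ‖slope X t (t + h)‖) (m₀ := M * ‖op D.A₂‖ * ‖(F t).fst‖)
      ((hXs.comp hshift').norm.const_mul _) (fun h hh => by
        have h1 := hprof (D.slip (X (t + h)) Us) (D.slip (X t) Us)
        have h2 : D.slip (X (t + h)) Us - D.slip (X t) Us = op D.A₂ (X (t + h) - X t) := by
          rw [slip, slip, map_sub]; abel
        rw [h2] at h1
        have h3 : ‖slope X t (t + h)‖ = h⁻¹ * ‖X (t + h) - X t‖ := by
          rw [slope_def_module, norm_smul, add_sub_cancel_left, norm_inv,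
            Real.norm_of_nonneg hh.le]
        simp only [h3]
        refine h1.trans ?_
        have h4 := (op D.A₂).le_opNorm (X (t + h) - X t)
        have h5 : h * (M * ‖op D.A₂‖ * (h⁻¹ * ‖X (t + h) - X t‖))
            = M * (‖op D.A₂‖ * ‖X (t + h) - X t‖) := by field_simp
        rw [h5]
        gcongr)
    rw [hkε] at hψ
    have hd1 : HasDerivWithinAt (fun t => 1 / 2 * wsq (op P) (X t - Xs))
        (inner ℝ (F t).fst (op P (X t - Xs))) (Ici t) t := by
      have h1 := (hXd t ht).sub_const Xs
      have h2 := (h1.inner ℝ ((op P).hasFDerivAt.comp_hasDerivWithinAt t h1)).const_mul (1 / 2)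
      refine h2.congr_deriv ?_
      rw [hPw.symm (X t - Xs), Function.comp_apply]
      ring
    have hs1 := (hasDerivWithinAt_iff_tendsto_slope' (by simp)).1
      (hasDerivWithinAt_Ioi_iff_Ici.2 hd1)
    have hlim := hs1.add (hψ.comp hshift)
    refine Eventually.frequently ?_
    filter_upwards [hlim.eventually_lt_const hρ, self_mem_nhdsWithin] with τ hτ hτt
    refine lt_of_le_of_lt ?_ hτ
    have hpos : 0 < τ - t := sub_pos.2 hτt
    have h1 := hψle (τ - t) hpos
    rw [add_sub_cancel] at h1
    rw [slope_def_field, slope_def_field, hVe, hVe, Function.comp_apply, ← sub_le_iff_le_add',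
      ← sub_div, div_le_iff₀ hpos]
    simp only [hζ]
    linarith
  have key : ∀ B, V 0 < B → B < r → V t ≤ B * Real.exp (-(s / 2) * t) := by
    intro B hB hBr
    have hV0 : 0 ≤ V 0 := by
      rw [hVe]
      have := hPw.wsq_nonneg (X 0 - Xs)
      have := hQ.wsq_nonneg (ζ 0)
      positivity
    have hB0 : 0 < B := hV0.trans_lt hB
    refine image_le_of_liminf_slope_right_lt_deriv_boundary (a := 0) (b := t) (f' := V')
      (B := fun t => B * Real.exp (-(s / 2) * t))
      (B' := fun t => B * (Real.exp (-(s / 2) * t) * -(s / 2)))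
      hVc.continuousOn (fun τ hτ => hdini τ hτ.1) (by simpa using hB.le) (fun τ => ?_)
      (fun τ hτ hτV => ?_) ⟨ht, le_rfl⟩
    · have : HasDerivAt (fun t : ℝ => -(s / 2) * t) (-(s / 2)) τ := by
        simpa using (hasDerivAt_id τ).const_mul (-(s / 2))
      exact this.exp.const_mul B
    · have h1 : V τ < r := by
        rw [hτV]
        refine lt_of_le_of_lt ?_ hBr
        have : Real.exp (-(s / 2) * τ) ≤ 1 := by
          rw [Real.exp_le_one_iff]
          have := mul_nonneg hs.le hτ.1
          linarith
        nlinarith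
      have h2 := hrate (w τ) h1
      have h3 := hFw τ h1
      have e1 : (F τ).fst = D.odeField Us (w τ) := by rw [h3]; rfl
      have e2 : (F τ).snd + a τ = ε⁻¹ • D.sourceOp (D.slip (X τ) Us) (ζ τ) := by
        have : (F τ).snd = ε⁻¹ • D.source Us (w τ) := by rw [h3]; rfl
        rw [this, source_eq]
        simp only [ha, hζ]
        rw [← smul_add, map_sub]
        congr 1
        abel
      have h4 : V' τ ≤ -s * V τ := by
        simp only [hV']
        rw [e1, e2]
        exact h2
      have h5 : 0 < V τ := by rw [hτV]; positivity
      have h6 : B * (Real.exp (-(s / 2) * τ) * -(s / 2)) = -(s / 2) * V τ := by rw [hτV]; ring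
      rw [h6]
      nlinarith
  have hlim : Tendsto (fun B => B * Real.exp (-(s / 2) * t)) (𝓝[>] (V 0))
      (𝓝 (V 0 * Real.exp (-(s / 2) * t))) := by
    have : Continuous fun B => B * Real.exp (-(s / 2) * t) := by fun_prop
    exact (this.tendsto _).mono_left nhdsWithin_le_nhds
  refine ge_of_tendsto hlim ?_
  filter_upwards [Ioo_mem_nhdsGT h0] with B hB
  exact key B hB.1 hB.2

/-! ### Mild solutions of the model -/

/-- The mild formulation, as a variation of constants equation in the product space. -/
theorem mild_iff (hA : D.StrictlyDissipative Q) (hS : D.SourceDissipativeLipschitz Q)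
    (hR : D.SteadyRegular) {T : ℝ → L2 →L[ℝ] L2} (hT : D.Generates T) {ε : ℝ} (hε : 0 < ε)
    (U : Plane) (w₀ : StateSpace) {w : ℝ → StateSpace} (hw : Continuous w) {t : ℝ} (ht : 0 ≤ t) :
    w t = prodFlow Plane (fun t => T (t / ε)) t w₀
        + ∫ s in (0 : ℝ)..t, prodFlow Plane (fun t => T (t / ε)) (t - s) (D.field ε U (w s)) ↔
      (w t).fst = w₀.fst + ∫ s in (0 : ℝ)..t, D.odeField U (w s) ∧
      (w t).snd = T (t / ε) w₀.snd
        + ε⁻¹ • ∫ s in (0 : ℝ)..t, T ((t - s) / ε) (D.source U (w s)) := by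
  obtain ⟨c, hQ⟩ := hA.exists_isWeight
  obtain ⟨κ, hG⟩ := hA.isMaxDissipative
  have h := prodFlow_eq_iff (F := Plane) (hG.scaled hε) hQ ((generates_iff.1 hT).scaled hε)
    (f := fun s => D.field ε U (w s))
    ((lipOnBounded_field hA hS hR ε U).continuous.comp hw) (w t) w₀ ht
  rw [h]
  have e : ∫ s in (0 : ℝ)..t, T (max (t - s) 0 / ε) (D.field ε U (w s)).snd
      = ε⁻¹ • ∫ s in (0 : ℝ)..t, T ((t - s) / ε) (D.source U (w s)) := by
    rw [← intervalIntegral.integral_smul]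
    refine intervalIntegral.integral_congr fun s hs => ?_
    rw [uIcc_of_le ht] at hs
    simp only [field]
    rw [max_eq_left (by linarith [hs.2]), ← map_smul]
    rfl
  rw [e]
  rfl

/-- Mild solutions are unique. Both are extended to negative times by their initial values, and
their semigroups agree because they have the same generator. -/
theorem eqOn_of_isMildSolution (hA : D.StrictlyDissipative Q)
    (hS : D.SourceDissipativeLipschitz Q) (hR : D.SteadyRegular) {ε : ℝ} (hε : 0 < ε) {U : Plane}
    {w₀ : StateSpace} {v w : ℝ → StateSpace} (hv : D.IsMildSolution ε U w₀ v)
    (hw : D.IsMildSolution ε U w₀ w) : EqOn v w (Ici 0) := by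
  obtain ⟨c, hQ⟩ := hA.exists_isWeight
  obtain ⟨κ, hG⟩ := hA.isMaxDissipative
  obtain ⟨hvc, T, hT, hvT⟩ := hv
  obtain ⟨hwc, T', hT', hwT⟩ := hw
  have hTT : ∀ t, 0 ≤ t → T t = T' t := fun t ht =>
    IsSemigroupOf.unique hG hQ (generates_iff.1 hT) (generates_iff.1 hT') ht
  have hTε := (generates_iff.1 hT).scaled hε
  have hmax : Continuous fun t : ℝ => max t 0 := by fun_prop
  have hext : ∀ {u : ℝ → StateSpace}, ContinuousOn u (Ici 0) → Continuous fun t => u (max t 0) :=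
    fun h => h.comp_continuous hmax fun t => mem_Ici.2 (le_max_right _ _)
  have hcongr : ∀ {u : ℝ → StateSpace} {t : ℝ}, 0 ≤ t →
      ((u t).fst = w₀.fst + ∫ s in (0 : ℝ)..t, D.odeField U (u s)) →
      ((u t).snd = T (t / ε) w₀.snd
        + ε⁻¹ • ∫ s in (0 : ℝ)..t, T ((t - s) / ε) (D.source U (u s))) →
      (u (max t 0)).fst = w₀.fst + ∫ s in (0 : ℝ)..t, D.odeField U (u (max s 0)) ∧
      (u (max t 0)).snd = T (t / ε) w₀.snd
        + ε⁻¹ • ∫ s in (0 : ℝ)..t, T ((t - s) / ε) (D.source U (u (max s 0))) := by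
    intro u t ht h1 h2
    rw [max_eq_left ht, h1, h2]
    refine ⟨?_, ?_⟩
    · congr 1
      refine intervalIntegral.integral_congr fun s hs => ?_
      rw [uIcc_of_le ht] at hs
      simp only [max_eq_left hs.1]
    · congr 2
      refine intervalIntegral.integral_congr fun s hs => ?_
      rw [uIcc_of_le ht] at hs
      simp only [max_eq_left hs.1]
  intro t ht
  have h := eqOn_of_mild (S := prodFlow Plane fun t => T (t / ε)) (M := weightBound hA.weight c)
    (fun t => norm_prodFlow_le (hG.scaled hε) hQ hTε t)
    (fun x => continuous_prodFlow (hG.scaled hε) hQ hTε x)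
    (lipOnBounded_field hA hS hR ε U) (w₀ := w₀) (hext hvc) (hext hwc)
    (fun t ht => (mild_iff hA hS hR hT hε U w₀ (hext hvc) ht).2
      (hcongr ht (hvT t ht).1 (hvT t ht).2))
    (fun t ht => (mild_iff hA hS hR hT hε U w₀ (hext hwc) ht).2
      (hcongr ht (hwT t ht).1 (by
        rw [(hwT t ht).2, hTT _ (by positivity)]
        congr 2
        refine intervalIntegral.integral_congr fun s hs => ?_
        rw [uIcc_of_le ht] at hs
        have : 0 ≤ (t - s) / ε := div_nonneg (by linarith [hs.2]) hε.le
        simp only [hTT _ this]))) (τ := t) ht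
  simpa [max_eq_left (mem_Ici.1 ht)] using h

end Model

end SingleTrack

namespace SingleTrack

namespace Model

variable {D : Model} {Q : ℝ → Mat}

/-- A solution of the equation whose nonlinearity is cut off outside of the ball of radius `R`
never leaves the sublevel set `V < r`, on which the cutoff is inactive, and therefore solves the
original equation. -/
theorem exists_isMildSolution (hA : D.StrictlyDissipative Q)
    (hS : D.SourceDissipativeLipschitz Q) (hR : D.SteadyRegular) {Xs Us : Plane} {P : Mat}
    (hP : P.PosDef) {κ M : ℝ} (hG : IsMaxDissipative hA.weight κ D.transportSubmodule)
    (hM : 0 ≤ M) (hprof : ∀ y₁ y₂, ‖D.profileL2 y₁ - D.profileL2 y₂‖ ≤ M * ‖y₁ - y₂‖)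
    {ε r s R : ℝ} (hε : 0 < ε) (hs : 0 < s)
    (hbdd : ∀ w : StateSpace, lyapunov P Q (D.deviation Xs Us w) < r → ‖w‖ ≤ R)
    (hrate : ∀ w : StateSpace, lyapunov P Q (D.deviation Xs Us w) < r →
      lyapunovRate hA P (decayRate hA.weight κ / ε) (M * ‖op D.A₂‖) (w.fst - Xs)
          (D.odeField Us w) (w.snd - D.profileL2 (D.slip w.fst Us))
          (ε⁻¹ • D.sourceOp (D.slip w.fst Us) (w.snd - D.profileL2 (D.slip w.fst Us)))
          ≤ -s * lyapunov P Q (D.deviation Xs Us w))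
    {w₀ : StateSpace} (h0 : lyapunov P Q (D.deviation Xs Us w₀) < r) :
    ∃ w : ℝ → StateSpace, D.IsMildSolution ε Us w₀ w ∧ ∀ t, 0 ≤ t →
      lyapunov P Q (D.deviation Xs Us (w t))
        ≤ lyapunov P Q (D.deviation Xs Us w₀) * Real.exp (-(s / 2) * t) := by
  obtain ⟨c, hQ⟩ := hA.exists_isWeight
  obtain ⟨cP, hPw⟩ := isWeight_op hP
  obtain ⟨T, hT⟩ := hG.exists_semigroup hQ
  have hTε := hT.scaled hε
  have hfield := lipOnBounded_field hA hS hR ε Us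
  obtain ⟨L, hL, hlip⟩ := hfield.exists_lipschitz_cutoff R
  have hFc : Continuous fun u => cutoff R ‖u‖ • D.field ε Us u :=
    (LipOnBounded.of_lipschitz hL hlip).continuous
  obtain ⟨w, hw, hmild⟩ := exists_mild_of_lipschitz
    (S := prodFlow Plane fun t => T (t / ε)) (M := weightBound hA.weight c)
    (fun t => norm_prodFlow_le (hG.scaled hε) hQ hTε t)
    (fun x => continuous_prodFlow (hG.scaled hε) hQ hTε x) hL hlip w₀
  have hcomp : ∀ t, 0 ≤ t → (w t).fst = w₀.fst
        + ∫ s in (0 : ℝ)..t, (cutoff R ‖w s‖ • D.field ε Us (w s)).fst ∧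
      (w t).snd = T (t / ε) w₀.snd
        + ∫ s in (0 : ℝ)..t, T (max (t - s) 0 / ε) (cutoff R ‖w s‖ • D.field ε Us (w s)).snd :=
    fun t ht => (prodFlow_eq_iff (F := Plane) (hG.scaled hε) hQ hTε
      (f := fun s => cutoff R ‖w s‖ • D.field ε Us (w s)) (hFc.comp hw) (w t) w₀ ht).1 (hmild t ht)
  have hw0 : w 0 = w₀ := by
    have h := hmild 0 le_rfl
    rw [intervalIntegral.integral_same, add_zero, prodFlow_apply, max_self, zero_div, hT.zero] at h
    exact h
  have hcut : ∀ t, lyapunov P Q (D.deviation Xs Us (w t)) < r →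
      cutoff R ‖w t‖ • D.field ε Us (w t) = D.field ε Us (w t) := fun t ht => by
    rw [cutoff_eq_one (hbdd _ ht), one_smul]
  have hdecay : ∀ t, 0 ≤ t → lyapunov P Q (D.deviation Xs Us (w t))
      ≤ lyapunov P Q (D.deviation Xs Us w₀) * Real.exp (-(s / 2) * t) := by
    intro t ht
    have h := lyapunov_decay hA hS hP hG hM hprof hT hε hs hrate hw
      (F := fun s => cutoff R ‖w s‖ • D.field ε Us (w s)) (hFc.comp hw) hcut
      (fun t ht => by rw [hw0]; exact (hcomp t ht).1)
      (fun t ht => by rw [hw0]; exact (hcomp t ht).2) (by rwa [hw0]) ht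
    rwa [hw0] at h
  refine ⟨w, ⟨hw.continuousOn, T, generates_iff.2 hT, fun t ht => ?_⟩, hdecay⟩
  refine (mild_iff hA hS hR (generates_iff.2 hT) hε Us w₀ hw ht).1 ((hmild t ht).trans ?_)
  congr 1
  refine intervalIntegral.integral_congr fun τ hτ => ?_
  rw [uIcc_of_le ht] at hτ
  have hexp : Real.exp (-(s / 2) * τ) ≤ 1 := by
    rw [Real.exp_le_one_iff]
    nlinarith [hτ.1]
  have hV0 : 0 ≤ lyapunov P Q (D.deviation Xs Us w₀) := by
    rw [lyapunov_eq hA]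
    have := hPw.wsq_nonneg (D.deviation Xs Us w₀).fst
    have := hQ.wsq_nonneg (D.deviation Xs Us w₀).snd
    positivity
  have hr : lyapunov P Q (D.deviation Xs Us (w τ)) < r :=
    ((hdecay τ hτ.1).trans (mul_le_of_le_one_right hV0 hexp)).trans_lt h0
  simp only [hcut τ hr]

/-- Exponential decay of the Lyapunov function gives exponential decay of the norm, at half the
rate. -/
theorem norm_le_of_lyapunov_le (hA : D.StrictlyDissipative Q) {P : Mat} {cP c : ℝ}
    (hP : IsWeight (op P) cP) (hQ : IsWeight hA.weight c) {δ δ₀ : StateSpace} {s t : ℝ}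
    (h : lyapunov P Q δ ≤ lyapunov P Q δ₀ * Real.exp (-(s / 2) * t)) :
    ‖δ‖ ≤ Real.sqrt ((‖op P‖ + ‖hA.weight‖ + 1) / min (cP / 2) c)
      * Real.exp (-(s / 4) * t) * ‖δ₀‖ := by
  have hm : 0 < min (cP / 2) c := lt_min (half_pos hP.pos) hQ.pos
  refine (abs_le_of_sq_le_sq' ?_ (by positivity)).2
  have he : Real.exp (-(s / 4) * t) ^ 2 = Real.exp (-(s / 2) * t) := by
    rw [← Real.exp_nat_mul]
    congr 1
    push_cast
    ring
  rw [mul_pow, mul_pow, Real.sq_sqrt (by positivity), he, div_mul_eq_mul_div, div_mul_eq_mul_div,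
    le_div_iff₀ hm]
  have h1 := le_lyapunov hA hP hQ δ
  have h2 := mul_le_mul_of_nonneg_right (lyapunov_le hA P δ₀) (Real.exp_pos (-(s / 2) * t)).le
  linarith

end Model

end SingleTrack

/-! ### Exponential stability of equilibria -/

theorem mainTheorem1 (D : Model) (Q : ℝ → Mat)
    (hA : D.StrictlyDissipative Q)
    (hS : D.SourceDissipativeLipschitz Q)
    (hR : D.SteadyRegular)
    (Xs Us : Plane) (hE : D.IsEquilibrium Xs Us)
    (hH : IsHurwitz (D.reducedMatrix (D.slip Xs Us))) :
    (∃ P : Mat, IsLyapunovMatrix (D.reducedMatrix (D.slip Xs Us)) P) ∧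
    ∀ P : Mat, IsLyapunovMatrix (D.reducedMatrix (D.slip Xs Us)) P →
      ∃ εs > (0 : ℝ), ∃ r > (0 : ℝ), ∃ β > (0 : ℝ), ∃ σ > (0 : ℝ),
        ∀ ε : ℝ, 0 < ε → ε < εs →
        ∀ w₀ : StateSpace, lyapunov P Q (D.deviation Xs Us w₀) < r →
          ∃ w : ℝ → StateSpace, D.IsMildSolution ε Us w₀ w ∧
            (∀ v : ℝ → StateSpace, D.IsMildSolution ε Us w₀ v → EqOn v w (Ici 0)) ∧
            ∀ t : ℝ, 0 ≤ t →
              ‖D.deviation Xs Us (w t)‖ ≤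
                β * Real.exp (-σ * t) * ‖D.deviation Xs Us w₀‖ := by
  refine ⟨hH.exists_isLyapunovMatrix, fun P hP => ?_⟩
  obtain ⟨c, hQ⟩ := hA.exists_isWeight
  obtain ⟨κ, hG⟩ := hA.isMaxDissipative
  obtain ⟨cP, hPw⟩ := isWeight_op hP.1
  obtain ⟨M, hM, hprof⟩ := Model.exists_profileL2_lipschitz hR
  have hm : 0 < min (cP / 2) c := lt_min (half_pos hPw.pos) hQ.pos
  have hk : 0 < decayRate hA.weight κ := div_pos hG.pos (by positivity)
  obtain ⟨εs, hεs, r, hr, s, hs, ⟨R, hbdd⟩, hrate⟩ := Model.exists_lyapunovRate_le hA hS hR hE hP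
    hk (mul_nonneg hM (norm_nonneg (op D.A₂)))
  refine ⟨εs, hεs, r, hr, Real.sqrt ((‖op P‖ + ‖hA.weight‖ + 1) / min (cP / 2) c), by positivity,
    s / 4, by positivity, fun ε hε hlt w₀ h0 => ?_⟩
  obtain ⟨w, hw, hdecay⟩ := Model.exists_isMildSolution hA hS hR hP.1 hG hM hprof hε hs hbdd
    (hrate ε hε hlt) h0
  exact ⟨w, hw, fun v hv => Model.eqOn_of_isMildSolution hA hS hR hε hv hw, fun t ht =>
    Model.norm_le_of_lyapunov_le hA hPw hQ (hdecay t ht)⟩
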